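/- **Setting.** Let $d\in\{2,3\}$, let $\Omega\subset\mathbb R^d$ be a bounded open set (for example a bounded Lipschitz domain), and let $0<k_{\min}$, $k_{\max}$, $\sigma>0$ be constants. Let $k:\Omega\to\mathbb R^{d\times d}$ be measurable and symmetric with $k_{\min}|\zeta|^2\le \zeta^Tk(x)\zeta\le k_{\max}|\zeta|^2$ for all $\zeta\in\mathbb R^d$, $x\in\Omega$, and let $f\in L^2(\Omega)$. Write $(\cdot,\cdot)_D$ for the $L^2(D)$ inner product, $(\cdot,\cdot)=(\cdot,\cdot)_\Omega$; $H(\mathrm{div},D)$ for the fields in $[L^2(D)]^d$ with weak divergence in $L^2(D)$; and $H^0(\mathrm{div},D)$ for those with vanishing normal trace on $\partial D$. On $X\times Q=[L^2(\Omega)]^d\times H(\mathrm{div},\Omega)\times L^2(\Omega)$ put $$\|((\theta,u),p)\|_{X\times Q}=\|\theta\|_{0,\Omega}+\|u\|_{0,\Omega}+\|\mathrm{div}\,u\|_{0,\Omega}+\|p\|_{0,\Omega}.$$ The expanded mixed problem is: find $((\theta,u),p)\in X\times Q$ with $$(k\theta,\xi)+(u,\xi)=0,\qquad (\theta,\tau)+(p,\mathrm{div}\,\tau)=0,\qquad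 (\mathrm{div}\,u,q)=(f,q)\tag{1}$$ for all $\xi\in[L^2(\Omega)]^d$, $\tau\in H(\mathrm{div},\Omega)$, $q\in L^2(\Omega)$. **Mesh.** Let $\mathfrak T_h$ be a finite partition of $\Omega$ (that is, $\overline\Omega=\bigcup_{K\in\mathfrak T_h}K$, and the interior of each $K$ lies in $\Omega$) into closed nondegenerate cells, either all simplices or all axis-parallel boxes, any two of which meet in a (possibly empty) common face. Let $h=\max_K \mathrm{diam}\,K$, and let $\mathfrak T_h$ be quasi-uniform with constant $\sigma$: every $K$ contains a ball of radius $\sigma h$. Let $RT_0(K)$ be the lowest-order Raviart–Thomas space on $K$: the fields $a+bx$ with $a\in\mathbb R^d$, $b\in\mathbb R$ on a simplex, and $(a_i+b_ix_i)_{i=1}^d$ with $a,b\in\mathbb R^d$ on a box. Let $Q_h$ be the space of functions in $L^2(\Omega)$ that are constant on each cell. **Multiscale spaces.** For $\chi\in RT_0(K)$ let $((\eta^K_\chi,\psi^K_\chi),\phi^K_\chi)\in [L^2(K)]^d\times H(\mathrm{div},K)\times L^2(K)/\mathbb R$ solve $$(k\eta^K_\chi,\xi)_K+(\psi^K_\chi,\xi)_K=0,\qquad(\eta^K_\chi,\tau)_K+(\phi^K_\chi,\mathrm{div}\,\tau)_K=0,\qquad(\mathrm{div}\,\psi^K_\chi,q)_K=(\mathrm{div}\,\chi,q)_K$$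 for all $\xi\in[L^2(K)]^d$, $\tau\in H^0(\mathrm{div},K)$, $q\in L^2(K)$, with $\psi^K_\chi\cdot n=\chi\cdot n$ on $\partial K$. Put $$X_{1,h}=\{\theta\in[L^2(\Omega)]^d:\theta|_K\in\mathrm{span}\{\eta^K_\chi\}_{\chi\in RT_0(K)}\ \forall K\},\qquad X_{2,h}=\{u\in H(\mathrm{div},\Omega):u|_K\in\mathrm{span}\{\psi^K_\chi\}_{\chi\in RT_0(K)}\ \forall K\}$$ and $X_h=X_{1,h}\times X_{2,h}$. The local expanded mixed MsFEM problem is: find $((\theta_h,u_h),p_h)\in X_h\times Q_h$ with $$(k\theta_h,\xi_h)+(u_h,\xi_h)=0,\qquad(\theta_h,\tau_h)+(p_h,\mathrm{div}\,\tau_h)=0,\qquad(\mathrm{div}\,u_h,q_h)=(f,q_h)\tag{2}$$ for all $\xi_h\in X_{1,h}$, $\tau_h\in X_{2,h}$, $q_h\in Q_h$. **Theorem.** Problem (2) has a unique solution $((\theta_h,u_h),p_h)\in X_h\times Q_h$. Moreover there is a constant $C>0$, depending only on $\Omega$ (and $d$), the cell shape, $\sigma$, $k_{\min}$ and $k_{\max}$,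 and in particular not on $h$, such that every solution $((\theta,u),p)$ of (1) satisfies $$\|((\theta,u),p)-((\theta_h,u_h),p_h)\|_{X\times Q}\le C\inf_{((\xi_h,v_h),q_h)\in X_h\times Q_h}\|((\theta,u),p)-((\xi_h,v_h),q_h)\|_{X\times Q}.$$ -/

import Mathlib

open MeasureTheory Set
open scoped ContDiff InnerProductSpace

noncomputable section

namespace ExpandedMsFEM

/-- Euclidean space `ℝᵈ`. -/
abbrev E (d : ℕ) : Type := EuclideanSpace ℝ (Fin d)

/-- `L²(D)`. -/
abbrev L2 {d : ℕ} (D : Set (E d)) : Type := Lp ℝ 2 (volume.restrict D)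

/-- `[L²(D)]ᵈ`. -/
abbrev L2Vec {d : ℕ} (D : Set (E d)) : Type := Lp (E d) 2 (volume.restrict D)

/-! ### The space `H(div, D)` -/

/-- `g ∈ L²(D)` is the weak divergence of `v ∈ [L²(D)]ᵈ` on the open set `D`:
`∫_D v · ∇φ = - ∫_D g φ` for all `φ ∈ C_c^∞(D)`. -/
def IsWeakDiv {d : ℕ} (D : Set (E d)) (v : L2Vec D) (g : L2 D) : Prop :=
  ∀ φ : E d → ℝ, ContDiff ℝ ∞ φ → HasCompactSupport φ → tsupport φ ⊆ D →
    (∫ x in D, ⟪v x, gradient φ x⟫_ℝ) = -(∫ x in D, g x * φ x)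

/-- `H(div, D)`: the square integrable vector fields with a square integrable divergence. -/
def HDiv {d : ℕ} (D : Set (E d)) : Set (L2Vec D) := {v | ∃ g : L2 D, IsWeakDiv D v g}

open Classical in
/-- The weak divergence of `v ∈ H(div, D)` (on an open set `D` it is unique); `0` for fields outside
`H(div, D)`, a value that is never used. -/
def wdiv {d : ℕ} {D : Set (E d)} (v : L2Vec D) : L2 D :=
  if h : ∃ g : L2 D, IsWeakDiv D v g then h.choose else 0

/-- `H⁰(div, D)`: the fields in `H(div, D)` with `v · n = 0` on `∂D`. The normal trace is defined by
Green's formula, `⟨v · n, φ⟩ = ∫_D v · ∇φ + ∫_D (div v) φ`, with `φ` ranging over the smooth functions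
on the closure of `D` (restrictions of `C_c^∞(ℝᵈ)`). -/
def H0Div {d : ℕ} (D : Set (E d)) : Set (L2Vec D) :=
  {v | v ∈ HDiv D ∧ ∀ φ : E d → ℝ, ContDiff ℝ ∞ φ → HasCompactSupport φ →
    (∫ x in D, ⟪v x, gradient φ x⟫_ℝ) + (∫ x in D, wdiv v x * φ x) = 0}

/-! ### The coefficient and the continuous problem -/

/-- A matrix coefficient on `Ω`: measurable, symmetric, with
`kmin |ζ|² ≤ ζᵀ k(x) ζ ≤ kmax |ζ|²` for all `ζ` and all `x ∈ Ω`. -/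
structure IsCoefficient {d : ℕ} (Ω : Set (E d)) (kmin kmax : ℝ)
    (k : E d → Matrix (Fin d) (Fin d) ℝ) : Prop where
  measurable : ∀ i j, AEStronglyMeasurable (fun x => k x i j) (volume.restrict Ω)
  symm : ∀ x ∈ Ω, (k x).IsSymm
  lower : ∀ x ∈ Ω, ∀ ζ : E d, kmin * ‖ζ‖ ^ 2 ≤ ⟪ζ, Matrix.toEuclideanLin (k x) ζ⟫_ℝ
  upper : ∀ x ∈ Ω, ∀ ζ : E d, ⟪ζ, Matrix.toEuclideanLin (k x) ζ⟫_ℝ ≤ kmax * ‖ζ‖ ^ 2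

/-- `(k θ, ξ)_D = ∫_D k θ · ξ`. -/
def kForm {d : ℕ} {D : Set (E d)} (k : E d → Matrix (Fin d) (Fin d) ℝ) (θ ξ : L2Vec D) : ℝ :=
  ∫ x in D, ⟪Matrix.toEuclideanLin (k x) (θ x), ξ x⟫_ℝ

/-- The norm `‖((θ, u), p)‖_{X × Q} = ‖θ‖₀ + (‖u‖₀ + ‖div u‖₀) + ‖p‖₀`. -/
def xqNorm {d : ℕ} {D : Set (E d)} (z : L2Vec D × L2Vec D × L2 D) : ℝ :=
  ‖z.1‖ + (‖z.2.1‖ + ‖wdiv z.2.1‖) + ‖z.2.2‖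

/-- `z = (θ, u, p)` solves the expanded mixed system with trial and test spaces `X₁`, `X₂`, `Q`:
`(kθ, ξ) + (u, ξ) = 0` on `X₁`, `(θ, τ) + (p, div τ) = 0` on `X₂`, `(div u, q) = (f, q)` on `Q`. -/
structure SolvesExpandedMixed {d : ℕ} {Ω : Set (E d)} (k : E d → Matrix (Fin d) (Fin d) ℝ)
    (f : L2 Ω) (X₁ X₂ : Set (L2Vec Ω)) (Q : Set (L2 Ω))
    (z : L2Vec Ω × L2Vec Ω × L2 Ω) : Prop where
  mem : z ∈ X₁ ×ˢ X₂ ×ˢ Q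
  constitutive : ∀ ξ ∈ X₁, kForm k z.1 ξ + ⟪z.2.1, ξ⟫_ℝ = 0
  gradient : ∀ τ ∈ X₂, ⟪z.1, τ⟫_ℝ + ⟪z.2.2, wdiv τ⟫_ℝ = 0
  balance : ∀ q ∈ Q, ⟪wdiv z.2.1, q⟫_ℝ = ⟪f, q⟫_ℝ

/-- The continuous problem, posed on `[L²(Ω)]ᵈ × H(div, Ω) × L²(Ω)`. -/
def IsContinuousSolution {d : ℕ} {Ω : Set (E d)} (k : E d → Matrix (Fin d) (Fin d) ℝ)
    (f : L2 Ω) (z : L2Vec Ω × L2Vec Ω × L2 Ω) : Prop :=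
  SolvesExpandedMixed k f univ (HDiv Ω) univ z

/-! ### Meshes and the lowest-order Raviart-Thomas space -/

/-- The two classical element shapes: simplices (triangles, tetrahedra) and axis-parallel boxes
(rectangles, cuboids). -/
inductive CellType where
  | simplex
  | box

/-- `K` is a (closed, nondegenerate) cell of the given shape. -/
def IsCell {d : ℕ} : CellType → Set (E d) → Prop
  | .simplex, K => ∃ s : Affine.Simplex ℝ (E d) d, K = convexHull ℝ (range s.points)
  | .box, K => ∃ a b : E d, (∀ i, a i < b i) ∧ K = {x | ∀ i, a i ≤ x i ∧ x i ≤ b i}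

/-- The lowest-order Raviart-Thomas fields: `a + b x` with `a ∈ ℝᵈ`, `b ∈ ℝ` on simplices, and
`(aᵢ + bᵢ xᵢ)ᵢ` with `a, b ∈ ℝᵈ` on boxes. -/
def rt0Fields (d : ℕ) : CellType → Set (E d → E d)
  | .simplex => {v | ∃ (a : E d) (b : ℝ), v = fun x => a + b • x}
  | .box => {v | ∃ a b : E d, v = fun x => WithLp.toLp 2 fun i => a i + b i * x i}

/-- The mesh size `h`, the largest diameter of a cell. -/
def meshSize {d : ℕ} (T : Finset (Set (E d))) : ℝ := ⨆ K : T, Metric.diam (K : Set (E d))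

/-- `T` is a conforming partition of `Ω` into cells of shape `c`, quasi-uniform with constant `σ`. -/
structure IsMesh {d : ℕ} (c : CellType) (Ω : Set (E d)) (σ : ℝ) (T : Finset (Set (E d))) :
    Prop where
  cell : ∀ K ∈ T, IsCell c K
  /-- two cells meet in a (possibly empty) common face -/
  conforming : ∀ K ∈ T, ∀ K' ∈ T, IsExtreme ℝ K (K ∩ K')
  interior_subset : ∀ K ∈ T, interior K ⊆ Ω
  closure_eq : closure Ω = ⋃ K ∈ T, K
  /-- each cell contains a ball whose radius is comparable to the mesh size -/
  quasiUniform : ∀ K ∈ T, ∃ x, Metric.closedBall x (σ * meshSize T) ⊆ K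

/-! ### The multiscale spaces -/

/-- `RT₀(K)`, as a subset of `[L²(K)]ᵈ`; a cell is represented by its interior. -/
def RT0 {d : ℕ} (c : CellType) (K : Set (E d)) : Set (L2Vec (interior K)) :=
  {χ | ∃ v ∈ rt0Fields d c, χ =ᵐ[volume.restrict (interior K)] v}

/-- `((η, ψ), φ)` is a weak solution of the multiscale basis equation on `K` with data `χ`:
`ψ + kη = 0`, `η = ∇φ`, `div ψ = div χ` in `K` and `ψ · n = χ · n` on `∂K`. -/
structure SolvesBasisEquation {d : ℕ} (k : E d → Matrix (Fin d) (Fin d) ℝ) (K : Set (E d))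
    (χ η ψ : L2Vec (interior K)) (φ : L2 (interior K)) : Prop where
  mem : ψ ∈ HDiv (interior K)
  constitutive : ∀ ξ : L2Vec (interior K), kForm k η ξ + ⟪ψ, ξ⟫_ℝ = 0
  gradient : ∀ τ ∈ H0Div (interior K), ⟪η, τ⟫_ℝ + ⟪φ, wdiv τ⟫_ℝ = 0
  balance : ∀ q : L2 (interior K), ⟪wdiv ψ, q⟫_ℝ = ⟪wdiv χ, q⟫_ℝ
  normal_trace : ψ - χ ∈ H0Div (interior K)

/-- The local gradient space `span {η_χ : χ ∈ RT₀(K)}`. -/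
def localX1 {d : ℕ} (c : CellType) (k : E d → Matrix (Fin d) (Fin d) ℝ) (K : Set (E d)) :
    Submodule ℝ (L2Vec (interior K)) :=
  Submodule.span ℝ {η | ∃ χ ∈ RT0 c K, ∃ ψ φ, SolvesBasisEquation k K χ η ψ φ}

/-- The local velocity space `span {ψ_χ : χ ∈ RT₀(K)}`. -/
def localX2 {d : ℕ} (c : CellType) (k : E d → Matrix (Fin d) (Fin d) ℝ) (K : Set (E d)) :
    Submodule ℝ (L2Vec (interior K)) :=
  Submodule.span ℝ {ψ | ∃ χ ∈ RT0 c K, ∃ η φ, SolvesBasisEquation k K χ η ψ φ}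

/-- `X_{1,h}`: the fields in `[L²(Ω)]ᵈ` whose restriction to each cell is in the local gradient
space. -/
def X1h {d : ℕ} (c : CellType) (Ω : Set (E d)) (k : E d → Matrix (Fin d) (Fin d) ℝ)
    (T : Finset (Set (E d))) : Set (L2Vec Ω) :=
  {θ | ∀ K ∈ T, ∃ η ∈ localX1 c k K, θ =ᵐ[volume.restrict (interior K)] η}

/-- `X_{2,h}`: the fields in `H(div, Ω)` whose restriction to each cell is in the local velocity
space. -/
def X2h {d : ℕ} (c : CellType) (Ω : Set (E d)) (k : E d → Matrix (Fin d) (Fin d) ℝ)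
    (T : Finset (Set (E d))) : Set (L2Vec Ω) :=
  {u | u ∈ HDiv Ω ∧ ∀ K ∈ T, ∃ ψ ∈ localX2 c k K, u =ᵐ[volume.restrict (interior K)] ψ}

/-- `Q_h`, the pressure space of the `RT₀` pair: the functions that are constant on each cell. -/
def Qh {d : ℕ} (Ω : Set (E d)) (T : Finset (Set (E d))) : Set (L2 Ω) :=
  {q | ∀ K ∈ T, ∃ a : ℝ, q =ᵐ[volume.restrict (interior K)] fun _ => a}

/-- The discrete space `X_h × Q_h`, with `X_h = X_{1,h} × X_{2,h}`. -/
def XQh {d : ℕ} (c : CellType) (Ω : Set (E d)) (k : E d → Matrix (Fin d) (Fin d) ℝ)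
    (T : Finset (Set (E d))) : Set (L2Vec Ω × L2Vec Ω × L2 Ω) :=
  X1h c Ω k T ×ˢ X2h c Ω k T ×ˢ Qh Ω T

/-- The local expanded mixed MsFEM problem. -/
def IsMsFEMSolution {d : ℕ} {Ω : Set (E d)} (c : CellType)
    (k : E d → Matrix (Fin d) (Fin d) ℝ) (T : Finset (Set (E d))) (f : L2 Ω)
    (z : L2Vec Ω × L2Vec Ω × L2 Ω) : Prop :=
  SolvesExpandedMixed k f (X1h c Ω k T) (X2h c Ω k T) (Qh Ω T) z

end ExpandedMsFEM

end

/-! Both claims follow from one mesh-independent stability bound for the discrete twofold saddle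
point system, `IsStableTriple.norm_le`. With zero data it gives uniqueness, and existence follows
because the system is square. For quasi-optimality, the difference between the discrete solution and
any y in the discrete space solves the discrete system with residuals formed from z - y. Stability
bounds this difference by the norm of z - y, and the triangle inequality finishes.

Stability rests on three facts. Multiplication by k is bounded and coercive. Every discrete flux is
kζ for some ζ in the discrete gradient space (`exists_mem_X1Sub_kMul_eq`), because ψ = -kη cell by
cell. The divergence satisfies a discrete inf-sup condition.

The inf-sup condition is the heart of the proof. Since Ω is only bounded and open, no regularity
theory or interpolation is available, and an explicit field is used instead (`exists_stable_field`).
Let {q} on a facet F be half the sum of the values of q on the cells that have F as a facet; outside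
Ω the value counts as 0. Let τ be the Raviart-Thomas field with normal trace {q} x·n, where x is the
position field. With [q] denoting the jump, [q]{q} = [q²]/2, so (q, div τ) = ½ Σ_K q_K² ∫_K div x =
(d/2)‖q‖², which is at least ‖q‖² when d ≥ 2. On a cell, x = Σ γᵢ Xᵢ, where Xᵢ has flux only through
the i-th facet, and τ = Σ {q} γᵢ Xᵢ. Shape regularity and boundedness of Ω bound γᵢ Xᵢ uniformly,
hence ‖τ‖ ≤ C‖q‖.

That τ lies in H(div, Ω) is shown without surface integrals. The flux of φ Xᵢ is the volume integral
of div(φ Xᵢ). It depends only on φ restricted to the facet (`CellGeom.J_eq_zero`), and an affine map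
fixing the facet carries one neighbouring cell onto the other, so the two weighted fluxes cancel
(`CellGeom.γ_mul_J_of_facet_eq`).

Replacing τ on each cell by its multiscale counterpart preserves divergence and normal trace and
costs a factor kmax/kmin (`exists_mem_X2Sub_wdiv_eq`). The local problems are solved by Lax-Milgram
on the closure of the gradients, and a Poincaré inequality on convex cells recovers the potential
(`exists_solvesBasisEquation`). -/

noncomputable section

namespace ExpandedMsFEM

/-! ### Weak divergence and normal trace as identities against test functions. -/

variable {d : ℕ}

/-- Test functions `φ ∈ C_c^∞(ℝᵈ)`. -/
structure TestFun (d : ℕ) where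
  toFun : E d → ℝ
  smooth : ContDiff ℝ ∞ toFun
  compact : HasCompactSupport toFun

instance : CoeFun (TestFun d) fun _ => E d → ℝ := ⟨TestFun.toFun⟩

theorem gradient_eq_comp (φ : E d → ℝ) :
    gradient φ = fun x => (InnerProductSpace.toDual ℝ (E d)).symm (fderiv ℝ φ x) := rfl

theorem inner_gradient (φ : E d → ℝ) (x v : E d) : ⟪v, gradient φ x⟫_ℝ = fderiv ℝ φ x v := by
  rw [real_inner_comm, gradient_eq_comp]
  exact InnerProductSpace.toDual_symm_apply

theorem TestFun.differentiable (φ : TestFun d) : Differentiable ℝ φ :=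
  φ.smooth.differentiable (by simp)

theorem TestFun.continuous_gradient (φ : TestFun d) : Continuous (gradient φ) := by
  rw [gradient_eq_comp]
  exact (LinearIsometryEquiv.continuous _).comp (φ.smooth.continuous_fderiv (by simp))

theorem TestFun.hasCompactSupport_gradient (φ : TestFun d) : HasCompactSupport (gradient φ) := by
  rw [gradient_eq_comp]
  exact (φ.compact.fderiv ℝ).comp_left
    (g := (InnerProductSpace.toDual ℝ (E d)).symm) (map_zero _)

theorem TestFun.memLp_gradient (φ : TestFun d) (D : Set (E d)) :
    MemLp (gradient φ) 2 (volume.restrict D) :=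
  φ.continuous_gradient.memLp_of_hasCompactSupport φ.hasCompactSupport_gradient

theorem TestFun.memLp (φ : TestFun d) (D : Set (E d)) : MemLp φ 2 (volume.restrict D) :=
  φ.smooth.continuous.memLp_of_hasCompactSupport φ.compact

/-- The class of `∇φ` in `[L²(D)]ᵈ`. -/
def gradL (D : Set (E d)) (φ : TestFun d) : L2Vec D := (φ.memLp_gradient D).toLp

/-- The class of `φ` in `L²(D)`. -/
def testL (D : Set (E d)) (φ : TestFun d) : L2 D := (φ.memLp D).toLp

variable {D : Set (E d)}

theorem gradL_ae (φ : TestFun d) : gradL D φ =ᵐ[volume.restrict D] gradient φ :=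
  MemLp.coeFn_toLp _

theorem testL_ae (φ : TestFun d) : testL D φ =ᵐ[volume.restrict D] φ :=
  MemLp.coeFn_toLp _

theorem inner_L2Vec (u v : L2Vec D) : ⟪u, v⟫_ℝ = ∫ x in D, ⟪u x, v x⟫_ℝ := rfl

theorem inner_L2 (u v : L2 D) : ⟪u, v⟫_ℝ = ∫ x in D, u x * v x := by
  rw [L2.inner_def]
  refine integral_congr_ae (.of_forall fun x => ?_)
  simp [mul_comm]

theorem inner_gradL (v : L2Vec D) (φ : TestFun d) :
    ⟪v, gradL D φ⟫_ℝ = ∫ x in D, ⟪v x, gradient φ x⟫_ℝ := by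
  rw [inner_L2Vec]
  refine integral_congr_ae ?_
  filter_upwards [gradL_ae (D := D) φ] with x hx
  rw [hx]

theorem inner_testL (g : L2 D) (φ : TestFun d) :
    ⟪g, testL D φ⟫_ℝ = ∫ x in D, g x * φ x := by
  rw [inner_L2]
  refine integral_congr_ae ?_
  filter_upwards [testL_ae (D := D) φ] with x hx
  rw [hx]

theorem isWeakDiv_iff {v : L2Vec D} {g : L2 D} :
    IsWeakDiv D v g ↔ ∀ φ : TestFun d, tsupport φ ⊆ D →
      ⟪v, gradL D φ⟫_ℝ + ⟪g, testL D φ⟫_ℝ = 0 := by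
  constructor
  · intro h φ hφ
    rw [inner_gradL, inner_testL, h φ φ.smooth φ.compact hφ]
    ring
  · intro h φ h1 h2 h3
    have := h ⟨φ, h1, h2⟩ h3
    rw [inner_gradL, inner_testL] at this
    simpa using eq_neg_of_add_eq_zero_left this

theorem mem_H0Div_iff {v : L2Vec D} :
    v ∈ H0Div D ↔ v ∈ HDiv D ∧ ∀ φ : TestFun d,
      ⟪v, gradL D φ⟫_ℝ + ⟪wdiv v, testL D φ⟫_ℝ = 0 := by
  refine and_congr_right fun _ => ⟨fun h φ => ?_, fun h φ h1 h2 => ?_⟩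
  · rw [inner_gradL, inner_testL]
    exact h φ φ.smooth φ.compact
  · have := h ⟨φ, h1, h2⟩
    rwa [inner_gradL, inner_testL] at this

theorem eq_zero_of_inner_testL (hD : IsOpen D) {g : L2 D}
    (h : ∀ φ : TestFun d, tsupport φ ⊆ D → ⟪g, testL D φ⟫_ℝ = 0) : g = 0 := by
  rw [Lp.eq_zero_iff_ae_eq_zero]
  have hloc : LocallyIntegrableOn g D volume := by
    have h2 : LocallyIntegrable g (volume.restrict D) :=
      (Lp.memLp g).locallyIntegrable (by norm_num)
    exact locallyIntegrableOn_of_locallyIntegrable_restrict h2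
  have := hD.ae_eq_zero_of_integral_contDiff_smul_eq_zero hloc fun φ h1 h2 h3 => by
    have := h ⟨φ, h1, h2⟩ h3
    rw [inner_testL] at this
    rw [← setIntegral_eq_integral_of_forall_compl_eq_zero (s := D), ← this]
    · exact integral_congr_ae (.of_forall fun x => by simp [mul_comm])
    · intro x hx
      rw [image_eq_zero_of_notMem_tsupport (fun hx' => hx (h3 hx')), zero_smul]
  exact (ae_restrict_iff' hD.measurableSet).2 this

theorem IsWeakDiv.add {v w : L2Vec D} {g g' : L2 D} (h : IsWeakDiv D v g)
    (h' : IsWeakDiv D w g') : IsWeakDiv D (v + w) (g + g') := by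
  rw [isWeakDiv_iff] at *
  intro φ hφ
  rw [inner_add_left, inner_add_left]
  linarith [h φ hφ, h' φ hφ]

theorem IsWeakDiv.smul {v : L2Vec D} {g : L2 D} (c : ℝ) (h : IsWeakDiv D v g) :
    IsWeakDiv D (c • v) (c • g) := by
  rw [isWeakDiv_iff] at *
  intro φ hφ
  rw [real_inner_smul_left, real_inner_smul_left, ← mul_add, h φ hφ, mul_zero]

theorem IsWeakDiv.unique (hD : IsOpen D) {v : L2Vec D} {g g' : L2 D} (h : IsWeakDiv D v g)
    (h' : IsWeakDiv D v g') : g = g' := by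
  refine sub_eq_zero.1 (eq_zero_of_inner_testL hD fun φ hφ => ?_)
  rw [isWeakDiv_iff] at *
  rw [inner_sub_left]
  linarith [h φ hφ, h' φ hφ]

theorem isWeakDiv_wdiv {v : L2Vec D} (h : v ∈ HDiv D) : IsWeakDiv D v (wdiv v) := by
  have h' : ∃ g : L2 D, IsWeakDiv D v g := h
  rw [wdiv, dif_pos h']
  exact h'.choose_spec

theorem IsWeakDiv.wdiv_eq (hD : IsOpen D) {v : L2Vec D} {g : L2 D} (h : IsWeakDiv D v g) :
    wdiv v = g :=
  (isWeakDiv_wdiv ⟨g, h⟩).unique hD h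

theorem isWeakDiv_zero : IsWeakDiv D (0 : L2Vec D) 0 := by
  rw [isWeakDiv_iff]
  intro φ _
  simp

/-- `H(div, D)` as a subspace. -/
def hdivSub (D : Set (E d)) : Submodule ℝ (L2Vec D) where
  carrier := HDiv D
  add_mem' := fun ⟨_, ha⟩ ⟨_, hb⟩ => ⟨_, ha.add hb⟩
  zero_mem' := ⟨0, isWeakDiv_zero⟩
  smul_mem' := fun c _ ⟨_, ha⟩ => ⟨_, ha.smul c⟩

theorem wdiv_add (hD : IsOpen D) {v w : L2Vec D} (hv : v ∈ HDiv D) (hw : w ∈ HDiv D) :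
    wdiv (v + w) = wdiv v + wdiv w :=
  ((isWeakDiv_wdiv hv).add (isWeakDiv_wdiv hw)).wdiv_eq hD

theorem wdiv_smul (hD : IsOpen D) {v : L2Vec D} (c : ℝ) (hv : v ∈ HDiv D) :
    wdiv (c • v) = c • wdiv v :=
  ((isWeakDiv_wdiv hv).smul c).wdiv_eq hD

theorem wdiv_zero (hD : IsOpen D) : wdiv (0 : L2Vec D) = 0 := isWeakDiv_zero.wdiv_eq hD

theorem wdiv_sub (hD : IsOpen D) {v w : L2Vec D} (hv : v ∈ HDiv D) (hw : w ∈ HDiv D) :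
    wdiv (v - w) = wdiv v - wdiv w := by
  have h := ((isWeakDiv_wdiv hv).add ((isWeakDiv_wdiv hw).smul (-1))).wdiv_eq hD
  rw [neg_one_smul, neg_one_smul, ← sub_eq_add_neg, ← sub_eq_add_neg] at h
  exact h

/-- Testing with all smooth functions, not only those supported in D, encodes the weak divergence
and the vanishing normal trace at once. -/
theorem mem_H0Div_of_forall (hD : IsOpen D) {v : L2Vec D} {g : L2 D}
    (h : ∀ φ : TestFun d, ⟪v, gradL D φ⟫_ℝ + ⟪g, testL D φ⟫_ℝ = 0) :
    v ∈ H0Div D ∧ wdiv v = g := by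
  have h1 : IsWeakDiv D v g := isWeakDiv_iff.2 fun φ _ => h φ
  have h2 := h1.wdiv_eq hD
  exact ⟨mem_H0Div_iff.2 ⟨⟨g, h1⟩, by rwa [h2]⟩, h2⟩

theorem H0Div_add (hD : IsOpen D) {v w : L2Vec D} (hv : v ∈ H0Div D) (hw : w ∈ H0Div D) :
    v + w ∈ H0Div D := by
  rw [mem_H0Div_iff] at hv hw
  refine (mem_H0Div_of_forall hD (g := wdiv v + wdiv w) fun φ => ?_).1
  rw [inner_add_left, inner_add_left]
  linarith [hv.2 φ, hw.2 φ]

theorem H0Div_smul (hD : IsOpen D) {v : L2Vec D} (c : ℝ) (hv : v ∈ H0Div D) :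
    c • v ∈ H0Div D := by
  rw [mem_H0Div_iff] at hv
  refine (mem_H0Div_of_forall hD (g := c • wdiv v) fun φ => ?_).1
  rw [real_inner_smul_left, real_inner_smul_left, ← mul_add, hv.2 φ, mul_zero]

end ExpandedMsFEM

end

noncomputable section

namespace ExpandedMsFEM

variable {d : ℕ} {D Ω : Set (E d)}

/-! ### The operator of multiplication by the coefficient -/

/-- The ellipticity assumptions control only the quadratic form. Symmetry turns this into an
operator bound by polarisation: 4⟪Av, w⟫ is the form at v + w minus the form at v - w. -/
theorem norm_apply_le_of_symmetric {V : Type*} [NormedAddCommGroup V] [InnerProductSpace ℝ V]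
    (A : V →ₗ[ℝ] V) (hA : A.IsSymmetric) {M : ℝ} (h0 : ∀ v, 0 ≤ ⟪v, A v⟫_ℝ)
    (hM : ∀ v, ⟪v, A v⟫_ℝ ≤ M * ‖v‖ ^ 2) (hM0 : 0 < M) (v : V) : ‖A v‖ ≤ M * ‖v‖ := by
  have key : ∀ w : V, 4 * ⟪A v, w⟫_ℝ ≤ 2 * M * (‖v‖ ^ 2 + ‖w‖ ^ 2) := by
    intro w
    have h1 := hM (v + w)
    have h2 := h0 (v - w)
    have h3 := parallelogram_law_with_norm ℝ v w
    have h4 : ⟪w, A v⟫_ℝ = ⟪A v, w⟫_ℝ := real_inner_comm _ _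
    have h5 : ⟪v, A w⟫_ℝ = ⟪A v, w⟫_ℝ := (hA v w).symm
    rw [map_add, inner_add_left, inner_add_right, inner_add_right] at h1
    rw [map_sub, inner_sub_left, inner_sub_right, inner_sub_right] at h2
    have h6 : M * ‖v + w‖ ^ 2 ≤ M * (2 * (‖v‖ ^ 2 + ‖w‖ ^ 2)) := by
      refine mul_le_mul_of_nonneg_left ?_ hM0.le
      nlinarith [mul_self_nonneg ‖v - w‖]
    linarith
  -- This w makes the term in ‖w‖² half as large as the left side, so it can be absorbed.
  have h := key (M⁻¹ • A v)
  rw [real_inner_smul_right, real_inner_self_eq_norm_sq, norm_smul, Real.norm_eq_abs,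
    abs_of_pos (inv_pos.2 hM0)] at h
  have h7 : ‖A v‖ ^ 2 ≤ (M * ‖v‖) ^ 2 := by
    have h8 : M⁻¹ * ‖A v‖ ^ 2 ≤ M * ‖v‖ ^ 2 := by
      have : 2 * M * (M⁻¹ * ‖A v‖) ^ 2 = 2 * (M⁻¹ * ‖A v‖ ^ 2) := by field_simp
      nlinarith
    rw [inv_mul_le_iff₀ hM0] at h8
    nlinarith
  exact le_of_sq_le_sq h7 (by positivity)

variable {kmin kmax : ℝ} {k : E d → Matrix (Fin d) (Fin d) ℝ}

theorem IsCoefficient.mono (hk : IsCoefficient Ω kmin kmax k) (hD : D ⊆ Ω) :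
    IsCoefficient D kmin kmax k where
  measurable i j := (hk.measurable i j).mono_measure (Measure.restrict_mono hD le_rfl)
  symm x hx := hk.symm x (hD hx)
  lower x hx := hk.lower x (hD hx)
  upper x hx := hk.upper x (hD hx)

theorem IsCoefficient.mono_max (hk : IsCoefficient Ω kmin kmax k) {M : ℝ} (hM : kmax ≤ M) :
    IsCoefficient Ω kmin M k where
  measurable := hk.measurable
  symm := hk.symm
  lower := hk.lower
  upper x hx ζ := (hk.upper x hx ζ).trans (by gcongr)

theorem isSymmetric_toEuclideanLin {A : Matrix (Fin d) (Fin d) ℝ} (hA : A.IsSymm) :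
    (Matrix.toEuclideanLin A).IsSymmetric := by
  rw [Matrix.isSymmetric_toEuclideanLin_iff, Matrix.IsHermitian,
    Matrix.conjTranspose_eq_transpose_of_trivial]
  exact hA

/-- The hypotheses under which the coefficient acts on `[L²(D)]ᵈ`. -/
structure GoodCoefficient (D : Set (E d)) (kmin kmax : ℝ)
    (k : E d → Matrix (Fin d) (Fin d) ℝ) : Prop where
  isOpen : IsOpen D
  coeff : IsCoefficient D kmin kmax k
  pos : 0 < kmin
  le : kmin ≤ kmax

theorem GoodCoefficient.mono (hk : GoodCoefficient Ω kmin kmax k) (hD : IsOpen D)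
    (h : D ⊆ Ω) : GoodCoefficient D kmin kmax k :=
  ⟨hD, hk.coeff.mono h, hk.pos, hk.le⟩

theorem GoodCoefficient.pos' (hk : GoodCoefficient D kmin kmax k) : 0 < kmax :=
  hk.pos.trans_le hk.le

theorem GoodCoefficient.norm_le (hk : GoodCoefficient D kmin kmax k) {x : E d} (hx : x ∈ D)
    (ζ : E d) : ‖Matrix.toEuclideanLin (k x) ζ‖ ≤ kmax * ‖ζ‖ :=
  norm_apply_le_of_symmetric _ (isSymmetric_toEuclideanLin (hk.coeff.symm x hx))
    (fun v => (mul_nonneg hk.pos.le (by positivity)).trans (hk.coeff.lower x hx v))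
    (hk.coeff.upper x hx) hk.pos' ζ

theorem GoodCoefficient.ae (hk : GoodCoefficient D kmin kmax k) :
    ∀ᵐ x ∂(volume.restrict D), x ∈ D := ae_restrict_mem hk.isOpen.measurableSet

theorem GoodCoefficient.memLp (hk : GoodCoefficient D kmin kmax k) (θ : L2Vec D) :
    MemLp (fun x => Matrix.toEuclideanLin (k x) (θ x)) 2 (volume.restrict D) := by
  refine MemLp.of_le_mul (Lp.memLp θ) (c := kmax) ?_ ?_
  · have hθ := (Lp.aestronglyMeasurable θ).aemeasurable
    refine AEMeasurable.aestronglyMeasurable ?_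
    have : ∀ i, AEMeasurable (fun x => (Matrix.toEuclideanLin (k x) (θ x)).ofLp i)
        (volume.restrict D) := by
      intro i
      have h2 : (fun x => (Matrix.toEuclideanLin (k x) (θ x)).ofLp i)
          = fun x => ∑ j, k x i j * (θ x).ofLp j := by
        funext x
        simp [Matrix.toEuclideanLin, Matrix.mulVec, dotProduct]
      rw [h2]
      refine Finset.aemeasurable_fun_sum _ fun j _ => ?_
      refine (hk.coeff.measurable i j).aemeasurable.mul ?_
      exact (EuclideanSpace.proj (𝕜 := ℝ) j).continuous.measurable.comp_aemeasurable hθ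
    have h3 := aemeasurable_pi_lambda _ this
    exact (WithLp.measurable_toLp 2 (Fin d → ℝ)).comp_aemeasurable h3
  · filter_upwards [hk.ae] with x hx using hk.norm_le hx _

/-- Multiplication by the coefficient on `[L²(D)]ᵈ`. -/
def kMulLin (hk : GoodCoefficient D kmin kmax k) : L2Vec D →ₗ[ℝ] L2Vec D where
  toFun θ := (hk.memLp θ).toLp
  map_add' θ ξ := by
    refine Lp.ext ?_
    filter_upwards [(hk.memLp θ).coeFn_toLp, (hk.memLp ξ).coeFn_toLp,
      (hk.memLp (θ + ξ)).coeFn_toLp, Lp.coeFn_add θ ξ,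
      Lp.coeFn_add ((hk.memLp θ).toLp) ((hk.memLp ξ).toLp)] with x h1 h2 h3 h4 h5
    rw [h3, h5, h4, Pi.add_apply, Pi.add_apply, map_add, h1, h2]
  map_smul' c θ := by
    refine Lp.ext ?_
    filter_upwards [(hk.memLp θ).coeFn_toLp,
      (hk.memLp (c • θ)).coeFn_toLp, Lp.coeFn_smul c θ,
      Lp.coeFn_smul c ((hk.memLp θ).toLp)] with x h1 h3 h4 h5
    rw [RingHom.id_apply, h3, h5, h4, Pi.smul_apply, Pi.smul_apply, map_smul, h1]

theorem kMulLin_ae (hk : GoodCoefficient D kmin kmax k) (θ : L2Vec D) :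
    kMulLin hk θ =ᵐ[volume.restrict D] fun x => Matrix.toEuclideanLin (k x) (θ x) :=
  (hk.memLp θ).coeFn_toLp

theorem norm_kMulLin_le (hk : GoodCoefficient D kmin kmax k) (θ : L2Vec D) :
    ‖kMulLin hk θ‖ ≤ kmax * ‖θ‖ := by
  refine Lp.norm_le_mul_norm_of_ae_le_mul ?_
  filter_upwards [hk.ae, kMulLin_ae hk θ] with x hx h1
  rw [h1]
  exact hk.norm_le hx _

/-- Multiplication by the coefficient on `[L²(D)]ᵈ`, as a bounded operator. -/
def kMul (hk : GoodCoefficient D kmin kmax k) : L2Vec D →L[ℝ] L2Vec D :=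
  (kMulLin hk).mkContinuous kmax (norm_kMulLin_le hk)

theorem kMul_ae (hk : GoodCoefficient D kmin kmax k) (θ : L2Vec D) :
    kMul hk θ =ᵐ[volume.restrict D] fun x => Matrix.toEuclideanLin (k x) (θ x) :=
  kMulLin_ae hk θ

theorem norm_kMul_le (hk : GoodCoefficient D kmin kmax k) (θ : L2Vec D) :
    ‖kMul hk θ‖ ≤ kmax * ‖θ‖ := norm_kMulLin_le hk θ

theorem kForm_eq (hk : GoodCoefficient D kmin kmax k) (θ ξ : L2Vec D) :
    kForm k θ ξ = ⟪kMul hk θ, ξ⟫_ℝ := by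
  rw [inner_L2Vec, kForm]
  refine integral_congr_ae ?_
  filter_upwards [kMul_ae hk θ] with x hx
  rw [hx]

theorem kMul_coercive (hk : GoodCoefficient D kmin kmax k) (θ : L2Vec D) :
    kmin * ‖θ‖ ^ 2 ≤ ⟪kMul hk θ, θ⟫_ℝ := by
  rw [← real_inner_self_eq_norm_sq, inner_L2Vec, inner_L2Vec, ← integral_const_mul]
  refine integral_mono_ae ((L2.integrable_inner θ θ).const_mul _)
    (L2.integrable_inner (kMul hk θ) θ) ?_
  filter_upwards [hk.ae, kMul_ae hk θ] with x hx h1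
  rw [h1, real_inner_self_eq_norm_sq, real_inner_comm]
  exact hk.coeff.lower x hx _

/-- Lax-Milgram. It supplies a global preimage of a discrete flux, which is then identified cell by
cell. -/
theorem kMul_surjective (hk : GoodCoefficient D kmin kmax k) :
    Function.Surjective (kMul hk) := by
  have hc : IsCoercive ((innerSL ℝ).comp (kMul hk) : L2Vec D →L[ℝ] L2Vec D →L[ℝ] ℝ) := by
    refine ⟨kmin, hk.pos, fun u => ?_⟩
    have := kMul_coercive hk u
    simp only [ContinuousLinearMap.comp_apply, innerSL_apply_apply]
    nlinarith
  intro u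
  refine ⟨hc.continuousLinearEquivOfBilin.symm u, ?_⟩
  refine ext_inner_right ℝ fun w => ?_
  have := hc.continuousLinearEquivOfBilin_apply (hc.continuousLinearEquivOfBilin.symm u) w
  rw [ContinuousLinearEquiv.apply_symm_apply] at this
  rw [this]
  rfl

theorem kMul_injective (hk : GoodCoefficient D kmin kmax k) :
    Function.Injective (kMul hk) := by
  rw [injective_iff_map_eq_zero]
  intro θ h
  have := kMul_coercive hk θ
  rw [h, inner_zero_left] at this
  have h2 := hk.pos
  have : ‖θ‖ ^ 2 ≤ 0 := by nlinarith [sq_nonneg ‖θ‖]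
  simpa using this

/-! ### Restriction to and gluing from the pieces of a partition -/

section Glue

variable {F : Type*} [NormedAddCommGroup F] [NormedSpace ℝ F]

/-- Restriction from `L²(Ω)` to `L²(D)`. -/
def res (h : D ⊆ Ω) : Lp F 2 (volume.restrict Ω) →ₗ[ℝ] Lp F 2 (volume.restrict D) where
  toFun u := ((Lp.memLp u).mono_measure (Measure.restrict_mono h le_rfl)).toLp
  map_add' u v := by
    refine Lp.ext ?_
    filter_upwards [((Lp.memLp u).mono_measure (Measure.restrict_mono h le_rfl)).coeFn_toLp,
      ((Lp.memLp v).mono_measure (Measure.restrict_mono h le_rfl)).coeFn_toLp,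
      ((Lp.memLp (u + v)).mono_measure (Measure.restrict_mono h le_rfl)).coeFn_toLp,
      ae_restrict_of_ae_restrict_of_subset h (Lp.coeFn_add u v),
      Lp.coeFn_add ((Lp.memLp u).mono_measure (Measure.restrict_mono h le_rfl)).toLp
        ((Lp.memLp v).mono_measure (Measure.restrict_mono h le_rfl)).toLp]
      with x h1 h2 h3 h4 h5
    rw [h3, h5, h4, Pi.add_apply, Pi.add_apply, h1, h2]
  map_smul' c u := by
    refine Lp.ext ?_
    filter_upwards [((Lp.memLp u).mono_measure (Measure.restrict_mono h le_rfl)).coeFn_toLp,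
      ((Lp.memLp (c • u)).mono_measure (Measure.restrict_mono h le_rfl)).coeFn_toLp,
      ae_restrict_of_ae_restrict_of_subset h (Lp.coeFn_smul c u),
      Lp.coeFn_smul c ((Lp.memLp u).mono_measure (Measure.restrict_mono h le_rfl)).toLp]
      with x h1 h3 h4 h5
    rw [RingHom.id_apply, h3, h5, h4, Pi.smul_apply, Pi.smul_apply, h1]

theorem res_ae (h : D ⊆ Ω) (u : Lp F 2 (volume.restrict Ω)) :
    res h u =ᵐ[volume.restrict D] u :=
  ((Lp.memLp u).mono_measure (Measure.restrict_mono h le_rfl)).coeFn_toLp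

theorem res_eq_iff (h : D ⊆ Ω) {u : Lp F 2 (volume.restrict Ω)}
    {v : Lp F 2 (volume.restrict D)} : res h u = v ↔ u =ᵐ[volume.restrict D] v := by
  rw [Lp.ext_iff]
  exact ⟨fun h' => (res_ae h u).symm.trans h', fun h' => (res_ae h u).trans h'⟩

/-- The interiors of the cells of `T` partition `Ω` up to a null set. -/
structure IsPartition (Ω : Set (E d)) (T : Finset (Set (E d))) : Prop where
  sub : ∀ K ∈ T, interior K ⊆ Ω
  disj : ∀ K ∈ T, ∀ K' ∈ T, K ≠ K' → Disjoint (interior K) (interior K')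
  null : volume (Ω \ ⋃ K ∈ T, interior K) = 0

variable {T : Finset (Set (E d))}

theorem IsPartition.ae_eq (hT : IsPartition Ω T) :
    (⋃ K ∈ T, interior K : Set (E d)) =ᵐ[volume] Ω :=
  (iUnion₂_subset hT.sub).eventuallyLE.antisymm (ae_le_set.2 hT.null)

theorem IsPartition.integral (hT : IsPartition Ω T) {f : E d → ℝ} (hf : IntegrableOn f Ω) :
    ∫ x in Ω, f x = ∑ K ∈ T, ∫ x in interior K, f x := by
  rw [← setIntegral_congr_set hT.ae_eq]
  refine integral_biUnion_finset T (fun K _ => isOpen_interior.measurableSet) ?_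
    fun K hK => hf.mono_set (hT.sub K hK)
  intro K hK K' hK' hne
  exact hT.disj K hK K' hK' hne

theorem IsPartition.ae_of_forall (hT : IsPartition Ω T) {p : E d → Prop}
    (h : ∀ K ∈ T, ∀ᵐ x ∂(volume.restrict (interior K)), p x) :
    ∀ᵐ x ∂(volume.restrict Ω), p x := by
  rw [← Measure.restrict_congr_set hT.ae_eq, ae_restrict_biUnion_finset_iff]
  exact h

theorem IsPartition.ext (hT : IsPartition Ω T) {u v : Lp F 2 (volume.restrict Ω)}
    (h : ∀ K (hK : K ∈ T), res (hT.sub K hK) u = res (hT.sub K hK) v) : u = v := by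
  refine Lp.ext (hT.ae_of_forall fun K hK => ?_)
  have := (res_eq_iff _).1 (h K hK)
  exact this.trans (res_ae _ v)

/-- The field on `Ω` with given restrictions to the cells. -/
def glue (Ω : Set (E d)) (T : Finset (Set (E d)))
    (v : ∀ K : Set (E d), Lp F 2 (volume.restrict (interior K))) : Lp F 2 (volume.restrict Ω) :=
  ((memLp_finsetSum (μ := volume) T fun K _ =>
    (memLp_indicator_iff_restrict isOpen_interior.measurableSet).2 (Lp.memLp (v K))).mono_measure
      Measure.restrict_le_self : MemLp (fun x => ∑ K ∈ T, (interior K).indicator (v K) x) 2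
        (volume.restrict Ω)).toLp

theorem IsPartition.glue_ae (hT : IsPartition Ω T)
    (v : ∀ K : Set (E d), Lp F 2 (volume.restrict (interior K))) {K : Set (E d)} (hK : K ∈ T) :
    glue Ω T v =ᵐ[volume.restrict (interior K)] v K := by
  have h1 : glue Ω T v =ᵐ[volume.restrict Ω] _ := MemLp.coeFn_toLp _
  filter_upwards [ae_restrict_of_ae_restrict_of_subset (hT.sub K hK) h1,
    ae_restrict_mem isOpen_interior.measurableSet] with x h2 hx
  rw [h2, Finset.sum_eq_single_of_mem K hK, indicator_of_mem hx]
  intro K' hK' hne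
  exact indicator_of_notMem
    (fun hx' => disjoint_left.1 (hT.disj K' hK' K hK hne) hx' hx) _

theorem IsPartition.res_glue (hT : IsPartition Ω T)
    (v : ∀ K : Set (E d), Lp F 2 (volume.restrict (interior K))) {K : Set (E d)} (hK : K ∈ T) :
    res (hT.sub K hK) (glue Ω T v) = v K :=
  (res_eq_iff _).2 (hT.glue_ae v hK)

theorem IsPartition.inner_vec (hT : IsPartition Ω T) (u v : L2Vec Ω) :
    ⟪u, v⟫_ℝ = ∑ K ∈ T.attach, ⟪res (hT.sub K K.2) u, res (hT.sub K K.2) v⟫_ℝ := by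
  rw [inner_L2Vec, hT.integral (L2.integrable_inner u v), ← Finset.sum_attach]
  refine Finset.sum_congr rfl fun K _ => ?_
  rw [inner_L2Vec]
  refine integral_congr_ae ?_
  filter_upwards [res_ae (hT.sub K K.2) u, res_ae (hT.sub K K.2) v] with x h1 h2
  rw [h1, h2]

theorem IsPartition.inner_scalar (hT : IsPartition Ω T) (u v : L2 Ω) :
    ⟪u, v⟫_ℝ = ∑ K ∈ T.attach, ⟪res (hT.sub K K.2) u, res (hT.sub K K.2) v⟫_ℝ := by
  have h0 : IntegrableOn (fun x => u x * v x) Ω := by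
    refine (L2.integrable_inner (𝕜 := ℝ) u v).congr (.of_forall fun x => ?_)
    simp [mul_comm]
  rw [inner_L2, hT.integral h0, ← Finset.sum_attach]
  refine Finset.sum_congr rfl fun K _ => ?_
  rw [inner_L2]
  refine integral_congr_ae ?_
  filter_upwards [res_ae (hT.sub K K.2) u, res_ae (hT.sub K K.2) v] with x h1 h2
  rw [h1, h2]

end Glue

/-! ### Restriction of test functions, weak divergences and the coefficient to a subdomain. -/

theorem res_gradL (h : D ⊆ Ω) (φ : TestFun d) : res h (gradL Ω φ) = gradL D φ :=
  (res_eq_iff h).2 (Filter.EventuallyEq.trans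
    (ae_restrict_of_ae_restrict_of_subset h (gradL_ae φ)) (gradL_ae φ).symm)

theorem res_testL (h : D ⊆ Ω) (φ : TestFun d) : res h (testL Ω φ) = testL D φ :=
  (res_eq_iff h).2 (Filter.EventuallyEq.trans
    (ae_restrict_of_ae_restrict_of_subset h (testL_ae φ)) (testL_ae φ).symm)

theorem setIntegral_eq_of_support_subset {f : E d → ℝ} (hΩ : MeasurableSet Ω) (h : D ⊆ Ω) (hf : ∀ x ∉ D, f x = 0) :
    ∫ x in Ω, f x = ∫ x in D, f x :=
  setIntegral_eq_of_subset_of_forall_sdiff_eq_zero hΩ h fun x hx => hf x hx.2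

theorem IsWeakDiv.restrict (hΩ : IsOpen Ω) (h : D ⊆ Ω) {v : L2Vec Ω} {g : L2 Ω}
    (hv : IsWeakDiv Ω v g) : IsWeakDiv D (res h v) (res h g) := by
  intro φ h1 h2 h3
  have h4 := hv φ h1 h2 (h3.trans h)
  have h5 : ∀ x ∉ D, φ x = 0 := fun x hx => image_eq_zero_of_notMem_tsupport fun h' => hx (h3 h')
  have h6 : ∀ x ∉ D, gradient φ x = 0 := fun x hx => by
    rw [gradient_eq_comp]
    simp only
    rw [image_eq_zero_of_notMem_tsupport (f := fderiv ℝ φ)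
      (fun h' => hx (h3 (tsupport_fderiv_subset ℝ h'))), map_zero]
  rw [setIntegral_eq_of_support_subset hΩ.measurableSet h
      (fun x hx => by rw [h6 x hx, inner_zero_right]),
    setIntegral_eq_of_support_subset hΩ.measurableSet h
      (fun x hx => by rw [h5 x hx, mul_zero])] at h4
  have h7 : ∫ x in D, ⟪ExpandedMsFEM.res h v x, gradient φ x⟫_ℝ
      = ∫ x in D, ⟪v x, gradient φ x⟫_ℝ := by
    refine integral_congr_ae ?_
    filter_upwards [res_ae h v] with x hx
    rw [hx]
  have h8 : ∫ x in D, ExpandedMsFEM.res h g x * φ x = ∫ x in D, g x * φ x := by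
    refine integral_congr_ae ?_
    filter_upwards [res_ae h g] with x hx
    rw [hx]
  rw [h7, h8, h4]

theorem res_mem_HDiv (hD : IsOpen D) (hΩ : IsOpen Ω) (h : D ⊆ Ω) {v : L2Vec Ω}
    (hv : v ∈ HDiv Ω) : res h v ∈ HDiv D ∧ wdiv (res h v) = res h (wdiv v) :=
  ⟨⟨_, (isWeakDiv_wdiv hv).restrict hΩ h⟩, ((isWeakDiv_wdiv hv).restrict hΩ h).wdiv_eq hD⟩

theorem res_kMul {hk : GoodCoefficient Ω kmin kmax k} (hk' : GoodCoefficient D kmin kmax k)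
    (h : D ⊆ Ω) (θ : L2Vec Ω) : res h (kMul hk θ) = kMul hk' (res h θ) := by
  rw [res_eq_iff]
  filter_upwards [ae_restrict_of_ae_restrict_of_subset h (kMul_ae hk θ), kMul_ae hk' (res h θ),
    res_ae h θ] with x h1 h2 h3
  rw [h1, h2, h3]

end ExpandedMsFEM

end

noncomputable section

namespace ExpandedMsFEM

open scoped ENNReal

variable {d : ℕ} {D : Set (E d)}

/-! ### The Poincaré inequality on bounded convex sets -/

/-- The map y ↦ (1-t)x + ty sends D into itself by convexity and has Jacobian t^d ≥ 2^(-d). -/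
theorem lintegral_comp_segment_le (hD : MeasurableSet D) (hc : Convex ℝ D) {x : E d} (hx : x ∈ D)
    {t : ℝ} (ht : 1 / 2 ≤ t) (ht1 : t ≤ 1) (G : E d → ℝ≥0∞) :
    ∫⁻ y in D, G ((1 - t) • x + t • y) ≤ 2 ^ d * ∫⁻ z in D, G z := by
  have h0 : (0 : ℝ) < t := by linarith
  have hd : ∀ y ∈ D, HasFDerivWithinAt (fun y : E d => (1 - t) • x + t • y)
      (t • ContinuousLinearMap.id ℝ (E d)) D y := fun y _ =>
    (((hasFDerivAt_id y).const_smul t).const_add _).hasFDerivWithinAt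
  have hinj : InjOn (fun y : E d => (1 - t) • x + t • y) D := by
    intro y _ z _ h
    simpa [h0.ne'] using h
  have h1 := lintegral_image_eq_lintegral_abs_det_fderiv_mul volume hD hd hinj G
  have hsub : (fun y : E d => (1 - t) • x + t • y) '' D ⊆ D := by
    rintro _ ⟨y, hy, rfl⟩
    exact hc hx hy (by linarith) h0.le (by ring)
  have hdet : (t • ContinuousLinearMap.id ℝ (E d)).det = t ^ d := by
    simp [ContinuousLinearMap.det, LinearMap.det_smul]
  rw [hdet, abs_of_pos (by positivity), lintegral_const_mul' _ _ ENNReal.ofReal_ne_top] at h1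
  have h2 : (1 : ℝ≥0∞) ≤ 2 ^ d * ENNReal.ofReal (t ^ d) := by
    have : (2 : ℝ≥0∞) ^ d = ENNReal.ofReal (2 ^ d) := by
      rw [ENNReal.ofReal_pow (by norm_num)]; simp
    rw [this, ← ENNReal.ofReal_mul (by positivity), ← mul_pow, ENNReal.one_le_ofReal]
    exact one_le_pow₀ (by linarith)
  calc ∫⁻ y in D, G ((1 - t) • x + t • y)
      ≤ 2 ^ d * ENNReal.ofReal (t ^ d) * ∫⁻ y in D, G ((1 - t) • x + t • y) :=
        le_mul_of_one_le_left' h2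
    _ = 2 ^ d * ∫⁻ z in (fun y : E d => (1 - t) • x + t • y) '' D, G z := by
        rw [h1, mul_assoc]
    _ ≤ 2 ^ d * ∫⁻ z in D, G z := by
        gcongr

/-- For t below 1/2 the roles of x and y are exchanged, so the variable integrated first always
carries a weight of at least 1/2 and the Jacobian never degenerates. -/
theorem lintegral_lintegral_segment_le (hD : MeasurableSet D) (hc : Convex ℝ D)
    {t : ℝ} (ht : 0 ≤ t) (ht1 : t ≤ 1) {G : E d → ℝ≥0∞} (hG : Measurable G) :
    ∫⁻ x in D, ∫⁻ y in D, G ((1 - t) • x + t • y) ≤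
      2 ^ d * (∫⁻ z in D, G z) * volume D := by
  rcases le_total (1 / 2) t with h | h
  · calc ∫⁻ x in D, ∫⁻ y in D, G ((1 - t) • x + t • y)
        ≤ ∫⁻ _ in D, 2 ^ d * ∫⁻ z in D, G z :=
          setLIntegral_mono' hD fun x hx => lintegral_comp_segment_le hD hc hx h ht1 G
      _ = _ := by rw [setLIntegral_const]
  · rw [lintegral_lintegral_swap (by fun_prop)]
    calc ∫⁻ y in D, ∫⁻ x in D, G ((1 - t) • x + t • y)
        ≤ ∫⁻ _ in D, 2 ^ d * ∫⁻ z in D, G z := by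
          refine setLIntegral_mono' hD fun y hy => ?_
          have := lintegral_comp_segment_le hD hc hy (t := 1 - t) (by linarith) (by linarith) G
          simpa only [sub_sub_cancel, add_comm] using this
      _ = _ := by rw [setLIntegral_const]

theorem sq_integral_Ioc_le {f : ℝ → ℝ} (hf : Continuous f) :
    (∫ t in (0 : ℝ)..1, f t) ^ 2 ≤ ∫ t in (0 : ℝ)..1, f t ^ 2 := by
  set m := ∫ t in (0 : ℝ)..1, f t with hm
  have h1 : 0 ≤ ∫ t in (0 : ℝ)..1, (f t - m) ^ 2 :=
    intervalIntegral.integral_nonneg (by norm_num) fun t _ => sq_nonneg _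
  have h2 : ∫ t in (0 : ℝ)..1, (f t - m) ^ 2
      = (∫ t in (0 : ℝ)..1, f t ^ 2) - 2 * m * m + m ^ 2 := by
    have : ∀ t, (f t - m) ^ 2 = f t ^ 2 - 2 * m * f t + m ^ 2 := fun t => by ring
    simp_rw [this]
    rw [intervalIntegral.integral_add, intervalIntegral.integral_sub,
      intervalIntegral.integral_const_mul, ← hm, intervalIntegral.integral_const]
    · simp
    all_goals exact Continuous.intervalIntegrable (by fun_prop) _ _
  nlinarith

theorem TestFun.sq_sub_le (φ : TestFun d) (x y : E d) :
    (φ y - φ x) ^ 2 ≤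
      ‖y - x‖ ^ 2 * ∫ t in (0 : ℝ)..1, ‖gradient φ ((1 - t) • x + t • y)‖ ^ 2 := by
  have hcg := φ.continuous_gradient
  have hd : ∀ t ∈ uIcc (0 : ℝ) 1, HasDerivAt (fun t : ℝ => φ ((1 - t) • x + t • y))
      ⟪y - x, gradient φ ((1 - t) • x + t • y)⟫_ℝ t := by
    intro t _
    rw [inner_gradient]
    have h1 : HasDerivAt (fun t : ℝ => (1 - t) • x + t • y) (y - x) t := by
      have := (((hasDerivAt_id t).const_sub 1).smul_const x).add
        ((hasDerivAt_id t).smul_const y)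
      refine HasDerivAt.congr_deriv this ?_
      rw [neg_one_smul, one_smul, neg_add_eq_sub]
    exact (φ.differentiable _).hasFDerivAt.comp_hasDerivAt t h1
  have h2 := intervalIntegral.integral_eq_sub_of_hasDerivAt hd
    (Continuous.intervalIntegrable (by fun_prop) _ _)
  simp only [sub_self, zero_smul, one_smul, zero_add, sub_zero, add_zero] at h2
  rw [← h2]
  refine (sq_integral_Ioc_le (by fun_prop)).trans ?_
  rw [← intervalIntegral.integral_const_mul]
  refine intervalIntegral.integral_mono_on (by norm_num)
    (Continuous.intervalIntegrable (by fun_prop) _ _)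
    (Continuous.intervalIntegrable (by fun_prop) _ _) fun t _ => ?_
  rw [← mul_pow, sq_le_sq, abs_mul, abs_norm, abs_norm]
  exact abs_real_inner_le_norm _ _

/-- The constant is not the mean but a value φ(y), at a point y where the integral of (φ - φ(y))²
does not exceed its average over y. The resulting double integral is bounded by integrating the
gradient along segments. -/
theorem TestFun.exists_lintegral_sub_le (hD : IsOpen D) (hc : Convex ℝ D) (hne : D.Nonempty)
    {M : ℝ} (hM : ∀ x ∈ D, ∀ y ∈ D, ‖y - x‖ ≤ M) (hfin : volume D ≠ ⊤) (φ : TestFun d) :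
    ∃ c : ℝ, ∫⁻ x in D, ENNReal.ofReal ((φ x - c) ^ 2) ≤
      ENNReal.ofReal (M ^ 2) * 2 ^ d * ∫⁻ x in D, ENNReal.ofReal (‖gradient φ x‖ ^ 2) := by
  have hcg := φ.continuous_gradient
  have hcφ := φ.smooth.continuous
  have hMD := hD.measurableSet
  set G : E d → ℝ≥0∞ := fun z => ENNReal.ofReal (‖gradient φ z‖ ^ 2) with hG
  have hGm : Measurable G := by fun_prop
  have hpt : ∀ y ∈ D, ∀ x ∈ D, ENNReal.ofReal ((φ x - φ y) ^ 2) ≤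
      ENNReal.ofReal (M ^ 2) * ∫⁻ t in Ioc (0 : ℝ) 1, G ((1 - t) • y + t • x) := by
    intro y hy x hx
    rw [← ofReal_integral_eq_lintegral_ofReal, ← ENNReal.ofReal_mul (by positivity),
      ← intervalIntegral.integral_of_le (by norm_num)]
    · refine ENNReal.ofReal_le_ofReal ((φ.sq_sub_le y x).trans ?_)
      refine mul_le_mul_of_nonneg_right ?_
        (intervalIntegral.integral_nonneg (by norm_num) fun t _ => sq_nonneg _)
      have := hM y hy x hx
      gcongr
    · rw [← IntegrableOn, ← intervalIntegrable_iff_integrableOn_Ioc_of_le (by norm_num)]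
      exact Continuous.intervalIntegrable (by fun_prop) _ _
    · exact .of_forall fun t => sq_nonneg _
  have hvol : volume D ≠ 0 := (hD.measure_pos volume hne).ne'
  obtain ⟨y, hy, hle⟩ := exists_le_setLAverage (μ := volume) (s := D)
    (f := fun y => ∫⁻ x in D, ENNReal.ofReal ((φ x - φ y) ^ 2)) hvol hfin
    (Measurable.lintegral_prod_right' (f := fun p : E d × E d =>
      ENNReal.ofReal ((φ p.2 - φ p.1) ^ 2)) (by fun_prop)).aemeasurable
  refine ⟨φ y, hle.trans ?_⟩
  rw [setLAverage_eq, ENNReal.div_le_iff_le_mul (.inl hvol) (.inl hfin)]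
  calc ∫⁻ y in D, ∫⁻ x in D, ENNReal.ofReal ((φ x - φ y) ^ 2)
      ≤ ∫⁻ y in D, ∫⁻ x in D, ENNReal.ofReal (M ^ 2) *
          ∫⁻ t in Ioc (0 : ℝ) 1, G ((1 - t) • y + t • x) :=
        setLIntegral_mono' hMD fun y hy => setLIntegral_mono' hMD fun x hx => hpt y hy x hx
    _ = ENNReal.ofReal (M ^ 2) * ∫⁻ t in Ioc (0 : ℝ) 1, ∫⁻ y in D, ∫⁻ x in D,
          G ((1 - t) • y + t • x) := by
        simp_rw [lintegral_const_mul' _ _ ENNReal.ofReal_ne_top]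
        congr 1
        symm
        rw [lintegral_lintegral_swap]
        · refine lintegral_congr fun y => ?_
          rw [lintegral_lintegral_swap]
          exact Measurable.aemeasurable (by fun_prop)
        · refine Measurable.aemeasurable ?_
          exact Measurable.lintegral_prod_right' (f := fun p : (ℝ × E d) × E d =>
            G ((1 - p.1.1) • p.1.2 + p.1.1 • p.2)) (by fun_prop)
    _ ≤ ENNReal.ofReal (M ^ 2) * ∫⁻ _ in Ioc (0 : ℝ) 1, 2 ^ d * (∫⁻ z in D, G z) * volume D := by
        gcongr 1
        exact setLIntegral_mono' measurableSet_Ioc fun t ht =>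
          lintegral_lintegral_segment_le hMD hc ht.1.le ht.2 hGm
    _ = _ := by
        rw [setLIntegral_const]
        simp
        ring

/-- The constant function in `L²(D)`. -/
def constL (D : Set (E d)) [IsFiniteMeasure (volume.restrict D)] (c : ℝ) : L2 D :=
  (memLp_const c).toLp

theorem constL_ae [IsFiniteMeasure (volume.restrict D)] (c : ℝ) :
    constL D c =ᵐ[volume.restrict D] fun _ => c := MemLp.coeFn_toLp _

theorem norm_sq_L2 {F : Type*} [NormedAddCommGroup F] (u : Lp F 2 (volume.restrict D)) :
    ENNReal.ofReal (‖u‖ ^ 2) = ∫⁻ x in D, ENNReal.ofReal (‖u x‖ ^ 2) := by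
  have h := eLpNorm_nnreal_pow_eq_lintegral (f := u) (μ := volume.restrict D) (p := 2) (by norm_num)
  rw [Lp.norm_def, ENNReal.ofReal_pow ENNReal.toReal_nonneg,
    ENNReal.ofReal_toReal (Lp.eLpNorm_ne_top u)]
  simp only [NNReal.coe_ofNat, ENNReal.rpow_ofNat, ENNReal.coe_ofNat] at h
  rw [h]
  refine lintegral_congr fun x => ?_
  rw [ENNReal.ofReal_pow (norm_nonneg _), ofReal_norm]

/-- The Poincaré inequality on a bounded convex open set. -/
theorem exists_poincare (hD : IsOpen D) (hc : Convex ℝ D) (hne : D.Nonempty)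
    (hb : Bornology.IsBounded D) [IsFiniteMeasure (volume.restrict D)] :
    ∃ C : ℝ, ∀ φ : TestFun d, ∃ c : ℝ, ‖testL D φ - constL D c‖ ≤ C * ‖gradL D φ‖ := by
  obtain ⟨M, hM⟩ := Metric.isBounded_iff.1 hb
  have hM0 : 0 ≤ M := by
    obtain ⟨x, hx⟩ := hne
    simpa using hM hx hx
  -- The estimate gives M times the square root of 2^d; the larger 2^d avoids the root.
  refine ⟨M * 2 ^ d, fun φ => ?_⟩
  obtain ⟨c, h⟩ := φ.exists_lintegral_sub_le hD hc hne (M := M)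
    (fun x hx y hy => by rw [← dist_eq_norm]; exact hM hy hx) hb.measure_lt_top.ne
  refine ⟨c, ?_⟩
  have h1 : ENNReal.ofReal (‖testL D φ - constL D c‖ ^ 2)
      = ∫⁻ x in D, ENNReal.ofReal ((φ x - c) ^ 2) := by
    rw [norm_sq_L2]
    refine lintegral_congr_ae ?_
    filter_upwards [testL_ae (D := D) φ, constL_ae (D := D) c,
      Lp.coeFn_sub (testL D φ) (constL D c)] with x h1 h2 h3
    rw [h3, Pi.sub_apply, h1, h2, Real.norm_eq_abs, sq_abs]
  have h2 : ENNReal.ofReal (‖gradL D φ‖ ^ 2)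
      = ∫⁻ x in D, ENNReal.ofReal (‖gradient φ x‖ ^ 2) := by
    rw [norm_sq_L2]
    refine lintegral_congr_ae ?_
    filter_upwards [gradL_ae (D := D) φ] with x h1
    rw [h1]
  have h3 : (2 : ℝ≥0∞) ^ d = ENNReal.ofReal (2 ^ d) := by
    rw [ENNReal.ofReal_pow (by norm_num)]; simp
  rw [← h1, ← h2, h3, ← ENNReal.ofReal_mul (by positivity), ← ENNReal.ofReal_mul (by positivity),
    ENNReal.ofReal_le_ofReal_iff (by positivity)] at h
  refine le_of_sq_le_sq (h.trans ?_) (by positivity)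
  rw [mul_pow, mul_pow]
  gcongr
  exact le_self_pow₀ (one_le_pow₀ (by norm_num)) (by norm_num)

end ExpandedMsFEM

end

noncomputable section

namespace ExpandedMsFEM

variable {d : ℕ} {D : Set (E d)}

/-! ### The linear structure of the test functions -/

/-- The test function `φ + c ψ`. -/
def TestFun.addSmul (φ : TestFun d) (c : ℝ) (ψ : TestFun d) : TestFun d where
  toFun x := φ x + c * ψ x
  smooth := φ.smooth.add (contDiff_const.mul ψ.smooth)
  compact := φ.compact.add (ψ.compact.mul_left (f := fun _ => c))

/-- The zero test function. -/
def TestFun.zero : TestFun d where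
  toFun _ := 0
  smooth := contDiff_const
  compact := HasCompactSupport.zero

theorem TestFun.gradient_addSmul (φ : TestFun d) (c : ℝ) (ψ : TestFun d) (x : E d) :
    gradient (φ.addSmul c ψ) x = gradient φ x + c • gradient ψ x := by
  refine ext_inner_left ℝ fun v => ?_
  rw [inner_add_right, inner_smul_right, inner_gradient, inner_gradient, inner_gradient]
  have h : HasFDerivAt (φ.addSmul c ψ) (fderiv ℝ φ x + c • fderiv ℝ ψ x) x :=
    (φ.differentiable x).hasFDerivAt.add ((ψ.differentiable x).hasFDerivAt.const_mul c)
  rw [h.fderiv]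
  simp

theorem gradL_addSmul (φ : TestFun d) (c : ℝ) (ψ : TestFun d) :
    gradL D (φ.addSmul c ψ) = gradL D φ + c • gradL D ψ := by
  refine Lp.ext ?_
  filter_upwards [gradL_ae (D := D) (φ.addSmul c ψ), gradL_ae (D := D) φ, gradL_ae (D := D) ψ,
    Lp.coeFn_add (gradL D φ) (c • gradL D ψ), Lp.coeFn_smul c (gradL D ψ)] with x h1 h2 h3 h4 h5
  rw [h1, h4, Pi.add_apply, h5, Pi.smul_apply, h2, h3, φ.gradient_addSmul]

theorem testL_addSmul (φ : TestFun d) (c : ℝ) (ψ : TestFun d) :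
    testL D (φ.addSmul c ψ) = testL D φ + c • testL D ψ := by
  refine Lp.ext ?_
  filter_upwards [testL_ae (D := D) (φ.addSmul c ψ), testL_ae (D := D) φ, testL_ae (D := D) ψ,
    Lp.coeFn_add (testL D φ) (c • testL D ψ), Lp.coeFn_smul c (testL D ψ)] with x h1 h2 h3 h4 h5
  rw [h1, h4, Pi.add_apply, h5, Pi.smul_apply, h2, h3]
  rfl

theorem gradL_zero : gradL D (TestFun.zero : TestFun d) = 0 := by
  rw [Lp.eq_zero_iff_ae_eq_zero]
  filter_upwards [gradL_ae (D := D) (TestFun.zero : TestFun d)] with x h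
  rw [h]
  exact gradient_const x 0

/-- The space of gradients of test functions in `[L²(D)]ᵈ`. -/
def gradSub (D : Set (E d)) : Submodule ℝ (L2Vec D) where
  carrier := range (gradL D)
  add_mem' := by
    rintro _ _ ⟨φ, rfl⟩ ⟨ψ, rfl⟩
    exact ⟨φ.addSmul 1 ψ, by rw [gradL_addSmul, one_smul]⟩
  zero_mem' := ⟨_, gradL_zero⟩
  smul_mem' := by
    rintro c _ ⟨φ, rfl⟩
    exact ⟨TestFun.zero.addSmul c φ, by rw [gradL_addSmul, gradL_zero, zero_add]⟩

theorem gradL_mem (φ : TestFun d) : gradL D φ ∈ gradSub D := ⟨φ, rfl⟩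

/-- A test function equal to `1` on a bounded set. -/
theorem exists_testFun_eq_one (hb : Bornology.IsBounded D) :
    ∃ φ : TestFun d, ∀ x ∈ D, φ x = 1 ∧ gradient φ x = 0 := by
  obtain ⟨R, hR0, hR⟩ := hb.subset_ball_lt 0 0
  let f : ContDiffBump (0 : E d) := ⟨R, R + 1, hR0, by linarith⟩
  refine ⟨⟨f, f.contDiff, f.hasCompactSupport⟩, fun x hx => ?_⟩
  have h := f.eventuallyEq_one_of_mem_ball (hR hx)
  exact ⟨h.eq_of_nhds, (Filter.EventuallyEq.gradient_eq h).trans (gradient_const x 1)⟩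

section Finite

variable [IsFiniteMeasure (volume.restrict D)]

theorem constL_eq_smul (c : ℝ) : constL D c = c • constL D 1 := by
  refine Lp.ext ?_
  filter_upwards [constL_ae (D := D) c, constL_ae (D := D) 1, Lp.coeFn_smul c (constL D 1)]
    with x h1 h2 h3
  rw [h1, h3, Pi.smul_apply, h2, smul_eq_mul, mul_one]

/-- Green's formula with a test function equal to 1 on D: a field with zero normal trace has a
divergence of mean zero. -/
theorem inner_constL_wdiv (hD : IsOpen D) (hb : Bornology.IsBounded D) {τ : L2Vec D}
    (hτ : τ ∈ H0Div D) : ⟪constL D 1, wdiv τ⟫_ℝ = 0 := by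
  obtain ⟨φ, hφ⟩ := exists_testFun_eq_one hb
  have h := (mem_H0Div_iff.1 hτ).2 φ
  have hD' : ∀ᵐ x ∂(volume.restrict D), x ∈ D := ae_restrict_mem hD.measurableSet
  have h1 : gradL D φ = 0 := by
    rw [Lp.eq_zero_iff_ae_eq_zero]
    filter_upwards [gradL_ae (D := D) φ, hD'] with x h1 hx
    rw [h1, (hφ x hx).2]; rfl
  have h2 : testL D φ = constL D 1 := by
    refine Lp.ext ?_
    filter_upwards [testL_ae (D := D) φ, hD', constL_ae (D := D) 1] with x h1 hx h2
    rw [h1, (hφ x hx).1, h2]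
  rw [h1, h2, inner_zero_right, zero_add] at h
  rwa [real_inner_comm]

/-- Limits of gradients are gradients of `L²` functions, in the weak sense with
homogeneous natural boundary condition. -/
theorem exists_potential (hD : IsOpen D) (hc : Convex ℝ D) (hne : D.Nonempty)
    (hb : Bornology.IsBounded D) {η : L2Vec D} (hη : η ∈ (gradSub D).topologicalClosure) :
    ∃ Φ : L2 D, ∀ τ ∈ H0Div D, ⟪η, τ⟫_ℝ + ⟪Φ, wdiv τ⟫_ℝ = 0 := by
  obtain ⟨C, hC⟩ := exists_poincare hD hc hne hb
  set N : Submodule ℝ (L2 D) := ℝ ∙ constL D 1 with hN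
  -- Projecting out the constants makes Poincaré control the potentials by their gradients, and
  -- pairings with divergences of fields in `H0Div D` do not see the difference.
  let Q : L2 D →L[ℝ] L2 D := Nᗮ.starProjection
  have hQle : ∀ φ : TestFun d, ‖Q (testL D φ)‖ ≤ C * ‖gradL D φ‖ := by
    intro φ
    obtain ⟨c, hc⟩ := hC φ
    refine le_trans ?_ hc
    have : Q (constL D c) = 0 := by
      rw [constL_eq_smul, map_smul]
      simp only [Q]
      rw [Submodule.starProjection_orthogonalComplement_singleton_eq_zero, smul_zero]
    have h2 := Nᗮ.norm_starProjection_apply_le (testL D φ - constL D c)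
    change ‖Q _‖ ≤ _ at h2
    rwa [map_sub, this, sub_zero] at h2
  have hQi : ∀ s : L2 D, ∀ τ ∈ H0Div D, ⟪Q s, wdiv τ⟫_ℝ = ⟪s, wdiv τ⟫_ℝ := by
    intro s τ hτ
    have h1 : Q (wdiv τ) = wdiv τ := by
      refine Submodule.starProjection_eq_self_iff.2 ?_
      rw [Submodule.mem_orthogonal_singleton_iff_inner_right]
      exact inner_constL_wdiv hD hb hτ
    have h2 := Submodule.inner_starProjection_left_eq_right Nᗮ s (wdiv τ)
    change ⟪Q s, _⟫_ℝ = ⟪s, Q _⟫_ℝ at h2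
    rw [h2, h1]
  obtain ⟨u, hu, hlim⟩ := mem_closure_iff_seq_limit.1 hη
  choose φ hφ using hu
  have hcau : CauchySeq fun n => Q (testL D (φ n)) := by
    rw [Metric.cauchySeq_iff']
    intro ε hε
    -- The sign of C is unknown, hence the positive denominator |C| + 1.
    obtain ⟨n₀, hn₀⟩ := Metric.cauchySeq_iff'.1 hlim.cauchySeq (ε / (|C| + 1)) (by positivity)
    refine ⟨n₀, fun n hn => ?_⟩
    have h1 := hQle ((φ n).addSmul (-1) (φ n₀))
    rw [testL_addSmul, gradL_addSmul, hφ, hφ, neg_one_smul, neg_one_smul, ← sub_eq_add_neg,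
      ← sub_eq_add_neg, map_sub, ← dist_eq_norm, ← dist_eq_norm] at h1
    have h2 := hn₀ n hn
    rw [lt_div_iff₀ (by positivity)] at h2
    have h3 : C * dist (u n) (u n₀) ≤ dist (u n) (u n₀) * (|C| + 1) := by
      nlinarith [le_abs_self C, dist_nonneg (x := u n) (y := u n₀)]
    linarith
  obtain ⟨Φ, hΦ⟩ := cauchySeq_tendsto_of_complete hcau
  refine ⟨Φ, fun τ hτ => ?_⟩
  have h1 : Filter.Tendsto (fun n => ⟪u n, τ⟫_ℝ + ⟪Q (testL D (φ n)), wdiv τ⟫_ℝ) Filter.atTop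
      (nhds (⟪η, τ⟫_ℝ + ⟪Φ, wdiv τ⟫_ℝ)) :=
    (hlim.inner tendsto_const_nhds).add (hΦ.inner tendsto_const_nhds)
  refine tendsto_nhds_unique h1 (tendsto_const_nhds.congr fun n => ?_)
  rw [hQi _ _ hτ, ← hφ, real_inner_comm, real_inner_comm (wdiv τ)]
  exact ((mem_H0Div_iff.1 hτ).2 (φ n)).symm

end Finite

/-! ### The multiscale basis equation -/

variable {kmin kmax : ℝ} {k : E d → Matrix (Fin d) (Fin d) ℝ} {K : Set (E d)}

/-- A convex body: the properties of a cell used for the local problem. -/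
structure IsConvexBody (K : Set (E d)) : Prop where
  convex : Convex ℝ K
  bounded : Bornology.IsBounded K
  nonempty : (interior K).Nonempty

theorem IsConvexBody.bounded_interior (hK : IsConvexBody K) :
    Bornology.IsBounded (interior K) := hK.bounded.subset interior_subset

theorem IsConvexBody.isFiniteMeasure (hK : IsConvexBody K) :
    IsFiniteMeasure (volume.restrict (interior K)) :=
  isFiniteMeasure_restrict.2 hK.bounded_interior.measure_lt_top.ne

/-- Lax-Milgram on the closed span of gradients. The test functions are unrestricted on the
boundary, so the orthogonality expresses both div ψ = div χ and ψ·n = χ·n. -/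
theorem exists_basis_flux (hk : GoodCoefficient D kmin kmax k) (χ : L2Vec D) :
    ∃ η ∈ (gradSub D).topologicalClosure,
      ∀ φ : TestFun d, ⟪-(kMul hk η) - χ, gradL D φ⟫_ℝ = 0 := by
  set G := (gradSub D).topologicalClosure with hG
  have : CompleteSpace G := (gradSub D).isClosed_topologicalClosure.completeSpace_coe
  let B : G →L[ℝ] G →L[ℝ] ℝ :=
    ContinuousLinearMap.bilinearComp ((innerSL ℝ).comp (kMul hk)) G.subtypeL G.subtypeL
  have hB : ∀ u v : G, B u v = ⟪kMul hk u, (v : L2Vec D)⟫_ℝ := fun u v => rfl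
  have hc : IsCoercive B := ⟨kmin, hk.pos, fun u => by
    have h := kMul_coercive hk (u : L2Vec D)
    rw [hB, mul_assoc, ← sq]
    exact h⟩
  -- The functional -⟪χ, ·⟫ restricted to the closed subspace is represented by the projection of
  -- -χ.
  let r : G := G.orthogonalProjectionOnto (-χ)
  refine ⟨hc.continuousLinearEquivOfBilin.symm r, Subtype.coe_prop _, fun φ => ?_⟩
  have h1 := hc.continuousLinearEquivOfBilin_apply (hc.continuousLinearEquivOfBilin.symm r)
    ⟨gradL D φ, (gradSub D).le_topologicalClosure (gradL_mem φ)⟩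
  rw [ContinuousLinearEquiv.apply_symm_apply, hB,
    Submodule.inner_orthogonalProjectionOnto_eq_of_mem_right] at h1
  rw [inner_sub_left, inner_neg_left, ← h1, inner_neg_left]
  ring

theorem SolvesBasisEquation.psi_eq {hk : GoodCoefficient (interior K) kmin kmax k}
    {χ η ψ : L2Vec (interior K)} {φ : L2 (interior K)} (h : SolvesBasisEquation k K χ η ψ φ) :
    ψ = -(kMul hk η) := by
  refine eq_neg_of_add_eq_zero_right (ext_inner_right ℝ fun ξ => ?_)
  rw [inner_zero_left, inner_add_left, ← kForm_eq]
  exact h.constitutive ξ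

theorem SolvesBasisEquation.wdiv_eq {χ η ψ : L2Vec (interior K)} {φ : L2 (interior K)}
    (h : SolvesBasisEquation k K χ η ψ φ) : wdiv ψ = wdiv χ :=
  ext_inner_right ℝ h.balance

theorem SolvesBasisEquation.wdiv_sub_eq_zero {χ η ψ : L2Vec (interior K)} {φ : L2 (interior K)}
    (h : SolvesBasisEquation k K χ η ψ φ) : wdiv (ψ - χ) = 0 := by
  have h1 := h.normal_trace.1
  have hχ : χ ∈ HDiv (interior K) := by
    have := (hdivSub (interior K)).sub_mem h.mem h1
    rwa [sub_sub_cancel] at this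
  rw [wdiv_sub isOpen_interior h.mem hχ, h.wdiv_eq, sub_self]

/-- The field ψ - χ is an admissible test field and is divergence free, so the potential drops out.
-/
theorem SolvesBasisEquation.inner_eq_zero {χ η ψ : L2Vec (interior K)} {φ : L2 (interior K)}
    (h : SolvesBasisEquation k K χ η ψ φ) : ⟪η, ψ - χ⟫_ℝ = 0 := by
  have := h.gradient _ h.normal_trace
  rwa [h.wdiv_sub_eq_zero, inner_zero_right, add_zero] at this

theorem exists_solvesBasisEquation (hK : IsConvexBody K)
    (hk : GoodCoefficient (interior K) kmin kmax k) {χ : L2Vec (interior K)}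
    (hχ : χ ∈ HDiv (interior K)) : ∃ η ψ φ, SolvesBasisEquation k K χ η ψ φ := by
  have := hK.isFiniteMeasure
  obtain ⟨η, hη, h⟩ := exists_basis_flux hk χ
  obtain ⟨Φ, hΦ⟩ := exists_potential isOpen_interior hK.convex.interior hK.nonempty
    hK.bounded_interior hη
  have h1 := mem_H0Div_of_forall (D := interior K) isOpen_interior (g := 0)
    (v := -(kMul hk η) - χ) fun φ => by rw [h φ, inner_zero_left, add_zero]
  have h2 : -(kMul hk η) ∈ HDiv (interior K) := by
    have := (hdivSub (interior K)).add_mem h1.1.1 hχ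
    rwa [sub_add_cancel] at this
  refine ⟨η, -(kMul hk η), Φ, h2, fun ξ => ?_, hΦ, fun q => ?_, h1.1⟩
  · rw [kForm_eq hk, inner_neg_left, add_neg_cancel]
  · have h3 := wdiv_sub isOpen_interior h2 hχ
    rw [h1.2] at h3
    rw [sub_eq_zero.1 h3.symm]

/-- The energy identity (kη, η) = -(χ, η) gives kmin‖η‖ ≤ ‖χ‖, and ψ = -kη. The bound involves only
the L² norm of χ and no mesh size. -/
theorem SolvesBasisEquation.norm_flux_le (hk : GoodCoefficient (interior K) kmin kmax k)
    {χ η ψ : L2Vec (interior K)} {φ : L2 (interior K)} (h : SolvesBasisEquation k K χ η ψ φ) :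
    ‖ψ‖ ≤ kmax / kmin * ‖χ‖ := by
  have h0 := h.psi_eq (hk := hk)
  have h1 := h.inner_eq_zero
  have h2 := kMul_coercive hk η
  have h3 : ⟪kMul hk η, η⟫_ℝ = -⟪χ, η⟫_ℝ := by
    rw [inner_sub_right, h0, inner_neg_right] at h1
    rw [real_inner_comm, real_inner_comm η χ]
    linarith
  have h4 : kmin * ‖η‖ ≤ ‖χ‖ := by
    have h5 := abs_real_inner_le_norm χ η
    have h6 := neg_abs_le ⟪χ, η⟫_ℝ
    rcases (norm_nonneg η).eq_or_lt with h7 | h7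
    · rw [← h7, mul_zero]; positivity
    · nlinarith
  have h5 := norm_kMul_le hk η
  rw [h0, norm_neg]
  have h6 : ‖η‖ ≤ ‖χ‖ / kmin := by
    rw [le_div_iff₀ hk.pos]; linarith
  calc ‖kMul hk η‖ ≤ kmax * ‖η‖ := h5
    _ ≤ kmax * (‖χ‖ / kmin) := by gcongr; exact hk.pos'.le
    _ = kmax / kmin * ‖χ‖ := by ring

theorem SolvesBasisEquation.add {χ χ' η η' ψ ψ' : L2Vec (interior K)} {φ φ' : L2 (interior K)}
    (hk : GoodCoefficient (interior K) kmin kmax k)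
    (hχ : χ ∈ HDiv (interior K)) (hχ' : χ' ∈ HDiv (interior K))
    (h : SolvesBasisEquation k K χ η ψ φ) (h' : SolvesBasisEquation k K χ' η' ψ' φ') :
    SolvesBasisEquation k K (χ + χ') (η + η') (ψ + ψ') (φ + φ') where
  mem := (hdivSub (interior K)).add_mem h.mem h'.mem
  constitutive ξ := by
    have h1 := h.constitutive ξ
    have h2 := h'.constitutive ξ
    rw [kForm_eq hk] at h1 h2
    rw [kForm_eq hk, map_add, inner_add_left, inner_add_left]
    linarith
  gradient τ hτ := by
    have h1 := h.gradient τ hτ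
    have h2 := h'.gradient τ hτ
    rw [inner_add_left, inner_add_left]
    linarith
  balance q := by
    rw [wdiv_add isOpen_interior h.mem h'.mem, wdiv_add isOpen_interior hχ hχ',
      inner_add_left, inner_add_left, h.balance, h'.balance]
  normal_trace := by
    rw [add_sub_add_comm]
    exact H0Div_add isOpen_interior h.normal_trace h'.normal_trace

theorem SolvesBasisEquation.smul {χ η ψ : L2Vec (interior K)} {φ : L2 (interior K)} (c : ℝ)
    (hk : GoodCoefficient (interior K) kmin kmax k) (hχ : χ ∈ HDiv (interior K))
    (h : SolvesBasisEquation k K χ η ψ φ) :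
    SolvesBasisEquation k K (c • χ) (c • η) (c • ψ) (c • φ) where
  mem := (hdivSub (interior K)).smul_mem c h.mem
  constitutive ξ := by
    have h1 := h.constitutive ξ
    rw [kForm_eq hk] at h1
    rw [kForm_eq hk, map_smul, real_inner_smul_left, real_inner_smul_left, ← mul_add, h1, mul_zero]
  gradient τ hτ := by
    rw [real_inner_smul_left, real_inner_smul_left, ← mul_add, h.gradient τ hτ, mul_zero]
  balance q := by
    rw [wdiv_smul isOpen_interior c h.mem, wdiv_smul isOpen_interior c hχ,
      real_inner_smul_left, real_inner_smul_left, h.balance]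
  normal_trace := by
    rw [← smul_sub]
    exact H0Div_smul isOpen_interior c h.normal_trace

/-- By linearity the difference of two fluxes solves the problem with χ = 0, where the flux bound is
zero. This makes χ ↦ ψ a well-defined linear map although the potential is determined only up to
constants. -/
theorem SolvesBasisEquation.flux_unique {χ η η' ψ ψ' : L2Vec (interior K)}
    {φ φ' : L2 (interior K)} (hk : GoodCoefficient (interior K) kmin kmax k)
    (hχ : χ ∈ HDiv (interior K)) (h : SolvesBasisEquation k K χ η ψ φ)
    (h' : SolvesBasisEquation k K χ η' ψ' φ') : ψ = ψ' := by
  have h1 := (h.add hk hχ ((hdivSub _).smul_mem (-1) hχ) (h'.smul (-1) hk hχ)).norm_flux_le hk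
  rw [neg_one_smul, neg_one_smul, add_neg_cancel, norm_zero, mul_zero, ← sub_eq_add_neg] at h1
  exact sub_eq_zero.1 (norm_le_zero_iff.1 h1)

end ExpandedMsFEM

end

noncomputable section

namespace ExpandedMsFEM

variable {d : ℕ} {D : Set (E d)}

/-! ### Raviart-Thomas fields -/

/-- The field `(aᵢ + bᵢ xᵢ)ᵢ`. -/
def affineField (a b : E d) (x : E d) : E d := WithLp.toLp 2 fun i => a i + b i * x i

theorem affineField_apply (a b x : E d) (i : Fin d) :
    affineField a b x i = a i + b i * x i := rfl

theorem affineField_add (a b a' b' : E d) :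
    affineField (a + a') (b + b') = affineField a b + affineField a' b' := by
  funext x
  ext i
  simp only [affineField_apply, Pi.add_apply, PiLp.add_apply]
  ring

theorem affineField_smul (c : ℝ) (a b : E d) :
    affineField (c • a) (c • b) = c • affineField a b := by
  funext x
  ext i
  simp only [affineField_apply, Pi.smul_apply, PiLp.smul_apply, smul_eq_mul]
  ring

theorem continuous_affineField (a b : E d) : Continuous (affineField a b) := by
  unfold affineField
  fun_prop

theorem exists_eq_affineField {c : CellType} {v : E d → E d} (hv : v ∈ rt0Fields d c) :
    ∃ a b, v = affineField a b := by
  cases c with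
  | simplex =>
    obtain ⟨a, b, rfl⟩ := hv
    refine ⟨a, WithLp.toLp 2 fun _ => b, ?_⟩
    funext x
    ext i
    simp [affineField_apply]
  | box =>
    obtain ⟨a, b, rfl⟩ := hv
    exact ⟨a, b, rfl⟩

theorem rt0Fields_add {c : CellType} {v w : E d → E d} (hv : v ∈ rt0Fields d c)
    (hw : w ∈ rt0Fields d c) : v + w ∈ rt0Fields d c := by
  cases c with
  | simplex =>
    obtain ⟨a, b, rfl⟩ := hv
    obtain ⟨a', b', rfl⟩ := hw
    refine ⟨a + a', b + b', ?_⟩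
    funext x
    simp only [Pi.add_apply]
    module
  | box =>
    obtain ⟨a, b, rfl⟩ := hv
    obtain ⟨a', b', rfl⟩ := hw
    exact ⟨a + a', b + b', (affineField_add a b a' b').symm⟩

theorem rt0Fields_smul {c : CellType} {v : E d → E d} (t : ℝ) (hv : v ∈ rt0Fields d c) :
    t • v ∈ rt0Fields d c := by
  cases c with
  | simplex =>
    obtain ⟨a, b, rfl⟩ := hv
    refine ⟨t • a, t * b, ?_⟩
    funext x
    simp only [Pi.smul_apply]
    module
  | box =>
    obtain ⟨a, b, rfl⟩ := hv
    exact ⟨t • a, t • b, (affineField_smul t a b).symm⟩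

theorem zero_mem_rt0Fields (c : CellType) : (0 : E d → E d) ∈ rt0Fields d c := by
  cases c with
  | simplex => exact ⟨0, 0, by funext x; simp⟩
  | box => exact ⟨0, 0, by funext x; ext i; simp⟩

/-- `RT₀(K)` as a subspace. -/
def RT0Sub (c : CellType) (K : Set (E d)) : Submodule ℝ (L2Vec (interior K)) where
  carrier := RT0 c K
  add_mem' := by
    rintro u v ⟨f, hf, huf⟩ ⟨g, hg, hvg⟩
    refine ⟨f + g, rt0Fields_add hf hg, ?_⟩
    filter_upwards [huf, hvg, Lp.coeFn_add u v] with x h1 h2 h3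
    rw [h3, Pi.add_apply, h1, h2, Pi.add_apply]
  zero_mem' := ⟨0, zero_mem_rt0Fields c, Lp.coeFn_zero _ _ _⟩
  smul_mem' := by
    rintro t u ⟨f, hf, huf⟩
    refine ⟨t • f, rt0Fields_smul t hf, ?_⟩
    filter_upwards [huf, Lp.coeFn_smul t u] with x h1 h3
    rw [h3, Pi.smul_apply, h1, Pi.smul_apply]

/-- Since φ is supported in D, the integrals extend to the whole space, where each coordinate is
integrated by parts. -/
theorem isWeakDiv_of_ae_eq_affineField {a b : E d} {v : L2Vec D} {g : L2 D}
    (hv : v =ᵐ[volume.restrict D] affineField a b)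
    (hg : g =ᵐ[volume.restrict D] fun _ => ∑ i, b i) : IsWeakDiv D v g := by
  intro φ h1 h2 h3
  have h5 : ∀ x ∉ D, φ x = 0 := fun x hx => image_eq_zero_of_notMem_tsupport fun h' => hx (h3 h')
  have h6 : ∀ x ∉ D, gradient φ x = 0 := fun x hx => by
    rw [gradient_eq_comp]
    simp only
    rw [image_eq_zero_of_notMem_tsupport (f := fderiv ℝ φ)
      (fun h' => hx (h3 (tsupport_fderiv_subset ℝ h'))), map_zero]
  have hv' : ∫ x in D, ⟪v x, gradient φ x⟫_ℝ = ∫ x, ⟪affineField a b x, gradient φ x⟫_ℝ := by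
    rw [← setIntegral_eq_integral_of_forall_compl_eq_zero (s := D)
      (f := fun x => ⟪affineField a b x, gradient φ x⟫_ℝ)
      (fun x hx => by rw [h6 x hx, inner_zero_right])]
    refine integral_congr_ae ?_
    filter_upwards [hv] with x hx
    rw [hx]
  have hg' : ∫ x in D, g x * φ x = ∫ x, (∑ i, b i) * φ x := by
    rw [← setIntegral_eq_integral_of_forall_compl_eq_zero (s := D)
      (f := fun x => (∑ i, b i) * φ x) (fun x hx => by rw [h5 x hx, mul_zero])]
    refine integral_congr_ae ?_
    filter_upwards [hg] with x hx
    rw [hx]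
  have hcf : Continuous (fderiv ℝ φ) := h1.continuous_fderiv (by simp)
  have hcs : HasCompactSupport (fderiv ℝ φ) := h2.fderiv ℝ
  have hcφ := h1.continuous
  have hφd : Differentiable ℝ φ := h1.differentiable (by simp)
  let e : Fin d → E d := fun i => EuclideanSpace.single i 1
  have hexp : ∀ x, ⟪affineField a b x, gradient φ x⟫_ℝ
      = ∑ i, (a i + b i * x i) * fderiv ℝ φ x (e i) := by
    intro x
    rw [inner_gradient]
    conv_lhs => rw [← (EuclideanSpace.basisFun (Fin d) ℝ).sum_repr (affineField a b x)]
    simp [affineField_apply, e]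
  have hint : ∀ i, Integrable (fun x : E d => (a i + b i * x i) * fderiv ℝ φ x (e i)) := by
    intro i
    refine Continuous.integrable_of_hasCompactSupport (by fun_prop) ?_
    exact HasCompactSupport.mul_left (hcs.comp_left (g := fun L : E d →L[ℝ] ℝ => L (e i)) rfl)
  have hpart : ∀ i, ∫ x : E d, (a i + b i * x i) * fderiv ℝ φ x (e i) = -∫ x, b i * φ x := by
    intro i
    have hfd : ∀ x : E d, HasFDerivAt (fun x : E d => a i + b i * x i)
        (b i • (EuclideanSpace.proj i : E d →L[ℝ] ℝ)) x := fun x =>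
      ((EuclideanSpace.proj (𝕜 := ℝ) i).hasFDerivAt.const_mul (b i)).const_add (a i)
    have hfd' : ∀ x : E d, fderiv ℝ (fun x : E d => a i + b i * x i) x (e i) = b i := fun x => by
      rw [(hfd x).fderiv]
      simp [e]
    rw [integral_mul_fderiv_eq_neg_fderiv_mul_of_integrable]
    · simp_rw [hfd']
    · simp_rw [hfd']
      exact Continuous.integrable_of_hasCompactSupport (by fun_prop) h2.mul_left
    · exact hint i
    · exact Continuous.integrable_of_hasCompactSupport (by fun_prop) h2.mul_left
    · exact fun x _ => (hfd x).differentiableAt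
    · exact fun x _ => hφd x
  rw [hv', hg']
  simp_rw [hexp]
  rw [integral_finsetSum _ fun i _ => hint i]
  simp_rw [hpart, integral_const_mul]
  rw [Finset.sum_neg_distrib, Finset.sum_mul]

section Finite

variable [IsFiniteMeasure (volume.restrict D)]

theorem memLp_of_continuous (hD : MeasurableSet D) (hb : Bornology.IsBounded D)
    {F : Type*} [NormedAddCommGroup F] {f : E d → F} (hf : Continuous f) :
    MemLp f 2 (volume.restrict D) := by
  obtain ⟨C, hC⟩ := hb.isCompact_closure.exists_bound_of_continuousOn hf.continuousOn
  refine MemLp.of_bound hf.aestronglyMeasurable C ?_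
  filter_upwards [ae_restrict_mem hD] with x hx using hC x (subset_closure hx)

/-- The class of `(aᵢ + bᵢ xᵢ)ᵢ` in `[L²(D)]ᵈ`, depending linearly on `(a, b)`. -/
def affineL (hD : IsOpen D) (hb : Bornology.IsBounded D) : E d × E d →ₗ[ℝ] L2Vec D where
  toFun p := (memLp_of_continuous hD.measurableSet hb (continuous_affineField p.1 p.2)).toLp
  map_add' p q := by
    rw [← MemLp.toLp_add]
    congr 1
    exact affineField_add _ _ _ _
  map_smul' t p := by
    rw [RingHom.id_apply, ← MemLp.toLp_const_smul]
    congr 1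
    exact affineField_smul _ _ _

theorem affineL_ae (hD : IsOpen D) (hb : Bornology.IsBounded D) (p : E d × E d) :
    affineL hD hb p =ᵐ[volume.restrict D] affineField p.1 p.2 :=
  (memLp_of_continuous hD.measurableSet hb (continuous_affineField p.1 p.2)).coeFn_toLp

end Finite

/-! ### The local multiscale spaces as images of the Raviart-Thomas space. -/

variable {kmin kmax : ℝ} {k : E d → Matrix (Fin d) (Fin d) ℝ} {K : Set (E d)} {c : CellType}

theorem IsConvexBody.finiteDimensional_RT0Sub (hK : IsConvexBody K) :
    FiniteDimensional ℝ (RT0Sub c K) := by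
  have := hK.isFiniteMeasure
  have hle : RT0Sub c K ≤ LinearMap.range (affineL isOpen_interior hK.bounded_interior) := by
    rintro χ ⟨v, hv, hχ⟩
    obtain ⟨a, b, rfl⟩ := exists_eq_affineField hv
    exact ⟨(a, b), Lp.ext ((affineL_ae _ _ _).trans hχ.symm)⟩
  exact Submodule.finiteDimensional_of_le hle

theorem IsConvexBody.exists_wdiv_RT0 (hK : IsConvexBody K) {χ : L2Vec (interior K)}
    (hχ : χ ∈ RT0 c K) :
    χ ∈ HDiv (interior K) ∧ ∃ s : ℝ, wdiv χ =ᵐ[volume.restrict (interior K)] fun _ => s := by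
  have := hK.isFiniteMeasure
  obtain ⟨v, hv, hχ⟩ := hχ
  obtain ⟨a, b, rfl⟩ := exists_eq_affineField hv
  have h := isWeakDiv_of_ae_eq_affineField hχ (constL_ae (∑ i, b i))
  refine ⟨⟨_, h⟩, ∑ i, b i, ?_⟩
  rw [h.wdiv_eq isOpen_interior]
  exact constL_ae _

theorem IsConvexBody.exists_solves_RT0 (hK : IsConvexBody K)
    (hk : GoodCoefficient (interior K) kmin kmax k) (χ : RT0Sub c K) :
    ∃ ψ : L2Vec (interior K), ∃ η φ, SolvesBasisEquation k K χ η ψ φ := by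
  obtain ⟨η, ψ, φ, h⟩ := exists_solvesBasisEquation hK hk (hK.exists_wdiv_RT0 χ.2).1
  exact ⟨ψ, η, φ, h⟩

/-- The map `χ ↦ ψ_χ`. -/
def basisFlux (hK : IsConvexBody K) (hk : GoodCoefficient (interior K) kmin kmax k)
    (c : CellType) : RT0Sub c K →ₗ[ℝ] L2Vec (interior K) where
  toFun χ := (hK.exists_solves_RT0 hk χ).choose
  map_add' χ χ' := by
    obtain ⟨_, _, h⟩ := (hK.exists_solves_RT0 hk χ).choose_spec
    obtain ⟨_, _, h'⟩ := (hK.exists_solves_RT0 hk χ').choose_spec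
    obtain ⟨_, _, h''⟩ := (hK.exists_solves_RT0 hk (χ + χ')).choose_spec
    have hχ := (hK.exists_wdiv_RT0 χ.2).1
    have hχ' := (hK.exists_wdiv_RT0 χ'.2).1
    exact h''.flux_unique hk ((hdivSub _).add_mem hχ hχ') (h.add hk hχ hχ' h')
  map_smul' t χ := by
    obtain ⟨_, _, h⟩ := (hK.exists_solves_RT0 hk χ).choose_spec
    obtain ⟨_, _, h''⟩ := (hK.exists_solves_RT0 hk (t • χ)).choose_spec
    have hχ := (hK.exists_wdiv_RT0 χ.2).1
    exact h''.flux_unique hk ((hdivSub _).smul_mem t hχ) (h.smul t hk hχ)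

theorem basisFlux_spec (hK : IsConvexBody K) (hk : GoodCoefficient (interior K) kmin kmax k)
    (χ : RT0Sub c K) : ∃ η φ, SolvesBasisEquation k K χ η (basisFlux hK hk c χ) φ :=
  (hK.exists_solves_RT0 hk χ).choose_spec

theorem localX2_eq_range (hK : IsConvexBody K) (hk : GoodCoefficient (interior K) kmin kmax k) :
    localX2 c k K = LinearMap.range (basisFlux hK hk c) := by
  refine le_antisymm (Submodule.span_le.2 ?_) ?_
  · rintro ψ ⟨χ, hχ, η, φ, h⟩
    obtain ⟨_, _, h'⟩ := basisFlux_spec hK hk (⟨χ, hχ⟩ : RT0Sub c K)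
    exact ⟨⟨χ, hχ⟩, h'.flux_unique hk (hK.exists_wdiv_RT0 hχ).1 h⟩
  · rintro _ ⟨χ, rfl⟩
    obtain ⟨η, φ, h⟩ := basisFlux_spec hK hk χ
    exact Submodule.subset_span ⟨χ, χ.2, η, φ, h⟩

/-- Each generator satisfies ψ = -kη. This is what lets discrete fluxes be tested by discrete
gradients. -/
theorem localX2_eq_map (hk : GoodCoefficient (interior K) kmin kmax k) :
    localX2 c k K = (localX1 c k K).map (-(kMul hk : L2Vec (interior K) →ₗ[ℝ] _)) := by
  rw [localX1, localX2, Submodule.map_span]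
  congr 1
  ext ψ
  constructor
  · rintro ⟨χ, hχ, η, φ, h⟩
    exact ⟨η, ⟨χ, hχ, ψ, φ, h⟩, h.psi_eq.symm⟩
  · rintro ⟨η, ⟨χ, hχ, ψ', φ, h⟩, rfl⟩
    refine ⟨χ, hχ, η, φ, ?_⟩
    have := h.psi_eq (hk := hk)
    subst this
    exact h

theorem finiteDimensional_localX2 (hK : IsConvexBody K)
    (hk : GoodCoefficient (interior K) kmin kmax k) : FiniteDimensional ℝ (localX2 c k K) := by
  have := hK.finiteDimensional_RT0Sub (c := c)
  rw [localX2_eq_range hK hk]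
  infer_instance

theorem finiteDimensional_localX1 (hK : IsConvexBody K)
    (hk : GoodCoefficient (interior K) kmin kmax k) : FiniteDimensional ℝ (localX1 c k K) := by
  have h1 := finiteDimensional_localX2 (c := c) hK hk
  rw [localX2_eq_map hk] at h1
  refine Module.Finite.equiv (Submodule.equivMapOfInjective
    (-(kMul hk : L2Vec (interior K) →ₗ[ℝ] L2Vec (interior K))) ?_ (localX1 c k K)).symm
  intro x y h
  exact kMul_injective hk (neg_injective h)

theorem localX2_wdiv (hK : IsConvexBody K) (hk : GoodCoefficient (interior K) kmin kmax k)
    {ψ : L2Vec (interior K)} (hψ : ψ ∈ localX2 c k K) :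
    ∃ s : ℝ, wdiv ψ =ᵐ[volume.restrict (interior K)] fun _ => s := by
  rw [localX2_eq_range hK hk] at hψ
  obtain ⟨χ, rfl⟩ := hψ
  obtain ⟨η, φ, h⟩ := basisFlux_spec hK hk χ
  rw [h.wdiv_eq]
  exact (hK.exists_wdiv_RT0 χ.2).2

end ExpandedMsFEM

end

noncomputable section

namespace ExpandedMsFEM

variable {d : ℕ}

/-! ### Facets of a cell and the associated Raviart-Thomas fields -/

theorem det_id_add_smulRight (n w : E d) :
    (ContinuousLinearMap.id ℝ (E d) + (innerSL ℝ n).smulRight w).det = 1 + ⟪n, w⟫_ℝ := by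
  have h := LinearMap.transvection.det (innerSL ℝ n : E d →ₗ[ℝ] ℝ) w
  rw [ContinuousLinearMap.coe_coe, innerSL_apply_apply] at h
  rw [← h]
  rfl

/-- The linear part of the Raviart-Thomas field of a facet with normal `n`: the identity for
simplices, the orthogonal projection onto the line spanned by `n` for boxes. -/
def shapeProj : CellType → E d → E d →L[ℝ] E d
  | .simplex, _ => ContinuousLinearMap.id ℝ (E d)
  | .box, n => (innerSL ℝ n).smulRight ((‖n‖ ^ 2)⁻¹ • n)

/-- The divergence of the Raviart-Thomas field of a facet. -/
def shapeDiv (d : ℕ) : CellType → ℕ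
  | .simplex => d
  | .box => 1

/-- The index type of the facets of a cell. -/
def FacetIdx (d : ℕ) : CellType → Type
  | .simplex => Fin (d + 1)
  | .box => Fin d × Bool

instance (c : CellType) : Fintype (FacetIdx d c) := by
  cases c
  · exact inferInstanceAs (Fintype (Fin (d + 1)))
  · exact inferInstanceAs (Fintype (Fin d × Bool))

theorem shapeProj_box_apply (n v : E d) :
    shapeProj .box n v = (⟪n, v⟫_ℝ * (‖n‖ ^ 2)⁻¹) • n := by
  simp [shapeProj, mul_smul]

theorem inner_shapeProj (c : CellType) {n : E d} (hn : n ≠ 0) (v : E d) :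
    ⟪n, shapeProj c n v⟫_ℝ = ⟪n, v⟫_ℝ := by
  cases c with
  | simplex => rfl
  | box =>
    have : ‖n‖ ≠ 0 := norm_ne_zero_iff.2 hn
    rw [shapeProj_box_apply, real_inner_smul_right, real_inner_self_eq_norm_sq]
    field_simp

theorem shapeProj_idem (c : CellType) {n : E d} (hn : n ≠ 0) (v : E d) :
    shapeProj c n (shapeProj c n v) = shapeProj c n v := by
  cases c with
  | simplex => rfl
  | box =>
    rw [shapeProj_box_apply, inner_shapeProj _ hn, shapeProj_box_apply]

theorem shapeProj_smul (c : CellType) (n : E d) {t : ℝ} (ht : t ≠ 0) :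
    shapeProj c (t • n) = shapeProj c n := by
  cases c with
  | simplex => rfl
  | box =>
    ext1 v
    rw [shapeProj_box_apply, shapeProj_box_apply, real_inner_smul_left, norm_smul, smul_smul,
      Real.norm_eq_abs, mul_pow, sq_abs]
    congr 1
    field_simp

theorem norm_shapeProj_le (c : CellType) (n v : E d) : ‖shapeProj c n v‖ ≤ ‖v‖ := by
  cases c with
  | simplex => exact le_rfl
  | box =>
    rcases eq_or_ne n 0 with rfl | hn
    · simp [shapeProj_box_apply]
    have : 0 < ‖n‖ := norm_pos_iff.2 hn
    rw [shapeProj_box_apply, norm_smul, norm_mul, Real.norm_eq_abs, norm_inv, norm_pow, norm_norm]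
    have := abs_real_inner_le_norm n v
    calc |⟪n, v⟫_ℝ| * (‖n‖ ^ 2)⁻¹ * ‖n‖ ≤ ‖n‖ * ‖v‖ * (‖n‖ ^ 2)⁻¹ * ‖n‖ := by gcongr
      _ = ‖v‖ := by field_simp

/-- The map scales by t the range of the projection, which has dimension d for simplices and 1 for
boxes. This dimension is also the trace of the projection, hence the divergence of the facet field.
-/
theorem det_id_add_shapeProj (c : CellType) {n : E d} (hn : n ≠ 0) (t : ℝ) :
    (ContinuousLinearMap.id ℝ (E d) + (t - 1) • shapeProj c n).det = t ^ shapeDiv d c := by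
  cases c with
  | simplex =>
    have : ContinuousLinearMap.id ℝ (E d) + (t - 1) • shapeProj .simplex n
        = t • ContinuousLinearMap.id ℝ (E d) := by
      ext1 v
      simp only [shapeProj, add_apply, smul_apply,
        ContinuousLinearMap.id_apply]
      module
    rw [this]
    simp [ContinuousLinearMap.det, LinearMap.det_smul, shapeDiv]
  | box =>
    have h0 : ‖n‖ ≠ 0 := norm_ne_zero_iff.2 hn
    have : ContinuousLinearMap.id ℝ (E d) + (t - 1) • shapeProj .box n
        = ContinuousLinearMap.id ℝ (E d) +
          (innerSL ℝ n).smulRight ((t - 1) • (‖n‖ ^ 2)⁻¹ • n) := by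
      ext1 v
      simp only [shapeProj, add_apply, smul_apply,
        ContinuousLinearMap.id_apply, ContinuousLinearMap.smulRight_apply]
      module
    rw [this, det_id_add_smulRight, real_inner_smul_right, real_inner_smul_right,
      real_inner_self_eq_norm_sq, inv_mul_cancel₀ (pow_ne_zero 2 h0), shapeDiv]
    ring

/-- The facets `{ℓᵢ = 0}`, `ℓᵢ = ⟪nᵢ, ·⟫ + γᵢ`, of a cell `K = {x | ∀ i, 0 ≤ ℓᵢ x}`, with points
`pᵢ ∈ K` opposite to the facets, and points `zᵢ` in the relative interiors of the facets. -/
structure CellGeom (c : CellType) (K : Set (E d)) where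
  n : FacetIdx d c → E d
  γ : FacetIdx d c → ℝ
  p : FacetIdx d c → E d
  z : FacetIdx d c → E d
  n_ne : ∀ i, n i ≠ 0
  mem_iff : ∀ x, x ∈ K ↔ ∀ i, 0 ≤ ⟪n i, x⟫_ℝ + γ i
  le_one : ∀ x ∈ K, ∀ i, ⟪n i, x⟫_ℝ + γ i ≤ 1
  p_mem : ∀ i, p i ∈ K
  p_one : ∀ i, ⟪n i, p i⟫_ℝ + γ i = 1
  z_zero : ∀ i, ⟪n i, z i⟫_ℝ + γ i = 0
  z_pos : ∀ i j, j ≠ i → 0 < ⟪n j, z i⟫_ℝ + γ j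
  scale : ∀ i j, j ≠ i → ∃ s : ℝ, 0 ≤ s ∧ s ≤ 1 ∧
    ∀ x, ⟪n j, shapeProj c (n i) (x - p i)⟫_ℝ = s * (⟪n j, x⟫_ℝ + γ j)
  sum_one : shapeDiv d c * ∑ i, γ i = d
  rt0 : ∀ i, (fun x => shapeProj c (n i) (x - p i)) ∈ rt0Fields d c
  body : IsConvexBody K

/-! ### Dilations along the facet fields and the flux through a facet. -/

namespace CellGeom

variable {c : CellType} {K : Set (E d)} (G : CellGeom c K) (i : FacetIdx d c)

/-- The affine function of a facet. -/
def l (x : E d) : ℝ := ⟪G.n i, x⟫_ℝ + G.γ i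

/-- The Raviart-Thomas field of a facet, `pᵢ`-centred. -/
def X (x : E d) : E d := shapeProj c (G.n i) (x - G.p i)

/-- The dilation along the field `X`. -/
def S (t : ℝ) (x : E d) : E d := x + (t - 1) • G.X i x

/-- The facet. -/
def facet : Set (E d) := {x | x ∈ K ∧ G.l i x = 0}

theorem mem_iff' {x : E d} : x ∈ K ↔ ∀ i, 0 ≤ G.l i x := G.mem_iff x

theorem continuous_l : Continuous (G.l i) := by
  unfold l; fun_prop

theorem l_nonneg {x : E d} (hx : x ∈ K) : 0 ≤ G.l i x := G.mem_iff'.1 hx i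

theorem isClosed (G : CellGeom c K) : IsClosed K := by
  have : K = ⋂ i, {x | 0 ≤ G.l i x} := by
    ext x
    rw [G.mem_iff', mem_iInter]
    rfl
  rw [this]
  exact isClosed_iInter fun i => isClosed_le continuous_const (G.continuous_l i)

theorem isCompact (G : CellGeom c K) : IsCompact K := Metric.isCompact_of_isClosed_isBounded G.isClosed G.body.bounded

theorem measurableSet (G : CellGeom c K) : MeasurableSet K := G.isClosed.measurableSet

theorem mem_interior {x : E d} (hx : ∀ i, 0 < G.l i x) : x ∈ interior K := by
  have h : IsOpen (⋂ i, {x | 0 < G.l i x}) :=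
    isOpen_iInter_of_finite fun i => isOpen_lt continuous_const (G.continuous_l i)
  refine interior_maximal (fun y hy => ?_) h (mem_iInter.2 hx)
  exact G.mem_iff'.2 fun i => (mem_iInter.1 hy i).le

theorem z_mem : G.z i ∈ K := by
  refine G.mem_iff'.2 fun j => ?_
  rcases eq_or_ne j i with rfl | h
  · exact (G.z_zero j).ge
  · exact (G.z_pos i j h).le

theorem z_mem_facet : G.z i ∈ G.facet i := ⟨G.z_mem i, G.z_zero i⟩

theorem l_add (x v : E d) : G.l i (x + v) = G.l i x + ⟪G.n i, v⟫_ℝ := by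
  simp only [l, inner_add_right]; ring

theorem inner_X (x : E d) : ⟪G.n i, G.X i x⟫_ℝ = G.l i x - 1 := by
  rw [X, inner_shapeProj c (G.n_ne i), inner_sub_right, l, ← G.p_one i]
  ring

theorem l_S (t : ℝ) (x : E d) : 1 - G.l i (G.S i t x) = t * (1 - G.l i x) := by
  rw [S, l_add, real_inner_smul_right, G.inner_X]
  ring

/-- The field Xᵢ is tangent to every other facet, so the dilation only rescales ℓⱼ. For t ≥ 0 the
factor is nonnegative because s ≤ 1, so a dilated point of the cell can leave it only across facet
i. -/
theorem exists_l_S {j : FacetIdx d c} (hj : j ≠ i) :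
    ∃ s : ℝ, 0 ≤ s ∧ s ≤ 1 ∧ ∀ t x, G.l j (G.S i t x) = (1 + (t - 1) * s) * G.l j x := by
  obtain ⟨s, h0, h1, hs⟩ := G.scale i j hj
  refine ⟨s, h0, h1, fun t x => ?_⟩
  rw [S, l_add, real_inner_smul_right, X, hs]
  simp only [l]
  ring

theorem X_S (t : ℝ) (x : E d) : G.X i (G.S i t x) = t • G.X i x := by
  have h : G.S i t x - G.p i = (x - G.p i) + (t - 1) • G.X i x := by
    rw [S]; module
  rw [X, h, map_add, map_smul, X, shapeProj_idem c (G.n_ne i)]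
  module

theorem S_S (s t : ℝ) (x : E d) : G.S i s (G.S i t x) = G.S i (s * t) x := by
  rw [S, X_S, S, S]
  module

theorem S_one (x : E d) : G.S i 1 x = x := by
  simp [S]

theorem S_mem {t : ℝ} (ht : 0 ≤ t) {x : E d} (hx : x ∈ K) (h : 0 ≤ G.l i (G.S i t x)) :
    G.S i t x ∈ K := by
  refine G.mem_iff'.2 fun j => ?_
  rcases eq_or_ne j i with rfl | hj
  · exact h
  · obtain ⟨s, h0, h1, hs⟩ := G.exists_l_S i hj
    rw [hs]
    refine mul_nonneg ?_ (G.l_nonneg j hx)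
    nlinarith

theorem S_mem_of_le_one {t : ℝ} (ht : 0 ≤ t) (ht1 : t ≤ 1) {x : E d} (hx : x ∈ K) :
    G.S i t x ∈ K := by
  refine G.S_mem i ht hx ?_
  have h1 := G.l_S i t x
  have h2 := G.l_nonneg i hx
  have h3 : G.l i x ≤ 1 := G.le_one x hx i
  nlinarith

theorem continuous_X : Continuous (G.X i) := by
  unfold X; fun_prop

theorem hasFDerivAt_S (t : ℝ) (x : E d) : HasFDerivAt (G.S i t)
    (ContinuousLinearMap.id ℝ (E d) + (t - 1) • shapeProj c (G.n i)) x := by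
  have h : HasFDerivAt (G.X i) (shapeProj c (G.n i)) x := by
    have := (shapeProj c (G.n i)).hasFDerivAt.comp x ((hasFDerivAt_id x).sub_const (G.p i))
    rwa [ContinuousLinearMap.comp_id] at this
  exact (hasFDerivAt_id x).add (h.const_smul (t - 1))

theorem hasDerivAt_S (t : ℝ) (x : E d) : HasDerivAt (fun t => G.S i t x) (G.X i x) t := by
  have := (((hasDerivAt_id t).sub_const 1).smul_const (G.X i x)).const_add x
  rwa [one_smul] at this

theorem continuous_S : Continuous fun q : ℝ × E d => G.S i q.1 q.2 := by
  have := G.continuous_X i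
  unfold S
  fun_prop

theorem injective_S {t : ℝ} (ht : t ≠ 0) : Function.Injective (G.S i t) := by
  intro x y h
  have := congrArg (G.S i t⁻¹) h
  rwa [S_S, S_S, inv_mul_cancel₀ ht, S_one, S_one] at this

theorem integral_image_S {t : ℝ} (ht : 0 < t) (g : E d → ℝ) :
    ∫ x in G.S i t '' K, g x = t ^ shapeDiv d c * ∫ x in K, g (G.S i t x) := by
  rw [integral_image_eq_integral_abs_det_fderiv_smul volume G.measurableSet
    (fun x _ => (G.hasFDerivAt_S i t x).hasFDerivWithinAt) (G.injective_S i ht.ne').injOn]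
  simp_rw [det_id_add_shapeProj c (G.n_ne i), abs_of_pos (pow_pos ht _), smul_eq_mul]
  rw [integral_const_mul]

theorem subset_image_S {t : ℝ} (ht : 1 ≤ t) : K ⊆ G.S i t '' K := by
  intro x hx
  refine ⟨G.S i t⁻¹ x, G.S_mem_of_le_one i (by positivity) (inv_le_one_of_one_le₀ ht) hx, ?_⟩
  rw [S_S, mul_inv_cancel₀ (by positivity), S_one]

/-- A point y pushed out of the cell lies on a dilation orbit through the facet, and the crossing
parameter is read off as s = 1 - ℓᵢ(y). -/
theorem exists_facet_of_mem_layer {t : ℝ} (ht : 1 ≤ t) {y : E d} (hy : y ∈ G.S i t '' K)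
    (hyK : y ∉ K) : ∃ s, 1 < s ∧ s ≤ t ∧ ∃ x ∈ G.facet i, y = G.S i s x := by
  obtain ⟨x, hx, rfl⟩ := hy
  have h0 : G.l i (G.S i t x) < 0 := by
    by_contra! h
    exact hyK (G.S_mem i (by linarith) hx h)
  have h1 := G.l_S i t x
  have h2 := G.l_nonneg i hx
  set s := 1 - G.l i (G.S i t x) with hs
  have hs1 : 1 < s := by linarith
  have hst : s ≤ t := by rw [h1]; nlinarith
  have hl : G.l i (G.S i (s⁻¹ * t) x) = 0 := by
    have h3 := G.l_S i (s⁻¹ * t) x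
    rw [mul_assoc, ← h1, inv_mul_cancel₀ (by linarith)] at h3
    linarith
  refine ⟨s, hs1, hst, G.S i (s⁻¹ * t) x, ⟨G.S_mem i (by positivity) hx hl.ge, hl⟩, ?_⟩
  rw [S_S, ← mul_assoc, mul_inv_cancel₀ (by linarith), one_mul]

/-- The flux through the facet: `∫_K div (φ X)`. -/
def J (φ : E d → ℝ) : ℝ := ∫ x in K, (fderiv ℝ φ x (G.X i x) + shapeDiv d c * φ x)

/-- The flux is the derivative at t = 1 of the integral of g over the dilated cell. Only a layer
beyond facet i is added for t > 1. Its volume is O(t - 1), and g is O(t - 1) on it because g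
vanishes on the facet, so the integral changes by O((t - 1)²). This stands in for the divergence
theorem. -/
theorem J_eq_zero {g : E d → ℝ} (hg : ContDiff ℝ 1 g) (h0 : ∀ x ∈ G.facet i, g x = 0) :
    G.J i g = 0 := by
  have hcX := G.continuous_X i
  have hcS := G.continuous_S i
  have hcf : Continuous (fderiv ℝ g) := hg.continuous_fderiv (by simp)
  have hcg := hg.continuous
  have hgd : Differentiable ℝ g := hg.differentiable (by simp)
  have hK := G.isCompact
  set m := shapeDiv d c with hm
  have hder : ∀ x t, HasDerivAt (fun t => g (G.S i t x))
      (fderiv ℝ g (G.S i t x) (G.X i x)) t := fun x t =>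
    (hgd _).hasFDerivAt.comp_hasDerivAt t (G.hasDerivAt_S i t x)
  obtain ⟨L, hL⟩ := (isCompact_Icc (a := (0 : ℝ)) (b := 2)).prod hK
    |>.exists_bound_of_continuousOn (f := fun q => fderiv ℝ g (G.S i q.1 q.2) (G.X i q.2))
      (Continuous.continuousOn (by fun_prop))
  have hL0 : 0 ≤ L := (norm_nonneg _).trans
    (hL (0, G.p i) ⟨⟨le_rfl, by norm_num⟩, G.p_mem i⟩)
  have hfin : volume K ≠ ⊤ := hK.measure_lt_top.ne
  have hfm : IsFiniteMeasure (volume.restrict K) := isFiniteMeasure_restrict.2 hfin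
  have hcSt : ∀ t, Continuous fun x => G.S i t x := fun t =>
    hcS.comp (continuous_const.prodMk continuous_id)
  have hD := (hasDerivAt_integral_of_dominated_loc_of_deriv_le (μ := volume.restrict K)
    (F := fun t x => g (G.S i t x)) (F' := fun t x => fderiv ℝ g (G.S i t x) (G.X i x))
    (x₀ := (1 : ℝ)) (s := Icc 0 2) (bound := fun _ => L)
    (Icc_mem_nhds (by norm_num) (by norm_num))
    (.of_forall fun t => (hcg.comp (hcSt t)).aestronglyMeasurable)
    ((hcg.comp (hcSt 1)).continuousOn.integrableOn_compact hK)
    (((hcf.comp (hcSt 1)).clm_apply hcX).aestronglyMeasurable)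
    ((ae_restrict_mem G.measurableSet).mono fun x hx t ht => hL (t, x) ⟨ht, hx⟩)
    (integrable_const L) (.of_forall fun x t _ => hder x t)).2
  -- By change of variables, t^m times the integral of g ∘ S_t is the integral of g over S_t(K); the
  -- product rule identifies its derivative at 1 with the flux.
  have hH := (hasDerivAt_pow m (1 : ℝ)).mul hD
  simp only [one_pow, mul_one, one_mul, S_one] at hH
  have hint : ∀ f : E d → ℝ, Continuous f → IntegrableOn f K := fun f hf =>
    hf.continuousOn.integrableOn_compact hK
  have hJ : G.J i g = m * (∫ x in K, g x) + ∫ x in K, fderiv ℝ g x (G.X i x) := by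
    rw [J, integral_add (hint _ (by fun_prop)) (hint _ (by fun_prop)), integral_const_mul, add_comm]
  rw [← hJ] at hH
  -- Each layer point is reached from a zero of g on the facet, with the dilation parameter running
  -- from 1 to some s ≤ t at speed at most L.
  have hlayer : ∀ t ∈ Ioc (1 : ℝ) 2, ∀ y ∈ G.S i t '' K \ K, ‖g y‖ ≤ L * (t - 1) := by
    rintro t ⟨ht1, ht2⟩ y ⟨hy, hyK⟩
    obtain ⟨s, hs1, hst, x, hx, rfl⟩ := G.exists_facet_of_mem_layer i ht1.le hy hyK
    have h1 := norm_image_sub_le_of_norm_deriv_le_segment' (a := 1) (b := s)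
      (f := fun t => g (G.S i t x)) (C := L)
      (fun t _ => (hder x t).hasDerivWithinAt)
      (fun t ht => hL (t, x) ⟨⟨by linarith [ht.1], by linarith [ht.2]⟩, hx.1⟩) s ⟨hs1.le, le_rfl⟩
    simp only [S_one, h0 x hx, sub_zero] at h1
    exact h1.trans (by gcongr)
  have hvol : ∀ t ∈ Ioc (1 : ℝ) 2, volume.real (G.S i t '' K \ K) =
      (t ^ m - 1) * volume.real K := by
    rintro t ⟨ht1, ht2⟩
    have h1 := G.integral_image_S i (by linarith : 0 < t) fun _ => 1
    simp only [integral_const, MeasurableSet.univ, measureReal_restrict_apply, univ_inter,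
      smul_eq_mul, mul_one] at h1
    rw [measureReal_sdiff (G.subset_image_S i ht1.le) G.measurableSet
      (hK.image (hcSt t)).measure_lt_top.ne, h1]
    ring
  have hdiff : ∀ t ∈ Ioc (1 : ℝ) 2, |t ^ m * (∫ x in K, g (G.S i t x)) - ∫ x in K, g x| ≤
      L * (t - 1) * ((t ^ m - 1) * volume.real K) := by
    intro t ht
    have hSK := hK.image (hcSt t)
    rw [← G.integral_image_S i (by linarith [ht.1]),
      ← setIntegral_sdiff G.measurableSet (hcg.continuousOn.integrableOn_compact hSK)
        (G.subset_image_S i ht.1.le), ← hvol t ht]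
    exact norm_setIntegral_le_of_norm_le_const
      ((measure_mono sdiff_subset).trans_lt hSK.measure_lt_top) (hlayer t ht)
  have hslope := (hasDerivWithinAt_iff_tendsto_slope' (s := Ioi (1 : ℝ)) (by simp)).1
    hH.hasDerivWithinAt
  have hzero : Filter.Tendsto (fun t : ℝ => L * ((t ^ m - 1) * volume.real K))
      (nhdsWithin 1 (Ioi 1)) (nhds 0) := by
    have : Continuous fun t : ℝ => L * ((t ^ m - 1) * volume.real K) := by fun_prop
    have h := (this.tendsto 1).mono_left (nhdsWithin_le_nhds (s := Ioi 1))
    simpa using h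
  -- The two-sided derivative is known to exist, so difference quotients from the right determine
  -- it.
  refine tendsto_nhds_unique hslope (squeeze_zero_norm' ?_ hzero)
  filter_upwards [Ioc_mem_nhdsGT (show (1 : ℝ) < 2 by norm_num)] with t ht
  have ht0 : 0 < t - 1 := by linarith [ht.1]
  rw [slope_def_field, norm_div, Real.norm_eq_abs, Real.norm_eq_abs, abs_of_pos ht0,
    div_le_iff₀ ht0]
  have := hdiff t ht
  simp only [Pi.mul_apply, one_pow, one_mul, S_one]
  linarith

end CellGeom

end ExpandedMsFEM

end

noncomputable section

namespace ExpandedMsFEM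

open scoped Topology

variable {d : ℕ}

/-! ### Cells sharing a facet -/

theorem exists_eq_smul_of_orthogonal {n n' : E d} (h : ∀ v, ⟪n, v⟫_ℝ = 0 → ⟪n', v⟫_ℝ = 0) :
    ∃ t : ℝ, n' = t • n := by
  have h1 : n' ∈ (ℝ ∙ n)ᗮᗮ := by
    rw [Submodule.mem_orthogonal']
    intro v hv
    exact h v (Submodule.mem_orthogonal_singleton_iff_inner_right.1 hv)
  rw [Submodule.orthogonal_orthogonal] at h1
  obtain ⟨t, ht⟩ := Submodule.mem_span_singleton.1 h1
  exact ⟨t, ht.symm⟩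

namespace CellGeom

variable {c : CellType} {K K' : Set (E d)} (G : CellGeom c K) (G' : CellGeom c K')
  (i : FacetIdx d c) (i' : FacetIdx d c)

/-- `z` is a relative interior point of the `i`-th facet. -/
def RelInt (z : E d) : Prop := G.l i z = 0 ∧ ∀ j, j ≠ i → 0 < G.l j z

theorem relInt_z : G.RelInt i (G.z i) := ⟨G.z_zero i, G.z_pos i⟩

variable {G i}

theorem RelInt.mem_facet {z : E d} (hz : G.RelInt i z) : z ∈ G.facet i := by
  refine ⟨G.mem_iff'.2 fun j => ?_, hz.1⟩
  rcases eq_or_ne j i with rfl | h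
  · exact hz.1.ge
  · exact (hz.2 j h).le

theorem RelInt.eventually_pos {z : E d} (hz : G.RelInt i z) (v : E d) :
    ∀ᶠ s : ℝ in 𝓝 0, ∀ j, j ≠ i → 0 < G.l j (z + s • v) := by
  refine Filter.eventually_all.2 fun j => ?_
  by_cases hj : j = i
  · exact .of_forall fun s h => absurd hj h
  have hc : Continuous fun s : ℝ => G.l j (z + s • v) := (G.continuous_l j).comp (by fun_prop)
  have h0 : 0 < G.l j (z + (0 : ℝ) • v) := by simpa using hz.2 j hj
  exact (hc.tendsto 0 |>.eventually (lt_mem_nhds h0)).mono fun s hs _ => hs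

theorem RelInt.eventually_mem_facet {z : E d} (hz : G.RelInt i z) {v : E d}
    (hv : ⟪G.n i, v⟫_ℝ = 0) : ∀ᶠ s : ℝ in 𝓝 0, z + s • v ∈ G.facet i := by
  filter_upwards [hz.eventually_pos v] with s hs
  refine RelInt.mem_facet ⟨?_, hs⟩
  rw [l_add, real_inner_smul_right, hv, mul_zero, add_zero, hz.1]

theorem RelInt.exists_mem_facet {z : E d} (hz : G.RelInt i z) {v : E d}
    (hv : ⟪G.n i, v⟫_ℝ = 0) : ∃ s : ℝ, 0 < s ∧ z + s • v ∈ G.facet i := by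
  have h := (hz.eventually_mem_facet hv).filter_mono (nhdsWithin_le_nhds (s := Ioi 0))
  obtain ⟨s, hs, hs0⟩ := (h.and self_mem_nhdsWithin).exists
  exact ⟨s, hs0, hs⟩

theorem inner_sub_of_l_eq {x y : E d} (hx : G.l i x = 0) (hy : G.l i y = 0) :
    ⟪G.n i, x - y⟫_ℝ = 0 := by
  simp only [l] at hx hy
  rw [inner_sub_right]
  linarith

theorem RelInt.eventually_mem_interior {z : E d} (hz : G.RelInt i z) {v : E d}
    (hv : 0 < ⟪G.n i, v⟫_ℝ) : ∀ᶠ s : ℝ in 𝓝[>] 0, z + s • v ∈ interior K := by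
  filter_upwards [(hz.eventually_pos v).filter_mono nhdsWithin_le_nhds, self_mem_nhdsWithin]
    with s hs hs0
  refine G.mem_interior fun j => ?_
  rcases eq_or_ne j i with rfl | h
  · rw [l_add, hz.1, zero_add, real_inner_smul_right]
    exact mul_pos hs0 hv
  · exact hs j h

/-- The facet spans the hyperplane `ℓᵢ = 0`. -/
theorem RelInt.exists_smul {z : E d} (hz : G.RelInt i z)
    (h : ∀ x ∈ G.facet i, G'.l i' x = 0) :
    ∃ t : ℝ, t ≠ 0 ∧ G'.n i' = t • G.n i ∧ ∀ x, G'.l i' x = t * G.l i x := by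
  obtain ⟨t, ht⟩ := exists_eq_smul_of_orthogonal (n := G.n i) (n' := G'.n i') fun v hv => by
    obtain ⟨s, hs0, hs⟩ := hz.exists_mem_facet hv
    have h1 := h _ hs
    rw [l_add, h z hz.mem_facet, zero_add, real_inner_smul_right] at h1
    exact (mul_eq_zero.1 h1).resolve_left hs0.ne'
  refine ⟨t, ?_, ht, fun x => ?_⟩
  · rintro rfl
    exact G'.n_ne i' (by rw [ht, zero_smul])
  · have h1 : G'.l i' x = G'.l i' (z + (x - z)) := by rw [add_sub_cancel]
    have h2 : G.l i x = G.l i (z + (x - z)) := by rw [add_sub_cancel]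
    rw [h1, h2, l_add, l_add, h z hz.mem_facet, hz.1, ht, real_inner_smul_left, zero_add, zero_add]

variable {G'}

/-- The relative interior is defined through the inequalities of one cell. If another affine
function of the second cell vanished at z, moving slightly past z, away from the point `G'.z i'`,
would stay in the facet but make that function negative. -/
theorem RelInt.of_facet_eq {z : E d} (hz : G.RelInt i z)
    (h : G.facet i = G'.facet i') : G'.RelInt i' z := by
  have hz' : z ∈ G'.facet i' := h ▸ hz.mem_facet
  refine ⟨hz'.2, fun j hj => ?_⟩
  have hm : G'.z i' ∈ G.facet i := h ▸ G'.z_mem_facet i'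
  obtain ⟨s, hs0, hs⟩ := hz.exists_mem_facet (inner_sub_of_l_eq hz.1 hm.2)
  have h1 : 0 ≤ G'.l j (z + s • (z - G'.z i')) := by
    rw [h] at hs
    exact G'.l_nonneg j hs.1
  have h2 := (G'.relInt_z i').2 j hj
  rw [l_add, real_inner_smul_right, inner_sub_right] at h1
  simp only [l] at h1 h2 ⊢
  by_contra! h3
  nlinarith

/-- Cells without common interior points lie on opposite sides of a common facet. -/
theorem exists_neg_of_facet_eq (hdisj : Disjoint (interior K) (interior K'))
    (h : G.facet i = G'.facet i') :
    ∃ t : ℝ, t < 0 ∧ G'.n i' = t • G.n i ∧ ∀ x, G'.l i' x = t * G.l i x := by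
  have hz := G.relInt_z i
  obtain ⟨t, ht0, ht, htl⟩ := hz.exists_smul G' i' (fun x hx => (h ▸ hx : x ∈ G'.facet i').2)
  refine ⟨t, lt_of_le_of_ne (le_of_not_gt fun hpos => ?_) ht0, ht, htl⟩
  have hn : 0 < ⟪G.n i, G.n i⟫_ℝ := by
    rw [real_inner_self_eq_norm_sq]
    have := norm_pos_iff.2 (G.n_ne i)
    positivity
  have h1 := hz.eventually_mem_interior hn
  have h2 := (hz.of_facet_eq i' h).eventually_mem_interior (v := G.n i) (by
    rw [ht, real_inner_smul_left]
    exact mul_pos hpos hn)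
  obtain ⟨s, hs1, hs2⟩ := (h1.and h2).exists
  exact disjoint_left.1 hdisj hs1 hs2

/-- The affine map between cells with a common facet. -/
def shear (G : CellGeom c K) (i : FacetIdx d c) (w x : E d) : E d := x + G.l i x • w

section Shear

variable {t : ℝ}

/-- The shear fixes the facet pointwise and intertwines the dilations of the two cells. Every point
of K with ℓᵢ < 1 is a dilate, with factor in (0, 1], of a facet point, so its image is such a dilate
inside K'. -/
theorem shear_mem (h : G.facet i = G'.facet i') (ht0 : t ≠ 0) (ht : G'.n i' = t • G.n i)
    {x : E d} (hx : x ∈ K) :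
    G.shear i (shapeProj c (G.n i) (G'.p i' - G.p i)) x ∈ K' := by
  set w := shapeProj c (G.n i) (G'.p i' - G.p i) with hw
  have hw' : shapeProj c (G.n i) w = w := shapeProj_idem c (G.n_ne i) _
  have hcomm : ∀ s x, G.shear i w (G.S i s x) = G'.S i' s (G.shear i w x) := by
    intro s x
    have h1 : G'.X i' (G.shear i w x) = G.X i x - w + G.l i x • w := by
      rw [X, ht, shapeProj_smul c _ ht0, shear, X]
      have : x + G.l i x • w - G'.p i' = (x - G.p i) - (G'.p i' - G.p i) + G.l i x • w := by module
      rw [this, map_add, map_sub, map_smul, ← hw, hw']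
    change G.shear i w (x + (s - 1) • G.X i x) =
      G.shear i w x + (s - 1) • G'.X i' (G.shear i w x)
    rw [h1, shear, shear, l_add, real_inner_smul_right, G.inner_X]
    module
  have hlt : ∀ x ∈ K, G.l i x < 1 → G.shear i w x ∈ K' := by
    intro x hx h1
    have hs0 : 0 < 1 - G.l i x := by linarith
    set s := 1 - G.l i x with hs
    have hs1 : s ≤ 1 := by linarith [G.l_nonneg i hx]
    have hl : G.l i (G.S i s⁻¹ x) = 0 := by
      have h3 := G.l_S i s⁻¹ x
      rw [← hs, inv_mul_cancel₀ hs0.ne'] at h3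
      linarith
    have hF : G.S i s⁻¹ x ∈ G.facet i := ⟨G.S_mem i (by positivity) hx hl.ge, hl⟩
    have hx' : x = G.S i s (G.S i s⁻¹ x) := by
      rw [S_S, mul_inv_cancel₀ hs0.ne', S_one]
    rw [hx', hcomm]
    have h4 : G.shear i w (G.S i s⁻¹ x) = G.S i s⁻¹ x := by
      rw [shear, hl, zero_smul, add_zero]
    rw [h4]
    exact G'.S_mem_of_le_one i' hs0.le hs1 (h ▸ hF : _ ∈ G'.facet i').1
  -- Where ℓᵢ = 1 the point cannot be dilated back to the facet; it is approached along the segment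
  -- towards the facet point zᵢ, and K' is closed.
  have hc : Continuous fun ε : ℝ => G.shear i w (x + ε • (G.z i - x)) := by
    have := G.continuous_l i
    unfold shear
    fun_prop
  have hmem : ∀ᶠ ε : ℝ in 𝓝[>] 0, G.shear i w (x + ε • (G.z i - x)) ∈ K' := by
    filter_upwards [Ioc_mem_nhdsGT (show (0 : ℝ) < 1 by norm_num)] with ε hε
    refine hlt _ (G.body.convex.add_smul_sub_mem hx (G.z_mem i) ⟨hε.1.le, hε.2⟩) ?_
    have h1 : G.l i x ≤ 1 := G.le_one x hx i
    have h2 : G.l i (G.z i) = 0 := G.z_zero i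
    rw [l_add, real_inner_smul_right, inner_sub_right]
    simp only [l] at h1 h2 ⊢
    nlinarith [hε.1, mul_nonneg (sub_nonneg.2 hε.2) (sub_nonneg.2 h1)]
  have := G'.isClosed.mem_of_tendsto ((hc.tendsto 0).mono_left nhdsWithin_le_nhds) hmem
  simpa using this

theorem l_shear (htl : ∀ x, G'.l i' x = t * G.l i x) (x : E d) :
    G.l i (G.shear i (shapeProj c (G.n i) (G'.p i' - G.p i)) x) = t⁻¹ * G.l i x ∧
      1 + ⟪G.n i, shapeProj c (G.n i) (G'.p i' - G.p i)⟫_ℝ = t⁻¹ := by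
  have h1 : 1 + ⟪G.n i, shapeProj c (G.n i) (G'.p i' - G.p i)⟫_ℝ = t⁻¹ := by
    rw [inner_shapeProj c (G.n_ne i)]
    have h2 : G'.l i' (G'.p i') = 1 := G'.p_one i'
    have h3 : G.l i (G.p i) = 1 := G.p_one i
    rw [htl] at h2
    have h4 : G.l i (G'.p i') = t⁻¹ := eq_inv_of_mul_eq_one_right h2
    rw [inner_sub_right, ← h4]
    simp only [l] at h3 ⊢
    linarith
  refine ⟨?_, h1⟩
  rw [shear, l_add, real_inner_smul_right, ← h1]
  ring

theorem image_shear (h : G.facet i = G'.facet i') (ht0 : t ≠ 0) (ht : G'.n i' = t • G.n i)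
    (htl : ∀ x, G'.l i' x = t * G.l i x) :
    G.shear i (shapeProj c (G.n i) (G'.p i' - G.p i)) '' K = K' := by
  have ht' : G.n i = t⁻¹ • G'.n i' := by rw [ht, smul_smul, inv_mul_cancel₀ ht0, one_smul]
  have htl' : ∀ x, G.l i x = t⁻¹ * G'.l i' x := fun x => by
    rw [htl, ← mul_assoc, inv_mul_cancel₀ ht0, one_mul]
  refine Subset.antisymm (image_subset_iff.2 fun x hx => shear_mem i' h ht0 ht hx) fun y hy => ?_
  refine ⟨_, shear_mem i h.symm (inv_ne_zero ht0) ht' hy, ?_⟩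
  have h1 := (l_shear (G := G') (G' := G) (i := i') i htl' y).1
  have hP : shapeProj c (G'.n i') = shapeProj c (G.n i) := by rw [ht, shapeProj_smul c _ ht0]
  rw [shear, htl', h1, inv_inv, ← mul_assoc, inv_mul_cancel₀ ht0, one_mul, shear, hP,
    ← neg_sub (G'.p i') (G.p i), map_neg]
  module

theorem hasFDerivAt_shear (w x : E d) : HasFDerivAt (G.shear i w)
    (ContinuousLinearMap.id ℝ (E d) + (innerSL ℝ (G.n i)).smulRight w) x := by
  have h1 : HasFDerivAt (G.l i) (innerSL ℝ (G.n i)) x :=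
    ((innerSL ℝ (G.n i)).hasFDerivAt (x := x)).add_const (G.γ i)
  exact (hasFDerivAt_id x).add (h1.smul_const w)

theorem integral_of_facet_eq (h : G.facet i = G'.facet i') (ht0 : t ≠ 0)
    (ht : G'.n i' = t • G.n i) (htl : ∀ x, G'.l i' x = t * G.l i x) (g : E d → ℝ) :
    ∫ x in K', g x = |t|⁻¹ *
      ∫ x in K, g (G.shear i (shapeProj c (G.n i) (G'.p i' - G.p i)) x) := by
  set w := shapeProj c (G.n i) (G'.p i' - G.p i) with hw
  have hdet : 1 + ⟪G.n i, w⟫_ℝ = t⁻¹ := (l_shear i' htl 0).2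
  have hinj : Function.Injective (G.shear i w) := by
    intro x y hxy
    have h1 := (l_shear i' htl x).1
    have h2 := (l_shear i' htl y).1
    rw [← hw] at h1 h2
    rw [hxy, h2] at h1
    have h3 : G.l i x = G.l i y := (mul_left_cancel₀ (inv_ne_zero ht0) h1).symm
    rw [shear, shear, h3] at hxy
    exact add_right_cancel hxy
  rw [← image_shear i' h ht0 ht htl, integral_image_eq_integral_abs_det_fderiv_smul volume
    G.measurableSet (fun x _ => (hasFDerivAt_shear w x).hasFDerivWithinAt) hinj.injOn]
  simp_rw [det_id_add_smulRight, hdet, smul_eq_mul, abs_inv]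
  rw [integral_const_mul]

/-- The functions φ and φ ∘ shear agree on the facet, so they have the same flux by `J_eq_zero`. The
change of variables carries Xᵢ to the facet field of the neighbour and contributes the Jacobian
|t|⁻¹. -/
theorem J_of_facet_eq (h : G.facet i = G'.facet i') (ht0 : t ≠ 0)
    (ht : G'.n i' = t • G.n i) (htl : ∀ x, G'.l i' x = t * G.l i x) {φ : E d → ℝ}
    (hφ : ContDiff ℝ 1 φ) : G'.J i' φ = |t|⁻¹ * G.J i φ := by
  set w := shapeProj c (G.n i) (G'.p i' - G.p i) with hw
  have hw' : shapeProj c (G.n i) w = w := shapeProj_idem c (G.n_ne i) _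
  have hA : ContDiff ℝ 1 (G.shear i w) := by
    exact contDiff_id.add
      (((contDiff_const.inner ℝ contDiff_id).add contDiff_const).smul contDiff_const)
  have hφA : ContDiff ℝ 1 (φ ∘ G.shear i w) := hφ.comp hA
  have hzero := G.J_eq_zero i (hφ.sub hφA) fun x hx => by
    simp only [Function.comp_apply, shear, hx.2, zero_smul, add_zero, sub_self]
  have hK := G.isCompact
  have hcX := G.continuous_X i
  have hint : ∀ f : E d → ℝ, ContDiff ℝ 1 f →
      IntegrableOn (fun x => fderiv ℝ f x (G.X i x) + shapeDiv d c * f x) K := by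
    intro f hf
    have h1 := hf.continuous_fderiv (by simp)
    have h2 := hf.continuous
    exact ContinuousOn.integrableOn_compact hK (Continuous.continuousOn (by fun_prop))
  have hJ : G.J i φ = G.J i (φ ∘ G.shear i w) := by
    rw [← sub_eq_zero, ← hzero, J, J, J, ← integral_sub (hint _ hφ) (hint _ hφA)]
    refine integral_congr_ae (.of_forall fun x => ?_)
    have h1 : fderiv ℝ (fun x => φ x - (φ ∘ G.shear i w) x) x = fderiv ℝ φ x - fderiv ℝ (φ ∘ G.shear i w) x :=
      fderiv_fun_sub (hφ.differentiable (by simp) x) (hφA.differentiable (by simp) x)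
    simp only [h1, sub_apply]
    ring
  rw [hJ, J, J, integral_of_facet_eq i' h ht0 ht htl]
  congr 1
  refine integral_congr_ae (.of_forall fun x => ?_)
  have h1 : HasFDerivAt (φ ∘ G.shear i w) _ x :=
    (hφ.differentiable (by simp) (G.shear i w x)).hasFDerivAt.comp x (hasFDerivAt_shear w x)
  have h2 : G'.X i' (G.shear i w x) = G.X i x + ⟪G.n i, G.X i x⟫_ℝ • w := by
    rw [G.inner_X, X, ht, shapeProj_smul c _ ht0, shear, X]
    have : x + G.l i x • w - G'.p i' = (x - G.p i) - (G'.p i' - G.p i) + G.l i x • w := by module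
    rw [this, map_add, map_sub, map_smul, ← hw, hw']
    module
  simp only [h1.fderiv]
  rw [← hw, h2]
  rfl

end Shear

/-- Evaluating the two facet functions at the origin gives γ' = tγ with t < 0, and the Jacobian
|t|⁻¹ leaves only the sign. This is the continuity of the normal flux of γᵢXᵢ across a facet. -/
theorem γ_mul_J_of_facet_eq (hdisj : Disjoint (interior K) (interior K'))
    (h : G.facet i = G'.facet i') {φ : E d → ℝ} (hφ : ContDiff ℝ 1 φ) :
    G'.γ i' * G'.J i' φ = -(G.γ i * G.J i φ) := by
  obtain ⟨t, ht, htn, htl⟩ := exists_neg_of_facet_eq i' hdisj h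
  have h0 := htl 0
  simp only [l, inner_zero_right, zero_add] at h0
  rw [J_of_facet_eq i' h ht.ne htn htl hφ, h0, abs_of_neg ht]
  have := ht.ne
  field_simp

/-- Up to the factor `shapeDiv d c`, γᵢ times the volume is the flux of the position field through
the facet, seen from opposite sides. -/
theorem γ_mul_volume_of_facet_eq (hdisj : Disjoint (interior K) (interior K'))
    (h : G.facet i = G'.facet i') :
    G'.γ i' * volume.real K' = -(G.γ i * volume.real K) := by
  obtain ⟨t, ht, htn, htl⟩ := exists_neg_of_facet_eq i' hdisj h
  have h0 := htl 0
  simp only [l, inner_zero_right, zero_add] at h0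
  have h1 := integral_of_facet_eq i' h ht.ne htn htl fun _ => 1
  simp only [integral_const, MeasurableSet.univ, measureReal_restrict_apply, univ_inter,
      smul_eq_mul, mul_one] at h1
  rw [h1, h0, abs_of_neg ht]
  have := ht.ne
  field_simp

theorem disjoint_interior_left (G' : CellGeom c K') (hdisj : Disjoint (interior K) (interior K')) :
    Disjoint (interior K) K' := by
  have h := hdisj.closure_right isOpen_interior
  rwa [G'.body.convex.closure_interior_eq_closure_of_nonempty_interior G'.body.nonempty,
    G'.isClosed.closure_eq] at h

/-- A facet contained in another cell is a facet of that cell. -/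
theorem exists_facet_eq_of_subset (hdisj : Disjoint (interior K) (interior K'))
    (hext : IsExtreme ℝ K' (K' ∩ K)) (hsub : G.facet i ⊆ K') :
    ∃ i', G.facet i = G'.facet i' := by
  have hz := G.relInt_z i
  have hd1 := disjoint_interior_left G' hdisj
  have hd2 := disjoint_interior_left G hdisj.symm
  -- A common point y off the facet would make the midpoint of zᵢ and y interior to K while still in
  -- K'.
  have hinter : ∀ y ∈ K, y ∈ K' → y ∈ G.facet i := by
    intro y hy hy'
    by_contra hy0
    have hly : 0 < G.l i y := lt_of_le_of_ne (G.l_nonneg i hy) fun h => hy0 ⟨hy, h.symm⟩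
    have hm : (1 / 2 : ℝ) • G.z i + (1 / 2 : ℝ) • y ∈ K' :=
      G'.body.convex (hsub hz.mem_facet) hy' (by norm_num) (by norm_num) (by norm_num)
    refine disjoint_left.1 hd1 (G.mem_interior fun j => ?_) hm
    have h1 : G.l j ((1 / 2 : ℝ) • G.z i + (1 / 2 : ℝ) • y)
        = (1 / 2) * G.l j (G.z i) + (1 / 2) * G.l j y := by
      simp only [l, inner_add_right, real_inner_smul_right]
      ring
    rw [h1]
    rcases eq_or_ne j i with rfl | hj
    · rw [hz.1]; linarith
    · have := hz.2 j hj
      have := G.l_nonneg j hy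
      linarith
  have hzK' : G.z i ∈ K' := hsub hz.mem_facet
  obtain ⟨i', hi'⟩ : ∃ i', G'.l i' (G.z i) = 0 := by
    by_contra! hne
    refine disjoint_left.1 hd2 (G'.mem_interior fun j => ?_) (G.z_mem i)
    exact lt_of_le_of_ne (G'.l_nonneg j hzK') (hne j).symm
  -- A nonnegative affine function vanishing at a relative interior point vanishes on the whole
  -- facet.
  have hFF' : ∀ y ∈ G.facet i, G'.l i' y = 0 := by
    intro y hy
    obtain ⟨s, hs0, hs⟩ := hz.exists_mem_facet (inner_sub_of_l_eq hz.1 hy.2)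
    have h1 := G'.l_nonneg i' (hsub hs)
    have h2 := G'.l_nonneg i' (hsub hy)
    rw [l_add, real_inner_smul_right, inner_sub_right] at h1
    simp only [l] at h1 h2 hi' ⊢
    nlinarith
  refine ⟨i', Subset.antisymm (fun y hy => ⟨hsub hy, hFF' y hy⟩) fun y hy => ?_⟩
  obtain ⟨t, ht0, -, htl⟩ := hz.exists_smul G' i' hFF'
  have hly : G.l i y = 0 := by
    have := hy.2
    rw [htl] at this
    exact (mul_eq_zero.1 this).resolve_left ht0
  obtain ⟨s, hs0, hs⟩ := hz.exists_mem_facet (inner_sub_of_l_eq hz.1 hly)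
  have hseg : G.z i ∈ openSegment ℝ y (G.z i + s • (G.z i - y)) := by
    refine ⟨s / (1 + s), 1 / (1 + s), by positivity, by positivity, by field_simp; ring, ?_⟩
    have h1 : (s / (1 + s)) • y + (1 / (1 + s)) • (G.z i + s • (G.z i - y))
        = ((1 + s) / (1 + s)) • G.z i := by
      module
    rw [h1, div_self (by positivity), one_smul]
  have := hext.left_mem_of_mem_openSegment hy.1 (hsub hs) ⟨hzK', G.z_mem i⟩ hseg
  exact ⟨this.2, hly⟩

/-- A facet whose relative interior meets another cell is contained in it. -/
theorem facet_subset_of_relInt_mem {z : E d} (hz : G.RelInt i z) (hz' : z ∈ K')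
    (hext : IsExtreme ℝ K (K ∩ K')) : G.facet i ⊆ K' := by
  intro y hy
  obtain ⟨s, hs0, hs⟩ := hz.exists_mem_facet (inner_sub_of_l_eq hz.1 hy.2)
  have hseg : z ∈ openSegment ℝ y (z + s • (z - y)) := by
    refine ⟨s / (1 + s), 1 / (1 + s), by positivity, by positivity, by field_simp; ring, ?_⟩
    have h1 : (s / (1 + s)) • y + (1 / (1 + s)) • (z + s • (z - y))
        = ((1 + s) / (1 + s)) • z := by
      module
    rw [h1, div_self (by positivity), one_smul]
  exact (hext.left_mem_of_mem_openSegment hy.1 hs.1 ⟨hz.mem_facet.1, hz'⟩ hseg).2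

/-- A given facet point may lie on the relative boundary; a small move towards `G.z i` stays in Ω
and makes the other inequalities strict. -/
theorem exists_relInt_of_mem_open {Ω : Set (E d)} (hΩ : IsOpen Ω) {y : E d}
    (hy : y ∈ G.facet i) (hyΩ : y ∈ Ω) : ∃ z ∈ Ω, G.RelInt i z := by
  have hc : Continuous fun s : ℝ => y + s • (G.z i - y) := by fun_prop
  have h0 : y + (0 : ℝ) • (G.z i - y) ∈ Ω := by simpa using hyΩ
  have h1 : ∀ᶠ s : ℝ in 𝓝[>] 0, y + s • (G.z i - y) ∈ Ω :=
    ((hc.tendsto 0).eventually (hΩ.mem_nhds h0)).filter_mono nhdsWithin_le_nhds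
  obtain ⟨s, hs, hs1⟩ := (h1.and (Ioc_mem_nhdsGT (show (0 : ℝ) < 1 by norm_num))).exists
  have hl : ∀ j, G.l j (y + s • (G.z i - y)) = (1 - s) * G.l j y + s * G.l j (G.z i) := by
    intro j
    rw [l_add, real_inner_smul_right, inner_sub_right]
    simp only [l]
    ring
  refine ⟨_, hs, ?_, fun j hj => ?_⟩
  · rw [hl, hy.2, (G.relInt_z i).1]; ring
  · rw [hl]
    have h2 := G.l_nonneg j hy.1
    have h3 := (G.relInt_z i).2 j hj
    have h4 : 0 ≤ (1 - s) * G.l j y := mul_nonneg (by linarith [hs1.2]) h2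
    have h5 := mul_pos hs1.1 h3
    linarith

/-- The other cells of a cover touch every relative interior point of a facet that lies in
the open set covered. -/
theorem exists_cell_of_relInt {Ω : Set (E d)} (hΩ : IsOpen Ω) {T : Finset (Set (E d))}
    (hcl : ∀ K ∈ T, IsClosed K) (hcov : Ω ⊆ ⋃ K ∈ T, K) {z : E d} (hzΩ : z ∈ Ω)
    (hz : G.RelInt i z) : ∃ K' ∈ T, K' ≠ K ∧ z ∈ K' := by
  by_contra! hcon
  have hc : Continuous fun s : ℝ => z + s • (-G.n i) := by fun_prop
  have h0 : z + (0 : ℝ) • (-G.n i) = z := by simp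
  have h1 : ∀ᶠ s : ℝ in 𝓝[>] 0, z + s • (-G.n i) ∈ Ω :=
    ((hc.tendsto 0).eventually (hΩ.mem_nhds (by rwa [h0]))).filter_mono nhdsWithin_le_nhds
  have h2 : ∀ᶠ s : ℝ in 𝓝[>] 0, ∀ K' ∈ T, K' ≠ K → z + s • (-G.n i) ∉ K' := by
    refine (Filter.eventually_all_finset T).2 fun K' hK' => ?_
    by_cases hne : K' = K
    · exact .of_forall fun s h => absurd hne h
    refine Filter.Eventually.mono ?_ fun s hs _ => hs
    exact ((hc.tendsto 0).eventually ((hcl K' hK').isOpen_compl.mem_nhds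
      (by rw [h0]; exact hcon K' hK' hne))).filter_mono nhdsWithin_le_nhds
  obtain ⟨s, ⟨hs1, hs2⟩, hs0⟩ := ((h1.and h2).and self_mem_nhdsWithin).exists
  obtain ⟨K', hK', hmem⟩ := mem_iUnion₂.1 (hcov hs1)
  by_cases hne : K' = K
  · subst hne
    have h3 := G.l_nonneg i hmem
    rw [l_add, hz.1, zero_add, real_inner_smul_right, inner_neg_right,
      real_inner_self_eq_norm_sq] at h3
    have h4 := norm_pos_iff.2 (G.n_ne i)
    have : 0 < s * ‖G.n i‖ ^ 2 := mul_pos hs0 (by positivity)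
    linarith
  · exact hs2 K' hK' hne hmem

end CellGeom

end ExpandedMsFEM

end

noncomputable section

namespace ExpandedMsFEM

variable {d : ℕ}

/-! ### The geometry of boxes and simplices -/

theorem inner_single (i : Fin d) (r : ℝ) (x : E d) :
    ⟪EuclideanSpace.single i r, x⟫_ℝ = r * x i := by
  rw [EuclideanSpace.inner_single_left]
  simp

theorem shapeProj_box_single (i : Fin d) {r : ℝ} (hr : r ≠ 0) (v : E d) :
    shapeProj .box (EuclideanSpace.single i r) v = EuclideanSpace.single i (v i) := by
  rw [shapeProj_box_apply, inner_single, PiLp.norm_single]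
  ext j
  by_cases h : j = i
  · subst h
    simp only [PiLp.smul_apply, PiLp.single_apply, if_pos, smul_eq_mul, Real.norm_eq_abs, sq_abs]
    field_simp
  · simp [h]

/-- The closed box with corners `a`, `b`. -/
def boxSet (a b : E d) : Set (E d) := {x | ∀ i, a i ≤ x i ∧ x i ≤ b i}

theorem isBounded_boxSet (a b : E d) : Bornology.IsBounded (boxSet a b) := by
  have h1 : Bornology.IsBounded (Set.Icc a.ofLp b.ofLp) := Metric.isBounded_Icc _ _
  have h2 := (PiLp.lipschitzWith_toLp 2 fun _ : Fin d => ℝ).isBounded_image h1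
  refine h2.subset fun x hx => ⟨x.ofLp, ⟨fun i => (hx i).1, fun i => (hx i).2⟩, rfl⟩

theorem convex_boxSet (a b : E d) : Convex ℝ (boxSet a b) := by
  intro x hx y hy s t hs ht hst i
  have h1 := hx i
  have h2 := hy i
  have h3 : s • x i + t • y i ∈ Set.Icc (a i) (b i) := (convex_Icc (a i) (b i)) h1 h2 hs ht hst
  exact h3

theorem interior_boxSet_nonempty {a b : E d} (hab : ∀ i, a i < b i) :
    (interior (boxSet a b)).Nonempty := by
  have ho : IsOpen (⋂ i, {x : E d | a i < x i ∧ x i < b i}) :=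
    isOpen_iInter_of_finite fun i => by
      have hc : Continuous fun x : E d => x i := by fun_prop
      exact (isOpen_lt continuous_const hc).inter (isOpen_lt hc continuous_const)
  have hsub : (⋂ i, {x : E d | a i < x i ∧ x i < b i}) ⊆ boxSet a b := fun x hx i =>
    ⟨(mem_iInter.1 hx i).1.le, (mem_iInter.1 hx i).2.le⟩
  refine ⟨WithLp.toLp 2 fun i => (a i + b i) / 2, interior_maximal hsub ho
    (mem_iInter.2 fun i => ?_)⟩
  have := hab i
  constructor <;> simp only <;> linarith

/-- The facets of a box. -/
def boxGeom {a b : E d} (hab : ∀ i, a i < b i) : CellGeom .box (boxSet a b) where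
  n q := EuclideanSpace.single q.1 (if q.2 then -(b q.1 - a q.1)⁻¹ else (b q.1 - a q.1)⁻¹)
  γ q := if q.2 then b q.1 / (b q.1 - a q.1) else -(a q.1 / (b q.1 - a q.1))
  p q := if q.2 then a else b
  z q := WithLp.toLp 2 fun j => if j = q.1 then (if q.2 then b j else a j) else (a j + b j) / 2
  n_ne := by
    rintro ⟨i, s⟩
    have := sub_pos.2 (hab i)
    rw [Ne, PiLp.single_eq_zero_iff]
    cases s <;> simp [this.ne']
  mem_iff x := by
    constructor
    · rintro hx ⟨i, s⟩
      have h := sub_pos.2 (hab i)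
      rw [inner_single]
      cases s
      · simp only [Bool.false_eq_true, if_false]
        rw [← sub_eq_add_neg, div_eq_inv_mul, ← mul_sub]
        exact mul_nonneg (by positivity) (by linarith [(hx i).1])
      · simp only [if_true]
        rw [div_eq_inv_mul, neg_mul, neg_add_eq_sub, ← mul_sub]
        exact mul_nonneg (by positivity) (by linarith [(hx i).2])
    · intro hx i
      have h := sub_pos.2 (hab i)
      constructor
      · have h1 := hx (i, false)
        rw [inner_single] at h1
        simp only [Bool.false_eq_true, if_false] at h1
        rw [← sub_eq_add_neg, div_eq_inv_mul, ← mul_sub] at h1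
        have := nonneg_of_mul_nonneg_right h1 (inv_pos.2 h)
        linarith
      · have h1 := hx (i, true)
        rw [inner_single] at h1
        simp only [if_true] at h1
        rw [div_eq_inv_mul, neg_mul, neg_add_eq_sub, ← mul_sub] at h1
        have := nonneg_of_mul_nonneg_right h1 (inv_pos.2 h)
        linarith
  le_one x hx := by
    rintro ⟨i, s⟩
    have h := sub_pos.2 (hab i)
    rw [inner_single]
    cases s
    · simp only [Bool.false_eq_true, if_false]
      rw [← sub_eq_add_neg, div_eq_inv_mul, ← mul_sub, inv_mul_le_iff₀ h]
      linarith [(hx i).2]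
    · simp only [if_true]
      rw [div_eq_inv_mul, neg_mul, neg_add_eq_sub, ← mul_sub, inv_mul_le_iff₀ h]
      linarith [(hx i).1]
  p_mem := by
    rintro ⟨i, s⟩
    cases s
    · exact fun j => ⟨(hab j).le, le_rfl⟩
    · exact fun j => ⟨le_rfl, (hab j).le⟩
  p_one := by
    rintro ⟨i, s⟩
    have h := (sub_pos.2 (hab i)).ne'
    rw [inner_single]
    cases s
    · simp only [Bool.false_eq_true, if_false]
      field_simp
      ring
    · simp only [if_true]
      field_simp
      ring
  z_zero := by
    rintro ⟨i, s⟩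
    have h := (sub_pos.2 (hab i)).ne'
    rw [inner_single]
    cases s
    · simp only [Bool.false_eq_true, if_false, if_true]
      field_simp
      ring
    · simp only [if_true]
      field_simp
      ring
  z_pos := by
    rintro ⟨i, s⟩ ⟨j, s'⟩ hne
    have h := sub_pos.2 (hab j)
    rw [inner_single]
    have h1 : a j < b j := hab j
    have key : ∀ y : ℝ, (s' = false → a j < y) → (s' = true → y < b j) →
        0 < (if s' then -(b j - a j)⁻¹ else (b j - a j)⁻¹) * y +
          if s' then b j / (b j - a j) else -(a j / (b j - a j)) := by
      intro y h2 h3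
      cases s'
      · simp only [Bool.false_eq_true, if_false]
        rw [← sub_eq_add_neg, div_eq_inv_mul, ← mul_sub]
        exact mul_pos (by positivity) (by linarith [h2 rfl])
      · simp only [if_true]
        rw [div_eq_inv_mul, neg_mul, neg_add_eq_sub, ← mul_sub]
        exact mul_pos (by positivity) (by linarith [h3 rfl])
    refine key _ (fun hs => ?_) (fun hs => ?_)
    · subst hs
      by_cases hji : j = i
      · subst hji
        cases s
        · exact absurd rfl hne
        · simpa using h1
      · simp only [hji, if_false]
        linarith
    · subst hs
      by_cases hji : j = i
      · subst hji
        cases s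
        · simpa using h1
        · exact absurd rfl hne
      · simp only [hji, if_false]
        linarith
  scale := by
    rintro ⟨i, s⟩ ⟨j, s'⟩ hne
    have h := (sub_pos.2 (hab i)).ne'
    have hr : (if s then -(b i - a i)⁻¹ else (b i - a i)⁻¹) ≠ 0 := by
      cases s <;> simp [h]
    -- For the opposite facet, Xᵢ vanishes on it and s = 1; for facets in other coordinate
    -- directions, Xᵢ is parallel to them and s = 0.
    by_cases hji : j = i
    · subst hji
      refine ⟨1, zero_le_one, le_rfl, fun x => ?_⟩
      simp only
      rw [shapeProj_box_single _ hr, inner_single, inner_single]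
      cases s <;> cases s'
      · exact absurd rfl hne
      · simp
        field_simp
        ring
      · simp
        field_simp
        ring
      · exact absurd rfl hne
    · refine ⟨0, le_rfl, zero_le_one, fun x => ?_⟩
      simp only
      rw [shapeProj_box_single _ hr, inner_single]
      simp [hji]
  sum_one := by
    change ((1 : ℕ) : ℝ) * ∑ q : Fin d × Bool, _ = d
    rw [Fintype.sum_prod_type]
    simp only [Fintype.sum_bool, if_true, Bool.false_eq_true, if_false]
    rw [Finset.sum_congr rfl (g := fun _ => (1 : ℝ))]
    · simp
    · intro i _
      have h := (sub_pos.2 (hab i)).ne'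
      field_simp
      ring
  rt0 := by
    rintro ⟨i, s⟩
    have h := (sub_pos.2 (hab i)).ne'
    have hr : (if s then -(b i - a i)⁻¹ else (b i - a i)⁻¹) ≠ 0 := by
      cases s <;> simp [h]
    refine ⟨EuclideanSpace.single i (-((if s then a else b : E d) i)),
      EuclideanSpace.single i 1, ?_⟩
    funext x
    simp only
    rw [shapeProj_box_single _ hr]
    ext j
    by_cases hj : j = i
    · subst hj
      simp
      ring
    · simp [hj]
  body := ⟨convex_boxSet a b, isBounded_boxSet a b, interior_boxSet_nonempty hab⟩

/-- The affine basis given by the vertices of a simplex of full dimension. -/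
def simplexBasis (s : Affine.Simplex ℝ (E d) d) : AffineBasis (Fin (d + 1)) ℝ (E d) :=
  ⟨s.points, s.independent, by
    rw [s.independent.affineSpan_eq_top_iff_card_eq_finrank_add_one]
    simp⟩

/-- The gradient of a barycentric coordinate. -/
def coordGrad (s : Affine.Simplex ℝ (E d) d) (i : Fin (d + 1)) : E d :=
  (InnerProductSpace.toDual ℝ (E d)).symm
    (LinearMap.toContinuousLinearMap ((simplexBasis s).coord i).linear)

/-- The barycentre of the facet opposite to a vertex. -/
def facetCenter (s : Affine.Simplex ℝ (E d) d) (i : Fin (d + 1)) : E d :=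
  AffineMap.lineMap (s.points i) (Finset.univ.centroid ℝ (simplexBasis s)) ((d + 1 : ℝ) / d)

theorem simplexBasis_coord (s : Affine.Simplex ℝ (E d) d) (i : Fin (d + 1)) (x : E d) :
    ⟪coordGrad s i, x⟫_ℝ + (simplexBasis s).coord i 0 = (simplexBasis s).coord i x := by
  rw [coordGrad, InnerProductSpace.toDual_symm_apply]
  have := congrFun ((simplexBasis s).coord i).decomp x
  exact this.symm

theorem simplexBasis_coord_points (s : Affine.Simplex ℝ (E d) d) (i j : Fin (d + 1)) :
    (simplexBasis s).coord i (s.points j) = if i = j then 1 else 0 :=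
  (simplexBasis s).coord_apply i j

/-- From vertex i to the barycentre the i-th coordinate falls from 1 to 1/(d+1), so it reaches 0 at
the parameter (d+1)/d. -/
theorem simplexBasis_coord_facetCenter (hd : d ≠ 0) (s : Affine.Simplex ℝ (E d) d)
    (i j : Fin (d + 1)) :
    (simplexBasis s).coord j (facetCenter s i) = if j = i then 0 else (d : ℝ)⁻¹ := by
  have hd' : (d : ℝ) ≠ 0 := Nat.cast_ne_zero.2 hd
  rw [facetCenter, AffineMap.apply_lineMap,
    AffineBasis.coord_apply_centroid _ (Finset.mem_univ j),
    simplexBasis_coord_points, AffineMap.lineMap_apply_ring]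
  have hd1 : (d : ℝ) + 1 ≠ 0 := by positivity
  split_ifs
  · simp
    field_simp
    ring
  · simp
    field_simp

theorem coordGrad_ne_zero (hd : d ≠ 0) (s : Affine.Simplex ℝ (E d) d) (i : Fin (d + 1)) :
    coordGrad s i ≠ 0 := by
  intro h
  have h1 := simplexBasis_coord s i (s.points i)
  have h2 := simplexBasis_coord s i (facetCenter s i)
  rw [simplexBasis_coord_facetCenter hd, h, inner_zero_left, if_pos rfl] at h2
  rw [simplexBasis_coord_points, h, inner_zero_left, if_pos rfl, h2] at h1
  exact zero_ne_one h1

theorem mem_convexHull_points_iff (s : Affine.Simplex ℝ (E d) d) (x : E d) :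
    x ∈ convexHull ℝ (range s.points) ↔
      ∀ i, 0 ≤ ⟪coordGrad s i, x⟫_ℝ + (simplexBasis s).coord i 0 := by
  have h := (simplexBasis s).convexHull_eq_nonneg_coord
  change convexHull ℝ (range s.points) = _ at h
  rw [h]
  exact forall_congr' fun i => by rw [simplexBasis_coord]

theorem coord_le_one (s : Affine.Simplex ℝ (E d) d) (x : E d)
    (hx : x ∈ convexHull ℝ (range s.points)) (i : Fin (d + 1)) :
    ⟪coordGrad s i, x⟫_ℝ + (simplexBasis s).coord i 0 ≤ 1 := by
  rw [mem_convexHull_points_iff] at hx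
  simp_rw [simplexBasis_coord] at hx ⊢
  rw [← (simplexBasis s).sum_coord_apply_eq_one x]
  exact Finset.single_le_sum (f := fun j => (simplexBasis s).coord j x) (fun j _ => hx j)
    (Finset.mem_univ i)

theorem inner_coordGrad_sub (s : Affine.Simplex ℝ (E d) d) {i j : Fin (d + 1)} (hj : j ≠ i)
    (x : E d) : ⟪coordGrad s j, x - s.points i⟫_ℝ =
      1 * (⟪coordGrad s j, x⟫_ℝ + (simplexBasis s).coord j 0) := by
  have h1 := simplexBasis_coord s j x
  have h2 := simplexBasis_coord s j (s.points i)
  rw [simplexBasis_coord_points, if_neg hj] at h2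
  rw [one_mul, inner_sub_right]
  linarith

/-- The facets of a simplex. -/
def simplexGeom (hd : d ≠ 0) (s : Affine.Simplex ℝ (E d) d) :
    CellGeom .simplex (convexHull ℝ (range s.points)) where
  n := coordGrad s
  γ i := (simplexBasis s).coord i 0
  p := s.points
  z := facetCenter s
  n_ne := coordGrad_ne_zero hd s
  mem_iff := mem_convexHull_points_iff s
  le_one := coord_le_one s
  p_mem i := subset_convexHull ℝ _ (mem_range_self i)
  p_one i := (simplexBasis_coord s i _).trans
    ((simplexBasis_coord_points s i i).trans (if_pos rfl))
  z_zero i := (simplexBasis_coord s i _).trans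
    ((simplexBasis_coord_facetCenter hd s i i).trans (if_pos rfl))
  z_pos i j hj := ((simplexBasis_coord s j _).trans
    ((simplexBasis_coord_facetCenter hd s i j).trans (if_neg hj))).symm ▸
      inv_pos.2 (Nat.cast_pos.2 (Nat.pos_of_ne_zero hd))
  scale i j hj := ⟨1, zero_le_one, le_rfl, inner_coordGrad_sub s hj⟩
  sum_one := by
    change (d : ℝ) * ∑ i : Fin (d + 1), (simplexBasis s).coord i 0 = d
    rw [(simplexBasis s).sum_coord_apply_eq_one 0, mul_one]
  rt0 i := ⟨-s.points i, 1, by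
    funext x
    change x - s.points i = _
    module⟩
  body := ⟨convex_convexHull ℝ _, isBounded_convexHull.2 (finite_range _).isBounded,
    ⟨_, (simplexBasis s).centroid_mem_interior_convexHull⟩⟩

theorem IsCell.exists_geom {c : CellType} {K : Set (E d)} (hd : d ≠ 0) (h : IsCell c K) :
    Nonempty (CellGeom c K) := by
  cases c with
  | simplex =>
    obtain ⟨s, rfl⟩ := h
    exact ⟨simplexGeom hd s⟩
  | box =>
    obtain ⟨a, b, hab, rfl⟩ := h
    exact ⟨boxGeom hab⟩

end ExpandedMsFEM

end

noncomputable section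

namespace ExpandedMsFEM

variable {d : ℕ}

/-! ### Sums over the fibres of a map, with antisymmetric weights -/

section Fibers

variable {I S : Type*} [Fintype I] {F : I → S} {f : I → ℝ}

/-- A nonzero f s forces a partner in its fibre, and antisymmetry makes that partner's partner s
again, so the terms cancel under an involution. The weight a plays the role of a single-valued
trace, f that of an oriented flux. -/
theorem sum_mul_eq_zero_of_antisymm {a : I → ℝ} (ha : ∀ s t, F s = F t → a s = a t)
    (hf : ∀ s t, s ≠ t → F s = F t → f s = -f t)
    (h1 : ∀ s, (∀ t, F t = F s → t = s) → f s = 0) : ∑ s, a s * f s = 0 := by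
  classical
  have hex : ∀ s, f s ≠ 0 → ∃ t, F t = F s ∧ t ≠ s := by
    intro s hs
    by_contra! hcon
    exact hs (h1 s hcon)
  choose! o ho1 ho2 using hex
  have hneg : ∀ s, f s ≠ 0 → f (o s) = -f s := fun s hs => hf _ _ (ho2 s hs) (ho1 s hs)
  have hne : ∀ s, f s ≠ 0 → f (o s) ≠ 0 := fun s hs => by
    rw [hneg s hs]; exact neg_ne_zero.2 hs
  have hoo : ∀ s, f s ≠ 0 → o (o s) = s := by
    intro s hs
    by_contra hcon
    have e1 := hneg (o s) (hne s hs)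
    have e2 := hf _ _ hcon ((ho1 _ (hne s hs)).trans (ho1 s hs))
    rw [hneg s hs] at e1
    exact hs (by linarith)
  rw [← Finset.sum_filter_of_ne (p := fun s => f s ≠ 0) fun s _ h => right_ne_zero_of_mul h]
  refine Finset.sum_involution (fun s _ => o s) ?_ ?_ ?_ ?_
  · intro s hs
    have hs := (Finset.mem_filter.1 hs).2
    rw [hneg s hs, ha _ _ (ho1 s hs)]
    ring
  · intro s hs _
    exact ho2 s (Finset.mem_filter.1 hs).2
  · intro s hs
    exact Finset.mem_filter.2 ⟨Finset.mem_univ _, hne s (Finset.mem_filter.1 hs).2⟩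
  · intro s hs
    exact hoo s (Finset.mem_filter.1 hs).2

open Classical in
/-- Half the sum of `q` over the fibre of `s`. -/
def fiberAvg (F : I → S) (q : I → ℝ) (s : I) : ℝ := 2⁻¹ * ∑ t, if F t = F s then q t else 0

theorem fiberAvg_congr (q : I → ℝ) {s t : I} (h : F s = F t) :
    fiberAvg F q s = fiberAvg F q t := by
  rw [fiberAvg, fiberAvg, h]

/-- The discrete form of [q]{q} = [q²]/2. The factor 1/2 is kept on singleton fibres, so boundary
facets obey the same identity with exterior value 0. -/
theorem sum_mul_fiberAvg (q : I → ℝ) (hf : ∀ s t, s ≠ t → F s = F t → f s = -f t) :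
    ∑ s, q s * fiberAvg F q s * f s = 2⁻¹ * ∑ s, q s ^ 2 * f s := by
  classical
  have h1 : ∑ s, q s * fiberAvg F q s * f s
      = 2⁻¹ * ∑ s, ∑ t, if F t = F s then q s * q t * f s else 0 := by
    rw [Finset.mul_sum]
    refine Finset.sum_congr rfl fun s _ => ?_
    simp only [fiberAvg, Finset.mul_sum, Finset.sum_mul]
    refine Finset.sum_congr rfl fun t _ => ?_
    split_ifs <;> ring
  have h2 : ∑ s, ∑ t, (if F t = F s then q s * q t * f s else 0)
      = ∑ s, ∑ t, if F t = F s then q s * q t * f t else 0 := by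
    rw [Finset.sum_comm]
    refine Finset.sum_congr rfl fun s _ => Finset.sum_congr rfl fun t _ => ?_
    simp only [eq_comm (a := F s)]
    split_ifs <;> ring
  -- After symmetrising, an off-diagonal term is q s * q t * (f s + f t) = 0, and only the diagonal
  -- survives.
  have h3 : ∀ s, ∑ t, ((if F t = F s then q s * q t * f s else 0)
      + if F t = F s then q s * q t * f t else 0) = 2 * (q s ^ 2 * f s) := by
    intro s
    rw [Finset.sum_eq_single_of_mem s (Finset.mem_univ _)]
    · simp only [if_true]; ring
    · intro t _ hts
      split_ifs with h
      · rw [hf t s hts h]; ring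
      · ring
  have h4 : ∑ s, ∑ t, (if F t = F s then q s * q t * f s else 0) = ∑ s, q s ^ 2 * f s := by
    have h5 := Finset.sum_congr rfl fun s (_ : s ∈ Finset.univ) => h3 s
    simp only [Finset.sum_add_distrib] at h5
    rw [← h2, ← Finset.mul_sum] at h5
    linarith
  rw [h1, h4]

open Classical in
theorem sum_mul_fiberAvg_sq_le (hcard : ∀ s, (Finset.univ.filter fun t => F t = F s).card ≤ 2)
    (q : I → ℝ) {w : I → ℝ} (hw : ∀ s, 0 ≤ w s) {C : ℝ} (hC : 0 ≤ C)
    (hwC : ∀ s t, w s ≤ C * w t) :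
    ∑ s, w s * fiberAvg F q s ^ 2 ≤ C * ∑ s, w s * q s ^ 2 := by
  have h1 : ∀ s, fiberAvg F q s ^ 2 ≤ 2⁻¹ * ∑ t, if F t = F s then q t ^ 2 else 0 := by
    intro s
    rw [fiberAvg, ← Finset.sum_filter, ← Finset.sum_filter]
    have h2 := sq_sum_le_card_mul_sum_sq (s := Finset.univ.filter fun t => F t = F s) (f := q)
    have h3 : ((Finset.univ.filter fun t => F t = F s).card : ℝ) ≤ 2 := by
      exact_mod_cast hcard s
    have h4 : 0 ≤ ∑ t with F t = F s, q t ^ 2 := Finset.sum_nonneg fun t _ => sq_nonneg _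
    nlinarith
  calc ∑ s, w s * fiberAvg F q s ^ 2
      ≤ ∑ s, w s * (2⁻¹ * ∑ t, if F t = F s then q t ^ 2 else 0) :=
        Finset.sum_le_sum fun s _ => mul_le_mul_of_nonneg_left (h1 s) (hw s)
    _ = ∑ s, ∑ t, 2⁻¹ * (w s * if F t = F s then q t ^ 2 else 0) := by
        refine Finset.sum_congr rfl fun s _ => ?_
        simp only [Finset.mul_sum]
        exact Finset.sum_congr rfl fun t _ => by ring
    _ ≤ ∑ s, ∑ t, 2⁻¹ * (C * w t * if F t = F s then q t ^ 2 else 0) := by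
        refine Finset.sum_le_sum fun s _ => Finset.sum_le_sum fun t _ => ?_
        have := hwC s t
        split_ifs
        · gcongr
        · simp
    _ = ∑ t, C * (w t * q t ^ 2) *
          (2⁻¹ * ((Finset.univ.filter fun s => F s = F t).card : ℝ)) := by
        rw [Finset.sum_comm]
        refine Finset.sum_congr rfl fun t _ => ?_
        rw [Finset.card_eq_sum_ones, Nat.cast_sum, Finset.sum_filter, Finset.mul_sum,
          Finset.mul_sum]
        refine Finset.sum_congr rfl fun s _ => ?_
        simp only [eq_comm (a := F t)]
        split_ifs <;> simp; ring
    _ ≤ ∑ t, C * (w t * q t ^ 2) := by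
        refine Finset.sum_le_sum fun t _ => ?_
        have h3 : ((Finset.univ.filter fun s => F s = F t).card : ℝ) ≤ 2 := by
          exact_mod_cast hcard t
        have h4 : 0 ≤ C * (w t * q t ^ 2) := by have := hw t; positivity
        nlinarith
    _ = C * ∑ s, w s * q s ^ 2 := by rw [Finset.mul_sum]

end Fibers

/-! ### The geometry of a mesh -/

section Mesh

variable {c : CellType} {Ω : Set (E d)} {σ : ℝ} {T : Finset (Set (E d))}

/-- An interior point lies strictly inside a segment from any given point of K, so an extreme subset
containing it is all of K. Hence distinct cells of a conforming mesh have disjoint interiors. -/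
theorem subset_of_isExtreme {K K' : Set (E d)}
    (hext : IsExtreme ℝ K (K ∩ K')) {x : E d} (hx : x ∈ interior K) (hx' : x ∈ K') : K ⊆ K' := by
  intro y hy
  have hc : Continuous fun s : ℝ => x + s • (x - y) := by fun_prop
  have h0 : x + (0 : ℝ) • (x - y) ∈ interior K := by simpa using hx
  have h1 : ∀ᶠ s : ℝ in nhdsWithin 0 (Ioi 0), x + s • (x - y) ∈ interior K :=
    ((hc.tendsto 0).eventually (isOpen_interior.mem_nhds h0)).filter_mono nhdsWithin_le_nhds
  obtain ⟨s, hs, hs0⟩ := (h1.and self_mem_nhdsWithin).exists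
  have hs0 : 0 < s := hs0
  have hseg : x ∈ openSegment ℝ y (x + s • (x - y)) := by
    refine ⟨s / (1 + s), 1 / (1 + s), by positivity, by positivity, by field_simp; ring, ?_⟩
    have h1 : (s / (1 + s)) • y + (1 / (1 + s)) • (x + s • (x - y))
        = ((1 + s) / (1 + s)) • x := by
      module
    rw [h1, div_self (by positivity), one_smul]
  exact (hext.left_mem_of_mem_openSegment hy (interior_subset hs)
    ⟨interior_subset hx, hx'⟩ hseg).2

theorem IsMesh.body (hd : d ≠ 0) (hM : IsMesh c Ω σ T) {K : Set (E d)} (hK : K ∈ T) :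
    IsConvexBody K :=
  ((hM.cell K hK).exists_geom hd).some.body

theorem IsMesh.isPartition (hd : d ≠ 0) (hM : IsMesh c Ω σ T) : IsPartition Ω T where
  sub := hM.interior_subset
  disj K hK K' hK' hne := by
    rw [Set.disjoint_left]
    intro x hx hx'
    refine hne (Subset.antisymm ?_ ?_)
    · exact subset_of_isExtreme (hM.conforming K hK K' hK') hx (_root_.interior_subset hx')
    · exact subset_of_isExtreme (hM.conforming K' hK' K hK) hx' (_root_.interior_subset hx)
  null := by
    have h : Ω \ ⋃ K ∈ T, interior K ⊆ ⋃ K ∈ T, frontier K := by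
      rintro x ⟨hx, hx'⟩
      have h1 : x ∈ ⋃ K ∈ T, K := hM.closure_eq ▸ subset_closure hx
      simp only [mem_iUnion] at h1 hx' ⊢
      obtain ⟨K, hK, hxK⟩ := h1
      exact ⟨K, hK, subset_closure hxK, fun h => hx' ⟨K, hK, h⟩⟩
    refine measure_mono_null h ((measure_biUnion_null_iff T.countable_toSet).2 fun K hK => ?_)
    exact (hM.body hd hK).convex.addHaar_frontier _

theorem IsMesh.subset_closure (hM : IsMesh c Ω σ T) {K : Set (E d)} (hK : K ∈ T) :
    K ⊆ closure Ω := by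
  rw [hM.closure_eq]
  exact subset_biUnion_of_mem (u := fun K : Set (E d) => K) hK

theorem diam_le_meshSize {K : Set (E d)} (hK : K ∈ T) : Metric.diam K ≤ meshSize T :=
  le_ciSup (f := fun K : T => Metric.diam (K : Set (E d))) (finite_range _).bddAbove ⟨K, hK⟩

theorem meshSize_nonneg (T : Finset (Set (E d))) : 0 ≤ meshSize T :=
  Real.iSup_nonneg fun _ => Metric.diam_nonneg

theorem IsMesh.meshSize_le (hM : IsMesh c Ω σ T) {R : ℝ} (hR : 0 ≤ R)
    (hΩ : Ω ⊆ Metric.closedBall 0 R) : meshSize T ≤ 2 * R :=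
  Real.iSup_le (fun K => Metric.diam_le_of_subset_closedBall hR
    ((hM.subset_closure K.2).trans (closure_minimal hΩ Metric.isClosed_closedBall)))
    (by positivity)

/-- Every cell lies in a ball of radius h and contains one of radius σh. -/
theorem IsMesh.volume_le (hd : d ≠ 0) (hM : IsMesh c Ω σ T) (hσ : 0 < σ) {K K' : Set (E d)} (hK : K ∈ T)
    (hK' : K' ∈ T) : volume.real K ≤ (σ ^ d)⁻¹ * volume.real K' := by
  obtain ⟨G⟩ := (hM.cell K hK).exists_geom hd
  obtain ⟨G'⟩ := (hM.cell K' hK').exists_geom hd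
  have hh := meshSize_nonneg T
  obtain ⟨x, hx⟩ := hM.quasiUniform K' hK'
  obtain ⟨y, hy⟩ := G.body.nonempty.mono _root_.interior_subset
  have h1 : K ⊆ Metric.closedBall y (meshSize T) := fun z hz =>
    (Metric.dist_le_diam_of_mem G.body.bounded hz hy).trans (diam_le_meshSize hK)
  have h2 := measureReal_mono h1 (μ := volume) (measure_closedBall_lt_top).ne
  have h3 := measureReal_mono hx (μ := volume) G'.isCompact.measure_lt_top.ne
  rw [Measure.addHaar_real_closedBall _ _ hh, finrank_euclideanSpace_fin] at h2
  rw [Measure.addHaar_real_closedBall _ _ (by positivity), finrank_euclideanSpace_fin,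
    mul_pow, mul_assoc] at h3
  rw [inv_mul_eq_div, le_div_iff₀ (by positivity)]
  have : 0 < σ ^ d := by positivity
  nlinarith

end Mesh

/-! ### Size bounds and Green's formula for the Raviart-Thomas fields of a cell. -/

namespace CellGeom

variable {c : CellType} {K K' : Set (E d)} (G : CellGeom c K)

/-- Along the normal the facet function grows with slope ‖nᵢ‖, yet it stays between 0 and 1 on the
inscribed ball. -/
theorem norm_n_mul_le {x : E d} {r : ℝ} (hr : 0 ≤ r) (hx : Metric.closedBall x r ⊆ K)
    (i : FacetIdx d c) : ‖G.n i‖ * r ≤ 1 := by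
  have hn : 0 < ‖G.n i‖ := norm_pos_iff.2 (G.n_ne i)
  have h1 : x + (r * ‖G.n i‖⁻¹) • G.n i ∈ K := by
    refine hx ?_
    rw [Metric.mem_closedBall, dist_eq_norm, add_sub_cancel_left, norm_smul, norm_mul, norm_inv,
      norm_norm, Real.norm_of_nonneg hr, mul_assoc, inv_mul_cancel₀ hn.ne', mul_one]
  have h2 := G.le_one _ h1 i
  have h3 := G.l_nonneg i (hx (Metric.mem_closedBall_self hr))
  have h4 : ⟪G.n i, x + (r * ‖G.n i‖⁻¹) • G.n i⟫_ℝ = ⟪G.n i, x⟫_ℝ + ‖G.n i‖ * r := by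
    rw [inner_add_right, real_inner_smul_right, real_inner_self_eq_norm_sq]
    field_simp
  rw [l] at h3
  linarith

/-- The number γᵢ is the facet function at the origin, possibly far from the cell. The slope is at
most 1/(σh) and the distance at most R, so γᵢ may grow like 1/h, which the factor h from the size of
Xᵢ compensates. -/
theorem abs_γ_mul_le {x : E d} {σ h R : ℝ} (hσ : 0 < σ) (hh : 0 ≤ h) (hh2 : h ≤ 2 * R)
    (hx : Metric.closedBall x (σ * h) ⊆ K) (hK : K ⊆ Metric.closedBall 0 R) (i : FacetIdx d c) :
    |G.γ i| * h ≤ 2 * R + σ⁻¹ * R := by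
  have h1 := G.norm_n_mul_le (by positivity) hx i
  have hxK := hx (Metric.mem_closedBall_self (by positivity))
  have h2 := G.le_one _ hxK i
  have h3 := G.l_nonneg i hxK
  rw [l] at h3
  have h4 := abs_real_inner_le_norm (G.n i) x
  have h5 : ‖x‖ ≤ R := by simpa using hK hxK
  have h6 : |G.γ i| ≤ 1 + ‖G.n i‖ * R := by
    have : ‖G.n i‖ * ‖x‖ ≤ ‖G.n i‖ * R := by gcongr
    obtain ⟨h7, h8⟩ := abs_le.1 h4
    rw [abs_le]
    constructor <;> linarith
  have hR : 0 ≤ R := (norm_nonneg x).trans h5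
  have h7 : ‖G.n i‖ * h ≤ σ⁻¹ := by
    rw [← one_div, le_div_iff₀ hσ]
    linarith
  calc |G.γ i| * h ≤ (1 + ‖G.n i‖ * R) * h := by gcongr
    _ = h + (‖G.n i‖ * h) * R := by ring
    _ ≤ 2 * R + σ⁻¹ * R := by gcongr

theorem norm_X_le {h : ℝ} (hd : Metric.diam K ≤ h) (i : FacetIdx d c) {x : E d} (hx : x ∈ K) :
    ‖G.X i x‖ ≤ h := by
  refine (norm_shapeProj_le c _ _).trans ?_
  rw [← dist_eq_norm]
  exact (Metric.dist_le_diam_of_mem G.body.bounded hx (G.p_mem i)).trans hd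

/-- The Raviart-Thomas field `∑ᵢ aᵢ γᵢ Xᵢ`. -/
def field (a : FacetIdx d c → ℝ) (x : E d) : E d := ∑ i, (a i * G.γ i) • G.X i x

theorem continuous_field (a : FacetIdx d c → ℝ) : Continuous (G.field a) :=
  by
  unfold field
  refine continuous_finsetSum _ fun i _ => ?_
  exact (G.continuous_X i).const_smul (a i * G.γ i)

theorem field_mem (a : FacetIdx d c → ℝ) : G.field a ∈ rt0Fields d c := by
  have : G.field a = ∑ i, (a i * G.γ i) • G.X i := by
    funext x
    simp [field]
  rw [this]
  exact Finset.sum_induction _ (· ∈ rt0Fields d c) (fun _ _ => rt0Fields_add)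
    (zero_mem_rt0Fields c) fun i _ => rt0Fields_smul _ (G.rt0 i)

/-- The divergence of the field `∑ᵢ aᵢ γᵢ Xᵢ`. -/
def fieldDiv (a : FacetIdx d c → ℝ) : ℝ := ∑ i, a i * (shapeDiv d c * G.γ i)

/-- The class of `∑ᵢ aᵢ γᵢ Xᵢ` in `[L²(K)]ᵈ`. -/
def fieldL (a : FacetIdx d c → ℝ) : L2Vec (interior K) :=
  have := G.body.isFiniteMeasure
  (memLp_of_continuous isOpen_interior.measurableSet G.body.bounded_interior
    (G.continuous_field a)).toLp

theorem fieldL_ae (a : FacetIdx d c → ℝ) :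
    G.fieldL a =ᵐ[volume.restrict (interior K)] G.field a :=
  have := G.body.isFiniteMeasure
  (memLp_of_continuous isOpen_interior.measurableSet G.body.bounded_interior
    (G.continuous_field a)).coeFn_toLp

/-- A constant in `L²(K)`. -/
def constCell (s : ℝ) : L2 (interior K) :=
  have := G.body.isFiniteMeasure
  constL (interior K) s

theorem constCell_ae (s : ℝ) : G.constCell s =ᵐ[volume.restrict (interior K)] fun _ => s :=
  have := G.body.isFiniteMeasure
  constL_ae s

theorem setIntegral_interior (G : CellGeom c K) (f : E d → ℝ) : ∫ x in interior K, f x = ∫ x in K, f x :=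
  setIntegral_congr_set (interior_ae_eq_of_null_frontier (G.body.convex.addHaar_frontier _))

theorem volume_interior (G : CellGeom c K) : volume.real (interior K) = volume.real K :=
  measureReal_congr (interior_ae_eq_of_null_frontier (G.body.convex.addHaar_frontier _))

/-- Green's formula on a cell, with the boundary term split into facet fluxes. -/
theorem inner_fieldL_add (a : FacetIdx d c → ℝ) (φ : TestFun d) :
    ⟪G.fieldL a, gradL (interior K) φ⟫_ℝ
      + ⟪G.constCell (G.fieldDiv a), testL (interior K) φ⟫_ℝ
      = ∑ i, a i * (G.γ i * G.J i φ) := by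
  have hcφ := φ.smooth.continuous
  have hcf : Continuous (fderiv ℝ φ) := φ.smooth.continuous_fderiv (by simp)
  have hcX := fun i => G.continuous_X i
  have hcfield := G.continuous_field a
  have hKc := G.isCompact
  rw [inner_gradL, inner_testL]
  have h1 : ∫ x in interior K, ⟪G.fieldL a x, gradient φ x⟫_ℝ
      = ∫ x in K, fderiv ℝ φ x (G.field a x) := by
    rw [← G.setIntegral_interior]
    refine integral_congr_ae ?_
    filter_upwards [G.fieldL_ae a] with x hx
    rw [hx, inner_gradient]
  have h2 : ∫ x in interior K, G.constCell (G.fieldDiv a) x * φ x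
      = ∫ x in K, G.fieldDiv a * φ x := by
    rw [← G.setIntegral_interior]
    refine integral_congr_ae ?_
    filter_upwards [G.constCell_ae (G.fieldDiv a)] with x hx
    rw [hx]
  rw [h1, h2, ← integral_add]
  · have h3 : ∀ i, a i * (G.γ i * G.J i φ) = ∫ x in K, (a i * G.γ i) *
        (fderiv ℝ φ x (G.X i x) + shapeDiv d c * φ x) := fun i => by
      rw [integral_const_mul, J, mul_assoc]
    simp_rw [h3]
    rw [← integral_finsetSum]
    · refine integral_congr_ae (.of_forall fun x => ?_)
      simp only [field, fieldDiv, map_sum, map_smul, smul_eq_mul, Finset.sum_mul,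
        ← Finset.sum_add_distrib]
      exact Finset.sum_congr rfl fun i _ => by ring
    · intro i _
      have := hcX i
      exact (Continuous.continuousOn (by fun_prop)).integrableOn_compact hKc
  · exact (Continuous.continuousOn (by fun_prop)).integrableOn_compact hKc
  · exact (Continuous.continuousOn (by fun_prop)).integrableOn_compact hKc

theorem norm_fieldL_sq_le (a : FacetIdx d c → ℝ) {M : ℝ} (hM : ∀ i, ∀ x ∈ K, ‖G.γ i • G.X i x‖ ≤ M) :
    ‖G.fieldL a‖ ^ 2 ≤
      Fintype.card (FacetIdx d c) * M ^ 2 * ∑ i, volume.real K * a i ^ 2 := by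
  have hb : ∀ x ∈ K, ‖G.field a x‖ ^ 2 ≤
      Fintype.card (FacetIdx d c) * M ^ 2 * ∑ i, a i ^ 2 := by
    intro x hx
    have h1 : ‖G.field a x‖ ≤ ∑ i, |a i| * M := by
      refine (norm_sum_le _ _).trans (Finset.sum_le_sum fun i _ => ?_)
      rw [mul_smul, norm_smul, Real.norm_eq_abs]
      exact mul_le_mul_of_nonneg_left (hM i x hx) (abs_nonneg _)
    rw [← Finset.sum_mul] at h1
    have h2 := sq_sum_le_card_mul_sum_sq (s := Finset.univ) (f := fun i => |a i|)
    simp only [sq_abs, Finset.card_univ] at h2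
    calc ‖G.field a x‖ ^ 2 ≤ ((∑ i, |a i|) * M) ^ 2 := by gcongr
      _ = (∑ i, |a i|) ^ 2 * M ^ 2 := by ring
      _ ≤ (Fintype.card (FacetIdx d c) * ∑ i, a i ^ 2) * M ^ 2 := by gcongr
      _ = _ := by ring
  have hfin := G.isCompact.measure_lt_top (μ := volume)
  have h1 : ‖G.fieldL a‖ ^ 2 = ∫ x in K, ‖G.field a x‖ ^ 2 := by
    rw [← real_inner_self_eq_norm_sq, inner_L2Vec, ← G.setIntegral_interior]
    refine integral_congr_ae ?_
    filter_upwards [G.fieldL_ae a] with x hx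
    rw [hx, real_inner_self_eq_norm_sq]
  rw [h1, ← Finset.mul_sum]
  have h2 := norm_setIntegral_le_of_norm_le_const hfin (f := fun x => ‖G.field a x‖ ^ 2)
    (C := Fintype.card (FacetIdx d c) * M ^ 2 * ∑ i, a i ^ 2) fun x hx => by
      rw [norm_pow, norm_norm]; exact hb x hx
  calc _ ≤ _ := (le_abs_self _).trans h2
    _ = _ := by ring

end CellGeom

end ExpandedMsFEM

end

noncomputable section

namespace ExpandedMsFEM

variable {d : ℕ} {c : CellType} {Ω : Set (E d)} {σ : ℝ} {T : Finset (Set (E d))}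

/-! ### A stable Raviart-Thomas field -/

/-- Facets of the cells of a mesh. -/
def meshFacet (G : ∀ K : T, CellGeom c (K : Set (E d))) (s : Σ _ : T, FacetIdx d c) : Set (E d) :=
  (G s.1).facet s.2

section Facets

variable {G : ∀ K : T, CellGeom c (K : Set (E d))} {s t : Σ _ : T, FacetIdx d c}

/-- Two different facets of one cell cannot coincide, since `(G K).z j` lies on facet j and on no
other. Hence the two indices belong to different cells. -/
theorem IsPartition.disjoint_of_facet_eq (hT : IsPartition Ω T) (hst : s ≠ t)
    (h : meshFacet G s = meshFacet G t) :
    Disjoint (interior (s.1 : Set (E d))) (interior (t.1 : Set (E d))) := by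
  refine hT.disj _ s.1.2 _ t.1.2 fun hcon => ?_
  obtain ⟨K, i⟩ := s
  obtain ⟨K', j⟩ := t
  obtain rfl : K = K' := Subtype.ext hcon
  have hij : i ≠ j := fun hij => hst (by rw [hij])
  have h1 := (G K).z_mem_facet j
  have h2 : (G K).facet i = (G K).facet j := h
  rw [← h2] at h1
  exact ((G K).z_pos j i hij).ne' h1.2

open Classical in
-- Three cells on one facet would have pairwise opposite normals, whereas the composition of two
-- negative ratios is positive.
theorem IsPartition.card_fiber_le (hT : IsPartition Ω T) (s : Σ _ : T, FacetIdx d c) :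
    (Finset.univ.filter fun t => meshFacet G t = meshFacet G s).card ≤ 2 := by
  by_contra! hcon
  obtain ⟨u, hu, v, hv, w, hw, huv, huw, hvw⟩ := Finset.two_lt_card.1 hcon
  replace hu := (Finset.mem_filter.1 hu).2
  replace hv := (Finset.mem_filter.1 hv).2
  replace hw := (Finset.mem_filter.1 hw).2
  obtain ⟨a, ha, ha', -⟩ := CellGeom.exists_neg_of_facet_eq (G := G u.1) (G' := G v.1) (i := u.2)
    v.2 (hT.disjoint_of_facet_eq huv (hu.trans hv.symm)) (hu.trans hv.symm)
  obtain ⟨b, hb, hb', -⟩ := CellGeom.exists_neg_of_facet_eq (G := G v.1) (G' := G w.1) (i := v.2)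
    w.2 (hT.disjoint_of_facet_eq hvw (hv.trans hw.symm)) (hv.trans hw.symm)
  obtain ⟨e, he, he', -⟩ := CellGeom.exists_neg_of_facet_eq (G := G u.1) (G' := G w.1) (i := u.2)
    w.2 (hT.disjoint_of_facet_eq huw (hu.trans hw.symm)) (hu.trans hw.symm)
  rw [he', ha', smul_smul] at hb'
  have := smul_left_injective ℝ ((G u.1).n_ne u.2) hb'
  nlinarith [mul_pos_of_neg_of_neg hb ha]

/-- A facet without partner contains no point of Ω: a relative interior point in Ω would touch a
second cell, and conformity would make the facet common to both. A test function supported in Ω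
therefore vanishes on it. -/
theorem IsMesh.J_eq_zero (hd : d ≠ 0) (hΩ : IsOpen Ω) (hM : IsMesh c Ω σ T)
    (hs : ∀ t, meshFacet G t = meshFacet G s → t = s) {φ : TestFun d} (hφ : tsupport φ ⊆ Ω) :
    (G s.1).J s.2 φ = 0 := by
  have hT := hM.isPartition hd
  refine (G s.1).J_eq_zero s.2 (φ.smooth.of_le (by simp)) fun x hx => ?_
  by_contra h0
  have hxΩ : x ∈ Ω := hφ (subset_tsupport _ h0)
  obtain ⟨z, hzΩ, hz⟩ := CellGeom.exists_relInt_of_mem_open hΩ hx hxΩ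
  obtain ⟨K', hK', hne, hz'⟩ := CellGeom.exists_cell_of_relInt hΩ
    (fun K hK => (G ⟨K, hK⟩).isClosed) (hM.closure_eq ▸ _root_.subset_closure) hzΩ hz
  have hsub := CellGeom.facet_subset_of_relInt_mem hz hz' (hM.conforming _ s.1.2 K' hK')
  obtain ⟨i', hi'⟩ := CellGeom.exists_facet_eq_of_subset (G' := G ⟨K', hK'⟩)
    (hT.disj _ s.1.2 K' hK' hne.symm) (hM.conforming K' hK' _ s.1.2) hsub
  have := hs ⟨⟨K', hK'⟩, i'⟩ hi'.symm
  exact hne (by rw [← this])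

end Facets

/-- The field has normal trace {q} x·n. The weights γᵢ are those of the position field, so its
constant divergence d yields the lower bound. Only the radius of a ball around Ω, σ, d and the
number of facets enter C. -/
theorem exists_stable_field (hd : d ≠ 0) (hΩ : IsOpen Ω) (hΩb : Bornology.IsBounded Ω)
    (c : CellType) (hσ : 0 < σ) : ∃ C : ℝ, 0 ≤ C ∧ ∀ T : Finset (Set (E d)),
      ∀ hM : IsMesh c Ω σ T, ∀ q ∈ Qh Ω T, ∃ τ ∈ HDiv Ω, wdiv τ ∈ Qh Ω T ∧
        (∀ K (hK : K ∈ T), res (hM.interior_subset K hK) τ ∈ RT0 c K) ∧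
        ⟪q, wdiv τ⟫_ℝ = d / 2 * ‖q‖ ^ 2 ∧ ‖τ‖ ^ 2 ≤ C * ‖q‖ ^ 2 := by
  classical
  obtain ⟨R, hR0, hR⟩ : ∃ R : ℝ, 0 ≤ R ∧ Ω ⊆ Metric.closedBall 0 R := by
    obtain ⟨R, hR⟩ := hΩb.subset_closedBall 0
    exact ⟨max R 0, le_max_right _ _, hR.trans (Metric.closedBall_subset_closedBall (le_max_left _ _))⟩
  let M : ℝ := 2 * R + σ⁻¹ * R
  let N : ℝ := (Fintype.card (FacetIdx d c) : ℕ)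
  refine ⟨N * M ^ 2 * ((σ ^ d)⁻¹ * N), by positivity, fun T hM q hq => ?_⟩
  have hT := hM.isPartition hd
  let G : ∀ K : T, CellGeom c (K : Set (E d)) := fun K => ((hM.cell K K.2).exists_geom hd).some
  choose! qv hqv using hq
  have hresq : ∀ K (hK : K ∈ T), res (hT.sub K hK) q = (G ⟨K, hK⟩).constCell (qv K) :=
    fun K hK => (res_eq_iff _).2 ((hqv K hK).trans ((G ⟨K, hK⟩).constCell_ae _).symm)
  let Q : (Σ _ : T, FacetIdx d c) → ℝ := fun s => qv s.1
  -- The facet averages {q} depend on the facet only, which is what makes the glued field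
  -- conforming.
  let a := fiberAvg (meshFacet G) Q
  let v : ∀ K : Set (E d), L2Vec (interior K) := fun K =>
    if hK : K ∈ T then (G ⟨K, hK⟩).fieldL fun i => a ⟨⟨K, hK⟩, i⟩ else 0
  let g : ∀ K : Set (E d), L2 (interior K) := fun K =>
    if hK : K ∈ T then (G ⟨K, hK⟩).constCell ((G ⟨K, hK⟩).fieldDiv fun i => a ⟨⟨K, hK⟩, i⟩) else 0
  have hv : ∀ K (hK : K ∈ T), res (hT.sub K hK) (glue Ω T v)
      = (G ⟨K, hK⟩).fieldL fun i => a ⟨⟨K, hK⟩, i⟩ := fun K hK => by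
    rw [hT.res_glue v hK]; exact dif_pos hK
  have hg : ∀ K (hK : K ∈ T), res (hT.sub K hK) (glue Ω T g)
      = (G ⟨K, hK⟩).constCell ((G ⟨K, hK⟩).fieldDiv fun i => a ⟨⟨K, hK⟩, i⟩) := fun K hK => by
    rw [hT.res_glue g hK]; exact dif_pos hK
  have hconst : ∀ K : T, ∀ r s : ℝ, ⟪(G K).constCell r, (G K).constCell s⟫_ℝ
      = r * s * volume.real (K : Set (E d)) := by
    intro K r s
    rw [inner_L2, ← (G K).volume_interior]
    have : ∫ x in interior (K : Set (E d)), (G K).constCell r x * (G K).constCell s x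
        = ∫ x in interior (K : Set (E d)), r * s := by
      refine integral_congr_ae ?_
      filter_upwards [(G K).constCell_ae r, (G K).constCell_ae s] with x h1 h2
      rw [h1, h2]
    rw [this, setIntegral_const, smul_eq_mul, mul_comm]
  have hweak : IsWeakDiv Ω (glue Ω T v) (glue Ω T g) := by
    rw [isWeakDiv_iff]
    intro φ hφ
    rw [hT.inner_vec, hT.inner_scalar, ← Finset.sum_add_distrib]
    have h1 : ∀ K : T, ⟪res (hT.sub K K.2) (glue Ω T v), res (hT.sub K K.2) (gradL Ω φ)⟫_ℝ
        + ⟪res (hT.sub K K.2) (glue Ω T g), res (hT.sub K K.2) (testL Ω φ)⟫_ℝ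
        = ∑ i, a ⟨K, i⟩ * ((G K).γ i * (G K).J i φ) := by
      intro K
      rw [hv K K.2, hg K K.2, res_gradL, res_testL]
      exact (G K).inner_fieldL_add _ φ
    rw [Finset.sum_congr rfl fun K _ => h1 K, ← Finset.univ_eq_attach]
    have h2 := Fintype.sum_sigma fun s : (Σ _ : T, FacetIdx d c) =>
      a s * ((G s.1).γ s.2 * (G s.1).J s.2 φ)
    refine h2.symm.trans (sum_mul_eq_zero_of_antisymm (F := meshFacet G)
      (fun s t h => fiberAvg_congr Q h) ?_ ?_)
    · intro s t hst h
      exact CellGeom.γ_mul_J_of_facet_eq s.2 (hT.disjoint_of_facet_eq hst.symm h.symm) h.symm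
        (φ.smooth.of_le (by simp))
    · intro s hs
      rw [hM.J_eq_zero hd hΩ hs hφ, mul_zero]
  have hwdiv : wdiv (glue Ω T v) = glue Ω T g := hweak.wdiv_eq hΩ
  have hnorm : ‖q‖ ^ 2 = ∑ K : T, volume.real (K : Set (E d)) * qv K ^ 2 := by
    rw [← real_inner_self_eq_norm_sq, hT.inner_scalar, ← Finset.univ_eq_attach]
    refine Finset.sum_congr rfl fun K _ => ?_
    rw [hresq K K.2, hconst]
    ring
  refine ⟨glue Ω T v, ⟨_, hweak⟩, ?_, ?_, ?_, ?_⟩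
  · intro K hK
    rw [hwdiv]
    exact ⟨_, ((res_eq_iff _).1 (hg K hK)).trans ((G ⟨K, hK⟩).constCell_ae _)⟩
  · intro K hK
    exact ⟨_, (G ⟨K, hK⟩).field_mem _, by rw [hv K hK]; exact (G ⟨K, hK⟩).fieldL_ae _⟩
  · rw [hwdiv, hT.inner_scalar, ← Finset.univ_eq_attach]
    have h1 : ∀ K : T, ⟪res (hT.sub K K.2) q, res (hT.sub K K.2) (glue Ω T g)⟫_ℝ
        = ∑ i, Q ⟨K, i⟩ * a ⟨K, i⟩ * (shapeDiv d c * ((G K).γ i * volume.real (K : Set (E d)))) := by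
      intro K
      rw [hresq K K.2, hg K K.2, hconst, CellGeom.fieldDiv, Finset.mul_sum, Finset.sum_mul]
      exact Finset.sum_congr rfl fun i _ => by ring
    have h2 := Fintype.sum_sigma fun s : (Σ _ : T, FacetIdx d c) =>
      Q s * a s * (shapeDiv d c * ((G s.1).γ s.2 * volume.real (s.1 : Set (E d))))
    have h3 := sum_mul_fiberAvg (F := meshFacet G)
      (f := fun s => shapeDiv d c * ((G s.1).γ s.2 * volume.real (s.1 : Set (E d)))) Q (by
        intro s t hst h
        rw [CellGeom.γ_mul_volume_of_facet_eq (G := G t.1) (G' := G s.1) s.2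
          (hT.disjoint_of_facet_eq hst.symm h.symm) h.symm]
        ring)
    rw [Finset.sum_congr rfl fun K _ => h1 K]
    refine h2.symm.trans (h3.trans ?_)
    rw [Fintype.sum_sigma, hnorm, div_eq_inv_mul, mul_assoc, Finset.mul_sum (a := (d : ℝ))]
    congr 1
    refine Finset.sum_congr rfl fun K _ => ?_
    -- This identity is div x = d in terms of the facet fields.
    rw [← (G K).sum_one]
    simp only [Finset.mul_sum, Finset.sum_mul]
    exact Finset.sum_congr rfl fun i _ => by ring
  · rw [← real_inner_self_eq_norm_sq, hT.inner_vec, ← Finset.univ_eq_attach]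
    have hb : ∀ K : T, ∀ i, ∀ x ∈ (K : Set (E d)), ‖(G K).γ i • (G K).X i x‖ ≤ M := by
      intro K i x hx
      obtain ⟨y, hy⟩ := hM.quasiUniform K K.2
      refine le_trans ?_ ((G K).abs_γ_mul_le hσ (meshSize_nonneg T) (hM.meshSize_le hR0 hR) hy
        ((hM.subset_closure K.2).trans (closure_minimal hR Metric.isClosed_closedBall)) i)
      rw [norm_smul, Real.norm_eq_abs]
      exact mul_le_mul_of_nonneg_left ((G K).norm_X_le (diam_le_meshSize K.2) i hx) (abs_nonneg _)
    have h1 : ∀ K : T, ⟪res (hT.sub K K.2) (glue Ω T v), res (hT.sub K K.2) (glue Ω T v)⟫_ℝ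
        ≤ N * M ^ 2 * ∑ i, volume.real (K : Set (E d)) * a ⟨K, i⟩ ^ 2 := by
      intro K
      rw [hv K K.2, real_inner_self_eq_norm_sq]
      exact (G K).norm_fieldL_sq_le _ (hb K)
    refine (Finset.sum_le_sum fun K _ => h1 K).trans ?_
    rw [← Finset.mul_sum, mul_assoc _ ((σ ^ d)⁻¹ * N)]
    refine mul_le_mul_of_nonneg_left ?_ (by positivity)
    have h2 := Fintype.sum_sigma fun s : (Σ _ : T, FacetIdx d c) =>
      volume.real (s.1 : Set (E d)) * a s ^ 2
    rw [← h2]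
    refine (sum_mul_fiberAvg_sq_le (F := meshFacet G) (fun s => hT.card_fiber_le s) Q
      (w := fun s => volume.real (s.1 : Set (E d))) (fun s => measureReal_nonneg)
      (C := (σ ^ d)⁻¹) (by positivity)
      fun s t => hM.volume_le hd hσ s.1.2 t.1.2).trans ?_
    rw [Fintype.sum_sigma, hnorm, mul_assoc]
    refine mul_le_mul_of_nonneg_left ?_ (by positivity)
    rw [Finset.mul_sum]
    refine Finset.sum_le_sum fun K _ => ?_
    change ∑ _ : FacetIdx d c, volume.real (K : Set (E d)) * qv K ^ 2 ≤ _
    rw [Finset.sum_const, Finset.card_univ, nsmul_eq_mul]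

end ExpandedMsFEM

end

noncomputable section

namespace ExpandedMsFEM

variable {d : ℕ} {c : CellType} {Ω : Set (E d)} {σ kmin kmax : ℝ} {T : Finset (Set (E d))}
  {k : E d → Matrix (Fin d) (Fin d) ℝ}

/-! ### The discrete spaces as finite-dimensional subspaces -/

section Broken

variable {F : Type*} [NormedAddCommGroup F] [NormedSpace ℝ F]

/-- The functions whose restriction to each cell `K` lies in `S K`. -/
def brokenSub (hT : IsPartition Ω T)
    (S : ∀ K : Set (E d), Submodule ℝ (Lp F 2 (volume.restrict (interior K)))) :
    Submodule ℝ (Lp F 2 (volume.restrict Ω)) :=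
  ⨅ K : T, (S K).comap (res (hT.sub K K.2))

theorem mem_brokenSub {hT : IsPartition Ω T}
    {S : ∀ K : Set (E d), Submodule ℝ (Lp F 2 (volume.restrict (interior K)))}
    {u : Lp F 2 (volume.restrict Ω)} :
    u ∈ brokenSub hT S ↔ ∀ K (hK : K ∈ T), res (hT.sub K hK) u ∈ S K := by
  simp [brokenSub, Submodule.mem_iInf]

theorem mem_brokenSub_iff_ae {hT : IsPartition Ω T}
    {S : ∀ K : Set (E d), Submodule ℝ (Lp F 2 (volume.restrict (interior K)))}
    {u : Lp F 2 (volume.restrict Ω)} :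
    u ∈ brokenSub hT S ↔ ∀ K ∈ T, ∃ v ∈ S K, u =ᵐ[volume.restrict (interior K)] v := by
  rw [mem_brokenSub]
  refine forall₂_congr fun K hK => ⟨fun h => ⟨_, h, (res_ae _ u).symm⟩, ?_⟩
  rintro ⟨v, hv, huv⟩
  rwa [(res_eq_iff _).2 huv]

theorem finiteDimensional_brokenSub (hT : IsPartition Ω T)
    (S : ∀ K : Set (E d), Submodule ℝ (Lp F 2 (volume.restrict (interior K))))
    (hS : ∀ K ∈ T, FiniteDimensional ℝ (S K)) : FiniteDimensional ℝ (brokenSub hT S) := by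
  have : ∀ K : T, FiniteDimensional ℝ (S K) := fun K => hS K K.2
  let L : brokenSub hT S →ₗ[ℝ] ∀ K : T, S K := LinearMap.pi fun K =>
    ((res (hT.sub K K.2)).comp (brokenSub hT S).subtype).codRestrict (S K)
      fun u => mem_brokenSub.1 u.2 K K.2
  refine Module.Finite.of_injective L fun u v huv => Subtype.ext (hT.ext fun K hK => ?_)
  exact congrArg Subtype.val (congrFun huv ⟨K, hK⟩)

end Broken

/-- The constants in `L²(D)`. -/
def constSub (D : Set (E d)) : Submodule ℝ (L2 D) where
  carrier := {u | ∃ a : ℝ, u =ᵐ[volume.restrict D] fun _ => a}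
  add_mem' := by
    rintro u v ⟨a, ha⟩ ⟨b, hb⟩
    refine ⟨a + b, ?_⟩
    filter_upwards [ha, hb, Lp.coeFn_add u v] with x h1 h2 h3
    rw [h3, Pi.add_apply, h1, h2]
  zero_mem' := ⟨0, Lp.coeFn_zero _ _ _⟩
  smul_mem' := by
    rintro t u ⟨a, ha⟩
    refine ⟨t * a, ?_⟩
    filter_upwards [ha, Lp.coeFn_smul t u] with x h1 h3
    rw [h3, Pi.smul_apply, h1, smul_eq_mul]

theorem finiteDimensional_constSub (D : Set (E d)) [IsFiniteMeasure (volume.restrict D)] :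
    FiniteDimensional ℝ (constSub D) := by
  refine Submodule.finiteDimensional_of_le (S₂ := ℝ ∙ constL D 1) ?_
  rintro u ⟨a, ha⟩
  refine Submodule.mem_span_singleton.2 ⟨a, ?_⟩
  rw [← constL_eq_smul]
  exact Lp.ext ((constL_ae a).trans ha.symm)

/-- `X_{1,h}` as a subspace. -/
def X1Sub (c : CellType) (k : E d → Matrix (Fin d) (Fin d) ℝ) (hT : IsPartition Ω T) :
    Submodule ℝ (L2Vec Ω) := brokenSub hT (localX1 c k)

/-- `X_{2,h}` as a subspace. -/
def X2Sub (c : CellType) (k : E d → Matrix (Fin d) (Fin d) ℝ) (hT : IsPartition Ω T) :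
    Submodule ℝ (L2Vec Ω) := hdivSub Ω ⊓ brokenSub hT (localX2 c k)

/-- `Q_h` as a subspace. -/
def QSub (hT : IsPartition Ω T) : Submodule ℝ (L2 Ω) :=
  brokenSub hT fun K => constSub (interior K)

theorem mem_X1Sub {hT : IsPartition Ω T} {θ : L2Vec Ω} :
    θ ∈ X1Sub c k hT ↔ θ ∈ X1h c Ω k T := mem_brokenSub_iff_ae

theorem mem_X2Sub {hT : IsPartition Ω T} {u : L2Vec Ω} :
    u ∈ X2Sub c k hT ↔ u ∈ X2h c Ω k T := and_congr_right fun _ => mem_brokenSub_iff_ae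

theorem mem_QSub {hT : IsPartition Ω T} {q : L2 Ω} : q ∈ QSub hT ↔ q ∈ Qh Ω T := by
  rw [QSub, mem_brokenSub]
  refine forall₂_congr fun _ _ => exists_congr fun a => ?_
  exact ⟨(res_ae _ q).symm.trans, (res_ae _ q).trans⟩

theorem finiteDimensional_X1Sub (hd : d ≠ 0) (hM : IsMesh c Ω σ T) (hT : IsPartition Ω T)
    (hk : GoodCoefficient Ω kmin kmax k) : FiniteDimensional ℝ (X1Sub c k hT) :=
  finiteDimensional_brokenSub hT _ fun K hK =>
    finiteDimensional_localX1 (hM.body hd hK) (hk.mono isOpen_interior (hT.sub K hK))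

theorem finiteDimensional_X2Sub (hd : d ≠ 0) (hM : IsMesh c Ω σ T) (hT : IsPartition Ω T)
    (hk : GoodCoefficient Ω kmin kmax k) : FiniteDimensional ℝ (X2Sub c k hT) :=
  have := finiteDimensional_brokenSub hT (localX2 c k) fun K hK =>
    finiteDimensional_localX2 (hM.body hd hK) (hk.mono isOpen_interior (hT.sub K hK))
  Submodule.finiteDimensional_inf_right _ _

theorem finiteDimensional_QSub (hd : d ≠ 0) (hM : IsMesh c Ω σ T) (hT : IsPartition Ω T) :
    FiniteDimensional ℝ (QSub hT) :=
  finiteDimensional_brokenSub hT _ fun _ hK =>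
    have := (hM.body hd hK).isFiniteMeasure
    finiteDimensional_constSub _

theorem wdiv_mem_QSub (hd : d ≠ 0) (hΩ : IsOpen Ω) (hM : IsMesh c Ω σ T) (hT : IsPartition Ω T)
    (hk : GoodCoefficient Ω kmin kmax k) {u : L2Vec Ω} (hu : u ∈ X2Sub c k hT) :
    wdiv u ∈ QSub hT := by
  refine mem_brokenSub.2 fun K hK => ?_
  rw [← (res_mem_HDiv isOpen_interior hΩ (hT.sub K hK) hu.1).2]
  exact localX2_wdiv (hM.body hd hK) (hk.mono isOpen_interior (hT.sub K hK))
    (mem_brokenSub.1 hu.2 K hK)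

/-- Every discrete flux is the image under `k` of a discrete gradient. -/
theorem exists_mem_X1Sub_kMul_eq (hT : IsPartition Ω T) (hk : GoodCoefficient Ω kmin kmax k)
    {u : L2Vec Ω} (hu : u ∈ X2Sub c k hT) : ∃ ζ ∈ X1Sub c k hT, kMul hk ζ = u := by
  -- The preimage is taken globally; since multiplication by k is local and injective on each cell,
  -- its restrictions are forced into the local gradient spaces.
  obtain ⟨ζ, rfl⟩ := kMul_surjective hk u
  refine ⟨ζ, mem_brokenSub.2 fun K hK => ?_, rfl⟩
  have hkK := hk.mono isOpen_interior (hT.sub K hK)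
  have h := mem_brokenSub.1 hu.2 K hK
  rw [res_kMul hkK, localX2_eq_map hkK] at h
  obtain ⟨η, hη, h⟩ := h
  have h1 : kMul hkK (-η) = kMul hkK (res (hT.sub K hK) ζ) := by
    rw [map_neg]; exact h
  rw [← kMul_injective hkK h1]
  exact neg_mem hη

/-- The multiscale counterpart of a broken Raviart-Thomas field in `H(div, Ω)`. -/
theorem exists_mem_X2Sub_wdiv_eq (hd : d ≠ 0) (hΩ : IsOpen Ω) (hM : IsMesh c Ω σ T)
    (hT : IsPartition Ω T) (hk : GoodCoefficient Ω kmin kmax k) {τ : L2Vec Ω} (hτ : τ ∈ HDiv Ω)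
    (hτK : ∀ K (hK : K ∈ T), res (hT.sub K hK) τ ∈ RT0 c K) :
    ∃ u ∈ X2Sub c k hT, wdiv u = wdiv τ ∧ ‖u‖ ≤ kmax / kmin * ‖τ‖ := by
  classical
  have hkK : ∀ K ∈ T, GoodCoefficient (interior K) kmin kmax k :=
    fun K hK => hk.mono isOpen_interior (hT.sub K hK)
  let v : ∀ K : Set (E d), L2Vec (interior K) := fun K =>
    if hK : K ∈ T then basisFlux (hM.body hd hK) (hkK K hK) c ⟨_, hτK K hK⟩ else 0
  have hv : ∀ K (hK : K ∈ T), res (hT.sub K hK) (glue Ω T v)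
      = basisFlux (hM.body hd hK) (hkK K hK) c ⟨_, hτK K hK⟩ := fun K hK => by
    rw [hT.res_glue v hK]; exact dif_pos hK
  have hspec : ∀ K (hK : K ∈ T), ∃ η φ, SolvesBasisEquation k K (res (hT.sub K hK) τ) η
      (res (hT.sub K hK) (glue Ω T v)) φ := fun K hK => by
    rw [hv K hK]; exact basisFlux_spec (hM.body hd hK) (hkK K hK) ⟨_, hτK K hK⟩
  have hweak : IsWeakDiv Ω (glue Ω T v) (wdiv τ) := by
    rw [isWeakDiv_iff]
    intro φ hφ
    have h1 := isWeakDiv_iff.1 (isWeakDiv_wdiv hτ) φ hφ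
    -- On each cell the correction has zero divergence and zero normal trace, so it is orthogonal to
    -- all gradients and gluing creates no jump.
    have h2 : ⟪glue Ω T v - τ, gradL Ω φ⟫_ℝ = 0 := by
      rw [hT.inner_vec]
      refine Finset.sum_eq_zero fun K _ => ?_
      obtain ⟨η, ψ, h⟩ := hspec K K.2
      have h3 := (mem_H0Div_iff.1 h.normal_trace).2 φ
      rwa [h.wdiv_sub_eq_zero, inner_zero_left, add_zero, ← map_sub, ← res_gradL (hT.sub K K.2)]
        at h3
    rw [inner_sub_left] at h2
    linarith
  refine ⟨glue Ω T v, ⟨⟨_, hweak⟩, mem_brokenSub.2 fun K hK => ?_⟩, hweak.wdiv_eq hΩ, ?_⟩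
  · rw [hv K hK, localX2_eq_range (hM.body hd hK) (hkK K hK)]
    exact LinearMap.mem_range_self _ _
  · have hr : 0 ≤ kmax / kmin := div_nonneg hk.pos'.le hk.pos.le
    refine abs_le_of_sq_le_sq' ?_ (by positivity) |>.2
    rw [mul_pow, ← real_inner_self_eq_norm_sq, ← real_inner_self_eq_norm_sq, hT.inner_vec,
      hT.inner_vec, Finset.mul_sum]
    refine Finset.sum_le_sum fun K _ => ?_
    obtain ⟨η, ψ, h⟩ := hspec K K.2
    rw [real_inner_self_eq_norm_sq, real_inner_self_eq_norm_sq, ← mul_pow]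
    have := h.norm_flux_le (hkK K K.2)
    gcongr

end ExpandedMsFEM

end

noncomputable section

namespace ExpandedMsFEM

/-! ### Stability and solvability of a discrete twofold saddle point system -/

section Abstract

variable {V L : Type*} [NormedAddCommGroup V] [InnerProductSpace ℝ V] [NormedAddCommGroup L]
  [InnerProductSpace ℝ L]

/-- The hypotheses on the discrete spaces `X₁`, `X₂`, `P`, the operator `A` and the divergence
`B` on `X₂`. -/
structure IsStableTriple (A : V →L[ℝ] V) (X₁ X₂ : Submodule ℝ V) (P : Submodule ℝ L)
    (B : X₂ →ₗ[ℝ] L) (α β γ : ℝ) : Prop where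
  α_pos : 0 < α
  β_nonneg : 0 ≤ β
  γ_nonneg : 0 ≤ γ
  coercive : ∀ v, α * ‖v‖ ^ 2 ≤ ⟪A v, v⟫_ℝ
  bound : ∀ v, ‖A v‖ ≤ β * ‖v‖
  range : ∀ u, B u ∈ P
  exists_preimage : ∀ u : X₂, ∃ ζ ∈ X₁, A ζ = u
  inf_sup : ∀ q ∈ P, ∃ τ : X₂, ‖q‖ ^ 2 ≤ ⟪q, B τ⟫_ℝ ∧ ‖(τ : V)‖ ≤ γ * ‖q‖

/-- A bound for the gradient variable. -/
def gradientConst (α β γ : ℝ) : ℝ := (1 + β ^ 2 / α + β / α + 2 * γ) / α + 1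

/-- The stability constant. -/
def stabilityConst (α β γ : ℝ) : ℝ :=
  gradientConst α β γ + (β / α * (1 + β * gradientConst α β γ) + 1) +
    (γ * (1 + gradientConst α β γ) + 1)

variable {A : V →L[ℝ] V} {X₁ X₂ : Submodule ℝ V} {P : Submodule ℝ L} {B : X₂ →ₗ[ℝ] L}
  {α β γ : ℝ}

/-- The pressure is bounded by inf-sup and the flux by testing with its preimage under A, each
linearly in ‖θ‖. In the energy estimate for θ these bounds are multiplied by data only, so they can
be absorbed. The residuals have exactly the form produced by a Galerkin error. -/
theorem IsStableTriple.norm_le [FiniteDimensional ℝ P] (h : IsStableTriple A X₁ X₂ P B α β γ)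
    {θ : V} {u : X₂} {p : L} (hθ : θ ∈ X₁) (hp : p ∈ P) {r₁ r₂ : V} {r₃ r₄ : L}
    (h1 : ∀ ξ ∈ X₁, ⟪A θ, ξ⟫_ℝ + ⟪(u : V), ξ⟫_ℝ = ⟪r₁, ξ⟫_ℝ)
    (h2 : ∀ τ : X₂, ⟪θ, (τ : V)⟫_ℝ + ⟪p, B τ⟫_ℝ = ⟪r₂, (τ : V)⟫_ℝ + ⟪r₃, B τ⟫_ℝ)
    (h3 : ∀ q ∈ P, ⟪B u, q⟫_ℝ = ⟪r₄, q⟫_ℝ) :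
    ‖θ‖ + (‖(u : V)‖ + ‖B u‖) + ‖p‖ ≤
      stabilityConst α β γ * (‖r₁‖ + ‖r₂‖ + ‖r₃‖ + ‖r₄‖) := by
  obtain ⟨hα, hβ, hγ, hcoer, hbound, hrange, hpre, hinf⟩ := h
  set R := ‖r₁‖ + ‖r₂‖ + ‖r₃‖ + ‖r₄‖ with hR
  have hn1 := norm_nonneg r₁
  have hn2 := norm_nonneg r₂
  have hn3 := norm_nonneg r₃
  have hn4 := norm_nonneg r₄
  have hR0 : 0 ≤ R := by positivity
  have ht0 := norm_nonneg θ
  have hle_of_sq : ∀ a b : ℝ, 0 ≤ a → 0 ≤ b → a ^ 2 ≤ b * a → a ≤ b := by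
    intro a b ha hb hab
    rcases ha.eq_or_lt with rfl | ha
    · exact hb
    · nlinarith
  have hB : ‖B u‖ ≤ ‖r₄‖ := by
    refine hle_of_sq _ _ (norm_nonneg _) hn4 ?_
    rw [← real_inner_self_eq_norm_sq, h3 _ (hrange u)]
    exact real_inner_le_norm _ _
  -- Since B maps into P, the residual r₃ acts only through its projection and can be moved into the
  -- pressure.
  set e : L := p - P.starProjection r₃ with he
  have heP : e ∈ P := P.sub_mem hp (P.starProjection_apply_mem r₃)
  have h2' : ∀ τ : X₂, ⟪θ, (τ : V)⟫_ℝ + ⟪e, B τ⟫_ℝ = ⟪r₂, (τ : V)⟫_ℝ := by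
    intro τ
    have h4 := P.starProjection_inner_eq_zero r₃ (B τ) (hrange τ)
    rw [inner_sub_left] at h4
    have h5 := h2 τ
    rw [he, inner_sub_left]
    linarith
  have he1 : ‖e‖ ≤ γ * (R + ‖θ‖) := by
    obtain ⟨τ, hτ1, hτ2⟩ := hinf e heP
    refine hle_of_sq _ _ (norm_nonneg _) (by positivity) ?_
    have h4 := h2' τ
    have h5 := real_inner_le_norm r₂ (τ : V)
    have h6 := neg_le_of_abs_le (abs_real_inner_le_norm θ (τ : V))
    have h7 : (‖r₂‖ + ‖θ‖) * ‖(τ : V)‖ ≤ (R + ‖θ‖) * (γ * ‖e‖) := by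
      gcongr
      linarith
    nlinarith
  -- With u = Aζ and ζ in X₁, the test function ζ turns ⟪u, ζ⟫ into ⟪Aζ, ζ⟫, which coercivity bounds
  -- below.
  have hu : ‖(u : V)‖ ≤ β / α * (R + β * ‖θ‖) := by
    obtain ⟨ζ, hζ, hζu⟩ := hpre u
    have h4 := h1 ζ hζ
    have h5 := hcoer ζ
    rw [hζu] at h5
    have h6 := real_inner_le_norm r₁ ζ
    have h7 := neg_le_of_abs_le (abs_real_inner_le_norm (A θ) ζ)
    have h8 : ‖A θ‖ * ‖ζ‖ ≤ β * ‖θ‖ * ‖ζ‖ := by gcongr; exact hbound θ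
    have h9 : ‖ζ‖ ≤ (R + β * ‖θ‖) / α := by
      refine hle_of_sq _ _ (norm_nonneg _) (by positivity) ?_
      rw [div_mul_eq_mul_div, le_div_iff₀ hα]
      have : ‖r₁‖ * ‖ζ‖ ≤ R * ‖ζ‖ := by gcongr; linarith
      nlinarith
    calc ‖(u : V)‖ = ‖A ζ‖ := by rw [hζu]
      _ ≤ β * ‖ζ‖ := hbound ζ
      _ ≤ β * ((R + β * ‖θ‖) / α) := by gcongr
      _ = _ := by ring
  -- Testing with θ and u eliminates ⟪u, θ⟫. What remains is ⟪r₁, θ⟫ - ⟪r₂, u⟫ + ⟪e, B u⟫, with ‖B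
  -- u‖ bounded by the data.
  have hθ1 : α * ‖θ‖ ^ 2 ≤ (1 + β ^ 2 / α + γ) * (R * ‖θ‖) + (β / α + γ) * R ^ 2 := by
    have h4 := h1 θ hθ
    have h5 := h2' u
    rw [real_inner_comm] at h5
    have h6 := hcoer θ
    have h7 := real_inner_le_norm r₁ θ
    have h8 := neg_le_of_abs_le (abs_real_inner_le_norm r₂ (u : V))
    have h9 := real_inner_le_norm e (B u)
    have h10 : ‖r₁‖ * ‖θ‖ ≤ R * ‖θ‖ := by gcongr; linarith
    have h11 : ‖r₂‖ * ‖(u : V)‖ ≤ R * (β / α * (R + β * ‖θ‖)) := by gcongr; linarith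
    have h12 : ‖e‖ * ‖B u‖ ≤ γ * (R + ‖θ‖) * R := by gcongr; linarith
    have h13 : R * ‖θ‖ + R * (β / α * (R + β * ‖θ‖)) + γ * (R + ‖θ‖) * R
      = (1 + β ^ 2 / α + γ) * (R * ‖θ‖) + (β / α + γ) * R ^ 2 := by ring
    linarith
  have hθ2 : ‖θ‖ ≤ gradientConst α β γ * R := by
    rcases le_total ‖θ‖ R with hle | hle
    · refine hle.trans (le_mul_of_one_le_left hR0 ?_)
      rw [gradientConst]
      have : 0 ≤ (1 + β ^ 2 / α + β / α + 2 * γ) / α := by positivity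
      linarith
    · have h4 : ‖θ‖ ≤ (1 + β ^ 2 / α + β / α + 2 * γ) / α * R := by
        refine hle_of_sq _ _ ht0 (by positivity) ?_
        rw [div_mul_eq_mul_div, div_mul_eq_mul_div, le_div_iff₀ hα]
        have h5 : (β / α + γ) * R ^ 2 ≤ (β / α + γ) * (R * ‖θ‖) := by
          rw [sq]; gcongr
        nlinarith
      rw [gradientConst]
      linarith
  have hp1 : ‖p‖ ≤ γ * (R + ‖θ‖) + R := by
    have h4 : p = e + P.starProjection r₃ := by rw [he, sub_add_cancel]
    have h5 := P.norm_starProjection_apply_le r₃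
    have h6 := norm_add_le e (P.starProjection r₃)
    rw [← h4] at h6
    linarith
  have hu' : ‖(u : V)‖ ≤ β / α * (R + β * (gradientConst α β γ * R)) := hu.trans (by gcongr)
  have hp' : ‖p‖ ≤ γ * (R + gradientConst α β γ * R) + R := hp1.trans (by gcongr)
  have hfin : stabilityConst α β γ * R = gradientConst α β γ * R +
      (β / α * (R + β * (gradientConst α β γ * R)) + R) +
      (γ * (R + gradientConst α β γ * R) + R) := by
    rw [stabilityConst]; ring
  rw [hfin]
  linarith

/-- The system maps X₁ × X₂ × P to the product of the duals, of equal dimension, and stability with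
zero data makes it injective. -/
theorem IsStableTriple.exists_solution [FiniteDimensional ℝ X₁] [FiniteDimensional ℝ X₂]
    [FiniteDimensional ℝ P] (h : IsStableTriple A X₁ X₂ P B α β γ) (f : L) :
    ∃ (θ : X₁) (u : X₂) (p : P), (∀ ξ ∈ X₁, ⟪A θ, ξ⟫_ℝ + ⟪(u : V), ξ⟫_ℝ = 0) ∧
      (∀ τ : X₂, ⟪(θ : V), (τ : V)⟫_ℝ + ⟪(p : L), B τ⟫_ℝ = 0) ∧
      ∀ q ∈ P, ⟪B u, q⟫_ℝ = ⟪f, q⟫_ℝ := by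
  let iV : V →ₗ[ℝ] V →ₗ[ℝ] ℝ := innerₗ V
  let iL : L →ₗ[ℝ] L →ₗ[ℝ] ℝ := innerₗ L
  let Z := X₁ × X₂ × P
  let pθ : Z →ₗ[ℝ] V := X₁.subtype ∘ₗ LinearMap.fst ℝ _ _
  let pu : Z →ₗ[ℝ] X₂ := LinearMap.fst ℝ _ _ ∘ₗ LinearMap.snd ℝ _ _
  let pp : Z →ₗ[ℝ] L := P.subtype ∘ₗ LinearMap.snd ℝ _ _ ∘ₗ LinearMap.snd ℝ _ _
  let F₁ : Z →ₗ[ℝ] Module.Dual ℝ X₁ :=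
    (LinearMap.lcomp ℝ ℝ X₁.subtype) ∘ₗ iV ∘ₗ ((A : V →ₗ[ℝ] V) ∘ₗ pθ + X₂.subtype ∘ₗ pu)
  let F₂ : Z →ₗ[ℝ] Module.Dual ℝ X₂ :=
    (LinearMap.lcomp ℝ ℝ X₂.subtype) ∘ₗ iV ∘ₗ pθ + (LinearMap.lcomp ℝ ℝ B) ∘ₗ iL ∘ₗ pp
  let F₃ : Z →ₗ[ℝ] Module.Dual ℝ P := (LinearMap.lcomp ℝ ℝ P.subtype) ∘ₗ iL ∘ₗ B ∘ₗ pu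
  let Φ : Z →ₗ[ℝ] Module.Dual ℝ X₁ × Module.Dual ℝ X₂ × Module.Dual ℝ P := F₁.prod (F₂.prod F₃)
  have hF₁ : ∀ z : Z, ∀ ξ : X₁, F₁ z ξ = ⟪A z.1, (ξ : V)⟫_ℝ + ⟪(z.2.1 : V), (ξ : V)⟫_ℝ :=
    fun z ξ => inner_add_left _ _ _
  have hF₂ : ∀ z : Z, ∀ τ : X₂, F₂ z τ = ⟪(z.1 : V), (τ : V)⟫_ℝ + ⟪(z.2.2 : L), B τ⟫_ℝ :=
    fun z τ => rfl
  have hF₃ : ∀ z : Z, ∀ q : P, F₃ z q = ⟪B z.2.1, (q : L)⟫_ℝ := fun z q => rfl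
  have hinj : Function.Injective Φ := by
    rw [injective_iff_map_eq_zero]
    intro z hz
    have e1 : F₁ z = 0 := congrArg Prod.fst hz
    have e2 : F₂ z = 0 := congrArg (fun w => w.2.1) hz
    have e3 : F₃ z = 0 := congrArg (fun w => w.2.2) hz
    have := h.norm_le (θ := z.1) (u := z.2.1) (p := z.2.2) z.1.2 z.2.2.2 (r₁ := 0) (r₂ := 0)
      (r₃ := 0) (r₄ := 0) (fun ξ hξ => by rw [← hF₁ z ⟨ξ, hξ⟩, e1, inner_zero_left]; rfl)
      (fun τ => by rw [← hF₂ z τ, e2, inner_zero_left, inner_zero_left, add_zero]; rfl)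
      (fun q hq => by rw [← hF₃ z ⟨q, hq⟩, e3, inner_zero_left]; rfl)
    simp only [norm_zero, add_zero, mul_zero] at this
    have n1 := norm_nonneg (z.1 : V)
    have n2 := norm_nonneg (z.2.1 : V)
    have n3 := norm_nonneg (B z.2.1)
    have n4 := norm_nonneg (z.2.2 : L)
    refine Prod.ext (Subtype.ext (norm_le_zero_iff.1 ?_))
      (Prod.ext (Subtype.ext (norm_le_zero_iff.1 ?_)) (Subtype.ext (norm_le_zero_iff.1 ?_))) <;>
    linarith
  have hrank : Module.finrank ℝ Z =
      Module.finrank ℝ (Module.Dual ℝ X₁ × Module.Dual ℝ X₂ × Module.Dual ℝ P) := by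
    simp only [Z, Module.finrank_prod, Subspace.dual_finrank_eq]
  obtain ⟨z, hz⟩ := (LinearMap.injective_iff_surjective_of_finrank_eq_finrank hrank).1 hinj
    (0, 0, iL f ∘ₗ P.subtype)
  have e1 : F₁ z = 0 := congrArg Prod.fst hz
  have e2 : F₂ z = 0 := congrArg (fun w => w.2.1) hz
  have e3 : F₃ z = iL f ∘ₗ P.subtype := congrArg (fun w => w.2.2) hz
  refine ⟨z.1, z.2.1, z.2.2, fun ξ hξ => ?_, fun τ => ?_, fun q hq => ?_⟩
  · rw [← hF₁ z ⟨ξ, hξ⟩, e1]; rfl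
  · rw [← hF₂ z τ, e2]; rfl
  · rw [← hF₃ z ⟨q, hq⟩, e3]; rfl

end Abstract

end ExpandedMsFEM

end

noncomputable section

namespace ExpandedMsFEM

variable {d : ℕ} {c : CellType} {Ω : Set (E d)} {σ kmin kmax : ℝ} {T : Finset (Set (E d))}
  {k : E d → Matrix (Fin d) (Fin d) ℝ}

/-! ### Quasi-optimality -/

theorem xqNorm_add_le (hΩ : IsOpen Ω) {z w : L2Vec Ω × L2Vec Ω × L2 Ω} (hz : z.2.1 ∈ HDiv Ω)
    (hw : w.2.1 ∈ HDiv Ω) : xqNorm (z + w) ≤ xqNorm z + xqNorm w := by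
  have h1 := norm_add_le z.1 w.1
  have h2 := norm_add_le z.2.1 w.2.1
  have h3 := norm_add_le (wdiv z.2.1) (wdiv w.2.1)
  have h4 := norm_add_le z.2.2 w.2.2
  rw [← wdiv_add hΩ hz hw] at h3
  simp only [xqNorm, Prod.fst_add, Prod.snd_add]
  linarith

theorem eq_of_xqNorm_sub_le_zero {z w : L2Vec Ω × L2Vec Ω × L2 Ω} (h : xqNorm (z - w) ≤ 0) :
    z = w := by
  have h1 := norm_nonneg (z.1 - w.1)
  have h2 := norm_nonneg (z.2.1 - w.2.1)
  have h3 := norm_nonneg (wdiv (z.2.1 - w.2.1))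
  have h4 := norm_nonneg (z.2.2 - w.2.2)
  simp only [xqNorm, Prod.fst_sub, Prod.snd_sub] at h
  exact Prod.ext (sub_eq_zero.1 (norm_le_zero_iff.1 (by linarith)))
    (Prod.ext (sub_eq_zero.1 (norm_le_zero_iff.1 (by linarith)))
      (sub_eq_zero.1 (norm_le_zero_iff.1 (by linarith))))

/-- The divergence on `X_{2,h}`. -/
def divX2 (hΩ : IsOpen Ω) (c : CellType) (k : E d → Matrix (Fin d) (Fin d) ℝ)
    (hT : IsPartition Ω T) : X2Sub c k hT →ₗ[ℝ] L2 Ω where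
  toFun u := wdiv (u : L2Vec Ω)
  map_add' u v := wdiv_add hΩ u.2.1 v.2.1
  map_smul' t u := wdiv_smul hΩ t u.2.1

/-- The multiscale spaces are stable, uniformly in the mesh and the coefficient. -/
theorem exists_isStableTriple (hd : 2 ≤ d) (hΩ : IsOpen Ω) (hΩb : Bornology.IsBounded Ω)
    (c : CellType) (hσ : 0 < σ) (kmin kmax : ℝ) : ∃ γ : ℝ, 0 ≤ γ ∧
      ∀ (T : Finset (Set (E d))) (k : E d → Matrix (Fin d) (Fin d) ℝ), IsMesh c Ω σ T →
        ∀ (hk : GoodCoefficient Ω kmin kmax k) (hT : IsPartition Ω T),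
          IsStableTriple (kMul hk) (X1Sub c k hT) (X2Sub c k hT) (QSub hT) (divX2 hΩ c k hT)
            kmin kmax γ := by
  have hd0 : d ≠ 0 := by omega
  obtain ⟨C, hC0, hC⟩ := exists_stable_field hd0 hΩ hΩb c hσ
  -- The absolute value keeps γ nonnegative, since γ is chosen before any coefficient fixes the
  -- signs of kmin and kmax.
  refine ⟨|kmax / kmin| * √C, by positivity, fun T k hM hk hT => ?_⟩
  refine ⟨hk.pos, hk.pos'.le, by positivity, kMul_coercive hk, norm_kMul_le hk,
    fun u => wdiv_mem_QSub hd0 hΩ hM hT hk u.2,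
    fun u => exists_mem_X1Sub_kMul_eq hT hk u.2, fun q hq => ?_⟩
  obtain ⟨τ, hτ, -, hτK, hτq, hτn⟩ := hC T hM q (mem_QSub.1 hq)
  obtain ⟨u, hu, hdiv, hn⟩ := exists_mem_X2Sub_wdiv_eq hd0 hΩ hM hT hk hτ hτK
  refine ⟨⟨u, hu⟩, ?_, ?_⟩
  · change _ ≤ ⟪q, wdiv u⟫_ℝ
    rw [hdiv, hτq]
    -- Here d ≥ 2 makes the constant d/2 at least 1.
    have : (2 : ℝ) ≤ d := by exact_mod_cast hd
    nlinarith [sq_nonneg ‖q‖]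
  · have h1 : ‖τ‖ ≤ √C * ‖q‖ := by
      refine abs_le_of_sq_le_sq' ?_ (by positivity) |>.2
      rwa [mul_pow, Real.sq_sqrt hC0]
    have h2 := abs_of_pos (div_pos hk.pos' hk.pos)
    calc ‖u‖ ≤ kmax / kmin * ‖τ‖ := hn
      _ ≤ |kmax / kmin| * (√C * ‖q‖) := by rw [h2]; have := hk.pos'; have := hk.pos; gcongr
      _ = _ := by ring

section Galerkin

variable {f : L2 Ω} {γ : ℝ} {hΩ : IsOpen Ω} {hT : IsPartition Ω T}
  {hk : GoodCoefficient Ω kmin kmax k}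

theorem IsStableTriple.existence (hd : d ≠ 0) (hM : IsMesh c Ω σ T)
    (h : IsStableTriple (kMul hk) (X1Sub c k hT) (X2Sub c k hT) (QSub hT) (divX2 hΩ c k hT)
      kmin kmax γ) (f : L2 Ω) : ∃ zh, IsMsFEMSolution c k T f zh := by
  have := finiteDimensional_X1Sub hd hM hT hk
  have := finiteDimensional_X2Sub hd hM hT hk
  have := finiteDimensional_QSub hd hM hT
  obtain ⟨θ, u, p, h1, h2, h3⟩ := h.exists_solution f
  refine ⟨⟨θ, u, p⟩, ⟨mem_X1Sub.1 θ.2, mem_X2Sub.1 u.2, mem_QSub.1 p.2⟩, fun ξ hξ => ?_,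
    fun τ hτ => h2 ⟨τ, mem_X2Sub.2 hτ⟩, fun q hq => h3 q (mem_QSub.2 hq)⟩
  rw [kForm_eq hk]
  exact h1 ξ (mem_X1Sub.2 hξ)

/-- The distance of the discrete solution to an arbitrary discrete triple, in terms of a triple
`z` which satisfies the equations tested with the discrete spaces. -/
theorem IsStableTriple.xqNorm_sub_le (hd : d ≠ 0) (hM : IsMesh c Ω σ T)
    (h : IsStableTriple (kMul hk) (X1Sub c k hT) (X2Sub c k hT) (QSub hT) (divX2 hΩ c k hT)
      kmin kmax γ) {S₁ S₂ : Set (L2Vec Ω)} {S : Set (L2 Ω)} (hS₁ : X1h c Ω k T ⊆ S₁)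
    (hS₂ : X2h c Ω k T ⊆ S₂) (hS₂' : S₂ ⊆ HDiv Ω) (hS : Qh Ω T ⊆ S)
    {z zh y : L2Vec Ω × L2Vec Ω × L2 Ω} (hz : SolvesExpandedMixed k f S₁ S₂ S z)
    (hzh : IsMsFEMSolution c k T f zh) (hy : y ∈ XQh c Ω k T) :
    xqNorm (zh - y) ≤ stabilityConst kmin kmax γ * (kmax + 2) * xqNorm (z - y) := by
  have := finiteDimensional_QSub hd hM hT
  obtain ⟨hm1, hm2, hm3⟩ := hzh.mem
  obtain ⟨hy1, hy2, hy3⟩ := hy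
  obtain ⟨-, hz2, -⟩ := hz.mem
  have hz2 := hS₂' hz2
  have hu := (X2Sub c k hT).sub_mem (mem_X2Sub.2 hm2) (mem_X2Sub.2 hy2)
  -- Galerkin orthogonality: z and zh satisfy the same equations against discrete test functions, so
  -- zh - y has the residuals generated by z - y.
  have hmain := h.norm_le (θ := zh.1 - y.1) (u := ⟨zh.2.1 - y.2.1, hu⟩) (p := zh.2.2 - y.2.2)
    ((X1Sub c k hT).sub_mem (mem_X1Sub.2 hm1) (mem_X1Sub.2 hy1))
    ((QSub hT).sub_mem (mem_QSub.2 hm3) (mem_QSub.2 hy3))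
    (r₁ := kMul hk (z.1 - y.1) + (z.2.1 - y.2.1)) (r₂ := z.1 - y.1) (r₃ := z.2.2 - y.2.2)
    (r₄ := wdiv (z.2.1 - y.2.1)) (by
      intro ξ hξ
      have h1 := hz.constitutive ξ (hS₁ (mem_X1Sub.1 hξ))
      have h2 := hzh.constitutive ξ (mem_X1Sub.1 hξ)
      rw [kForm_eq hk] at h1 h2
      simp only [map_sub, inner_add_left, inner_sub_left]
      linarith) (by
      intro τ
      have h1 := hz.gradient τ (hS₂ (mem_X2Sub.1 τ.2))
      have h2 := hzh.gradient τ (mem_X2Sub.1 τ.2)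
      simp only [inner_sub_left]
      change _ - _ + (⟪_, wdiv (τ : L2Vec Ω)⟫_ℝ - ⟪_, wdiv (τ : L2Vec Ω)⟫_ℝ)
        = _ - _ + (⟪_, wdiv (τ : L2Vec Ω)⟫_ℝ - ⟪_, wdiv (τ : L2Vec Ω)⟫_ℝ)
      linarith) (by
      intro q hq
      have h1 := hz.balance q (hS (mem_QSub.1 hq))
      have h2 := hzh.balance q (mem_QSub.1 hq)
      change ⟪wdiv (zh.2.1 - y.2.1), q⟫_ℝ = _
      rw [wdiv_sub hΩ hm2.1 hy2.1, wdiv_sub hΩ hz2 hy2.1, inner_sub_left, inner_sub_left, h1, h2])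
  change xqNorm (zh - y) ≤ _ at hmain
  refine hmain.trans ?_
  have h1 := norm_add_le (kMul hk (z.1 - y.1)) (z.2.1 - y.2.1)
  have h2 := norm_kMul_le hk (z.1 - y.1)
  have hα := hk.pos
  have hβ := hk.pos'
  have hγ := h.γ_nonneg
  have hst : 0 ≤ stabilityConst kmin kmax γ := by
    unfold stabilityConst gradientConst; positivity
  rw [mul_assoc]
  refine mul_le_mul_of_nonneg_left ?_ hst
  have n1 := norm_nonneg (z.1 - y.1)
  have n2 := norm_nonneg (z.2.1 - y.2.1)
  have n3 := norm_nonneg (wdiv (z.2.1 - y.2.1))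
  have n4 := norm_nonneg (z.2.2 - y.2.2)
  simp only [xqNorm, Prod.fst_sub, Prod.snd_sub]
  nlinarith [mul_nonneg hβ.le n1, mul_nonneg hβ.le n2, mul_nonneg hβ.le n3, mul_nonneg hβ.le n4]

end Galerkin

end ExpandedMsFEM

end

/-! ### Unique solvability and quasi-optimality. -/

open ExpandedMsFEM in
theorem theorem4p1 {d : ℕ} (hd : d = 2 ∨ d = 3) (Ω : Set (E d)) (hΩ : IsOpen Ω)
    (hΩb : Bornology.IsBounded Ω) (c : CellType) (σ kmin kmax : ℝ) (hσ : 0 < σ)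
    (hkmin : 0 < kmin) :
    ∃ C : ℝ, 0 < C ∧
      ∀ (T : Finset (Set (E d))) (k : E d → Matrix (Fin d) (Fin d) ℝ) (f : L2 Ω),
        IsMesh c Ω σ T → IsCoefficient Ω kmin kmax k →
          (∃! zh : L2Vec Ω × L2Vec Ω × L2 Ω, IsMsFEMSolution c k T f zh) ∧
          ∀ z zh : L2Vec Ω × L2Vec Ω × L2 Ω,
            IsContinuousSolution k f z → IsMsFEMSolution c k T f zh →
              xqNorm (z - zh) ≤
                C * ⨅ y : XQh c Ω k T, xqNorm (z - (y : L2Vec Ω × L2Vec Ω × L2 Ω)) := by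
  have hd2 : 2 ≤ d := by omega
  have hd0 : d ≠ 0 := by omega
  -- The ordering kmin ≤ kmax is not assumed and can fail for empty Ω; enlarging kmax keeps the
  -- coefficient admissible.
  have hle : kmin ≤ max kmax kmin := le_max_right _ _
  obtain ⟨γ, hγ, hstable⟩ := exists_isStableTriple hd2 hΩ hΩb c hσ kmin (max kmax kmin)
  set C₀ := stabilityConst kmin (max kmax kmin) γ * (max kmax kmin + 2) with hC₀
  have hβ : 0 < max kmax kmin := hkmin.trans_le hle
  have hC₀0 : 0 ≤ C₀ := by
    rw [hC₀]
    unfold stabilityConst gradientConst; positivity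
  -- The 1 comes from the triangle inequality through y, and C₀ from stability applied to zh - y.
  refine ⟨1 + C₀, by positivity, fun T k f hM hk => ?_⟩
  have hg : GoodCoefficient Ω kmin (max kmax kmin) k :=
    ⟨hΩ, hk.mono_max (le_max_left _ _), hkmin, hle⟩
  have hT := hM.isPartition hd0
  have hst := hstable T k hM hg hT
  refine ⟨?_, fun z zh hz hzh => ?_⟩
  · obtain ⟨zh, hzh⟩ := hst.existence hd0 hM f
    refine ⟨zh, hzh, fun w hw => eq_of_xqNorm_sub_le_zero ?_⟩
    -- Uniqueness is the same estimate with the discrete solution zh as both the reference and the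
    -- approximant, so the right side is zero.
    have h1 := hst.xqNorm_sub_le hd0 hM Subset.rfl Subset.rfl (fun u hu => hu.1) Subset.rfl
      hzh hw hzh.mem
    refine h1.trans (le_of_eq ?_)
    simp [xqNorm, wdiv_zero hΩ]
  · have : Nonempty (XQh c Ω k T) := ⟨⟨zh, hzh.mem⟩⟩
    have hle : (1 + C₀)⁻¹ * xqNorm (z - zh) ≤
        ⨅ y : XQh c Ω k T, xqNorm (z - (y : L2Vec Ω × L2Vec Ω × L2 Ω)) := by
      refine le_ciInf fun ⟨y, hy⟩ => ?_
      rw [inv_mul_le_iff₀ (by positivity)]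
      have h1 := hst.xqNorm_sub_le hd0 hM (subset_univ _) (fun u hu => hu.1) Subset.rfl
        (subset_univ _) hz hzh hy
      have hz2 : z.2.1 ∈ ExpandedMsFEM.HDiv Ω := hz.mem.2.1
      have hzy : (z - y).2.1 ∈ ExpandedMsFEM.HDiv Ω := (hdivSub Ω).sub_mem hz2 hy.2.1.1
      have hyz : (y - zh).2.1 ∈ ExpandedMsFEM.HDiv Ω := (hdivSub Ω).sub_mem hy.2.1.1 hzh.mem.2.1.1
      have h3 := xqNorm_add_le hΩ hzy hyz
      rw [sub_add_sub_cancel] at h3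
      have h4 : xqNorm (y - zh) = xqNorm (zh - y) := by
        have h5 : wdiv (y.2.1 - zh.2.1) = -wdiv (zh.2.1 - y.2.1) := by
          rw [wdiv_sub hΩ hy.2.1.1 hzh.mem.2.1.1, wdiv_sub hΩ hzh.mem.2.1.1 hy.2.1.1, neg_sub]
        simp only [xqNorm, Prod.fst_sub, Prod.snd_sub]
        rw [h5, norm_neg, norm_sub_rev y.1, norm_sub_rev y.2.1, norm_sub_rev y.2.2]
      linarith
    rwa [inv_mul_le_iff₀ (by positivity)] at hle
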